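/- **Setting.** Let $(X,Y,\delta)$ be a random triple with covariates $X$, real study variable $Y$ with $E(Y^2)<\infty$, and response indicator $\delta\in\{0,1\}$ (so $Y$ is observed iff $\delta=1$). Let $\pi_0(x)=P(\delta=1\mid X=x)$, and assume missingness at random: $\delta\perp Y\mid X$. Let $(x_i,y_i,\delta_i)$, $i=1,\dots,N$, be i.i.d. copies and $\theta=E(Y)$. Given are an entropy $G:\mathcal V\to\mathbb R$ with $g=G'$, $g'=G''$ and $f=g^{-1}$; basis functions $b(x)=(b_1(x),\dots,b_p(x))^\top$; a weight function $q(x)$; and a response propensity (RP) model $\pi(x,\phi)$, $\phi\in\mathbb R^d$, with gradient $\pi'$ and Hessian $\pi''$ in $\phi$. Put $$z(x,\phi)=\Big(b(x)^\top,\ -g'(1/\pi)\,\pi^{-2}q(x)^{-1}\pi'(x,\phi)^\top,\ g(1/\pi)\,q(x)^{-1}\Big)^\top\in\mathbb R^{p+d+1},\qquad \pi=\pi(x,\phi).$$ **Estimator.** For an estimate $\hat\phi$, let $\hat\omega=(\hat\omega_i:\delta_i=1)$ minimize $\sum_i\delta_iG(\omega_i)q(x_i)^{-1}$ over $\omega_i\in\mathcal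 V$ subject to $\sum_i\delta_i\omega_i z(x_i,\hat\phi)=\sum_i z(x_i,\hat\phi)$, and let $\hat\theta_{\rm GEC}=N^{-1}\sum_i\delta_i\hat\omega_iy_i$ (with an arbitrary value where $1/\pi(x_i,\hat\phi)\notin\mathcal V$ for some $i$ or no minimizer exists). **Conditions.** There are constants $c_0\in(0,1/2)$, $\epsilon>0$, $\tilde c>0$ and a point $\phi_0\in\mathbb R^d$ such that: 1. $\mathcal V\subset(0,\infty)$ is an open interval, and $G$ is three times continuously differentiable and strictly convex on $\mathcal V$ with $G''>0$. 2. Almost surely $c_0\le\pi_0(X)\le1-c_0$ and $c_0\le q(X)\le c_0^{-1}$, and $1/\pi_0(X)$ lies almost surely in some compact subset of $\mathcal V$ (automatic if $\mathcal V=(0,\infty)$ or $(1,\infty)$). 3. $\pi(x,\cdot)$ is twice continuously differentiable; $E\sup_{\|\phi-\phi_0\|\le\epsilon}\|\pi'(X,\phi)\|^{4+\tilde c}<\infty$; $E\sup_{\|\phi-\phi_0\|\le\epsilon}\|\pi''(X,\phi)\|_{\rm F}^{2+\tilde c}<\infty$; $c_0\le\pi(X,\phi_0)\le1-c_0$ almost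 surely; and $\|\hat\phi-\phi_0\|=O_p(N^{-1/2})$. 4. With $z^*=z(X,\phi_0)$, there is a unique $\lambda^*$ such that $\lambda^{*\top}z^*q(X)\in g(\mathcal V)$ almost surely and $E\{\delta f(\lambda^{*\top}z^*q(X))z^*\}=E(z^*)$ (with these expectations existing); and, with $\omega^*=f(\lambda^{*\top}z^*q(X))$, the matrix $\Gamma^*=E[\pi_0(X)\{g'(\omega^*)q(X)^{-1}\}^{-1}z^*z^{*\top}]$ is invertible. Put $\gamma^*=(\Gamma^*)^{-1}E[\pi_0(X)\{g'(\omega^*)q(X)^{-1}\}^{-1}z^*Y]$. 5. $E|b_j(X)|^{2+\tilde c}<\infty$ for all $j$, and $E(z^*z^{*\top})$ is positive definite. **Claim.** If the RP model is correct with true parameter $\phi_0$, i.e. $\pi_0(X)=\pi(X,\phi_0)$ almost surely, then, with $z_i^*=z(x_i,\phi_0)$, $$\hat\theta_{\rm GEC}=\frac1N\sum_{i=1}^N\delta_i\pi_0^{-1}(x_i)y_i+\frac1N\sum_{i=1}^N\{1-\delta_i\pi_0^{-1}(x_i)\}z_i^{*\top}\gamma^*+o_p(N^{-1/2}).$$ Moreover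 $\sqrt N(\hat\theta_{\rm GEC}-\theta)\to N(0,V_{\rm GEC})$ in distribution, where $V_{\rm GEC}=\mathrm{Var}\{\delta\omega^*Y+(1-\delta\omega^*)z^{*\top}\gamma^*\}$, and $$V_{\rm GEC}=\mathrm{Var}(Y)+E\big[\{\pi_0^{-1}(X)-1\}\{Y-z(X,\phi_0)^\top\gamma^*\}^2\big],$$ the last expectation being finite. -/

import Mathlib

open MeasureTheory ProbabilityTheory Filter Topology

noncomputable section

/-- One unit `(x, y, δ)`: covariates, study variable, response indicator. -/
abbrev Obs (𝓧 : Type*) : Type _ := 𝓧 × ℝ × Bool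

namespace Obs

variable {𝓧 : Type*}

/-- The covariates of a unit. -/
def x (o : Obs 𝓧) : 𝓧 := o.1

/-- The study variable of a unit. -/
def y (o : Obs 𝓧) : ℝ := o.2.1

/-- The response indicator, as a truth value. -/
def resp (o : Obs 𝓧) : Bool := o.2.2

/-- The response indicator, as the number `1` or `0`. -/
def δ (o : Obs 𝓧) : ℝ := if o.2.2 = true then 1 else 0

end Obs

/-- The index set of the `p + d + 1` calibration covariates. -/
abbrev ZIdx (p d : ℕ) : Type := Fin p ⊕ Fin d ⊕ Unit

/-- The functions that the analyst chooses: an entropy `G` on the domain `V`, basis functions `b`,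
an entropy weight `q` and a response propensity model `ps x φ`. -/
structure GECSpec (𝓧 : Type*) (p d : ℕ) where
  V : Set ℝ
  G : ℝ → ℝ
  b : 𝓧 → Fin p → ℝ
  q : 𝓧 → ℝ
  ps : 𝓧 → EuclideanSpace ℝ (Fin d) → ℝ

namespace GECSpec

variable {𝓧 : Type*} {p d : ℕ} (M : GECSpec 𝓧 p d)

/-- `g = G'`; the domain is open in all uses, so that this does not depend on `G` outside `V`. -/
def g : ℝ → ℝ := deriv M.G

/-- `g' = G''`. -/
def g' : ℝ → ℝ := deriv M.g

/-- `f = g⁻¹`, the inverse of `g : V → g(V)`. -/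
def f : ℝ → ℝ := Function.invFunOn M.g M.V

/-- The gradient of the propensity model in the parameter. -/
def ps' (x : 𝓧) (φ : EuclideanSpace ℝ (Fin d)) : EuclideanSpace ℝ (Fin d) :=
  gradient (M.ps x) φ

/-- The Frobenius norm of the Hessian of the propensity model in the parameter. -/
def hessFrob (x : 𝓧) (φ : EuclideanSpace ℝ (Fin d)) : ℝ :=
  √(∑ j : Fin d, ‖fderiv ℝ (M.ps' x) φ (EuclideanSpace.single j 1)‖ ^ 2)

/-- The calibration covariates `z(φ) = (b, - g'(1/π) π⁻² q⁻¹ π', g(1/π) q⁻¹)` with `π = π(x, φ)`. -/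
def z (φ : EuclideanSpace ℝ (Fin d)) (x : 𝓧) : ZIdx p d → ℝ :=
  Sum.elim (M.b x)
    (Sum.elim
      (fun j => -(M.g' (M.ps x φ)⁻¹) * ((M.ps x φ) ^ 2)⁻¹ * (M.q x)⁻¹ * M.ps' x φ j)
      (fun _ => M.g (M.ps x φ)⁻¹ * (M.q x)⁻¹))

/-! ### The estimator -/

/-- Weights on a sample that lie in `V` for the respondents and satisfy the balancing, the
orthogonal and the debiasing calibration constraints. -/
def Feasible {N : ℕ} (φ : EuclideanSpace ℝ (Fin d)) (s : Fin N → Obs 𝓧) :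
    Set (Fin N → ℝ) :=
  {w | (∀ i, (s i).resp = true → w i ∈ M.V) ∧
    ∀ k, ∑ i, (s i).δ * w i * M.z φ (s i).x k = ∑ i, M.z φ (s i).x k}

/-- The generalized entropy of the weights of the respondents. -/
def entropy {N : ℕ} (s : Fin N → Obs 𝓧) (w : Fin N → ℝ) : ℝ :=
  ∑ i, (s i).δ * M.G (w i) * (M.q (s i).x)⁻¹

/-- `w` solves the calibration problem on the sample `s` with estimated parameter `φ`. The problem
makes sense only if the initial weights `1 / π(xᵢ, φ)` lie in the domain of `G`. -/
def IsGECWeights {N : ℕ} (φ : EuclideanSpace ℝ (Fin d)) (s : Fin N → Obs 𝓧)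
    (w : Fin N → ℝ) : Prop :=
  (∀ i, (M.ps (s i).x φ)⁻¹ ∈ M.V) ∧ w ∈ M.Feasible φ s ∧ IsMinOn (M.entropy s) (M.Feasible φ s) w

/-! ### Population quantities -/

/-- The limiting weight `ω* = f(λᵀ z(φ) q)`. -/
def omega (lam : ZIdx p d → ℝ) (φ : EuclideanSpace ℝ (Fin d)) (x : 𝓧) : ℝ :=
  M.f ((lam ⬝ᵥ M.z φ x) * M.q x)

variable [MeasurableSpace 𝓧]

/-- `lam` solves the population dual problem, through its first-order condition
`E {δ f(λᵀ z q) z} = E z`. -/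
structure IsPopLambda (P : Measure (Obs 𝓧)) (φ : EuclideanSpace ℝ (Fin d))
    (lam : ZIdx p d → ℝ) : Prop where
  mem_range : ∀ᵐ o ∂P, (lam ⬝ᵥ M.z φ o.x) * M.q o.x ∈ M.g '' M.V
  integrable_z : ∀ k, Integrable (fun o => M.z φ o.x k) P
  integrable_wz : ∀ k, Integrable (fun o => o.δ * M.omega lam φ o.x * M.z φ o.x k) P
  calibration : ∀ k, ∫ o, o.δ * M.omega lam φ o.x * M.z φ o.x k ∂P = ∫ o, M.z φ o.x k ∂P

/-- `Γ* = E [π₀ {g'(ω*) q⁻¹}⁻¹ z zᵀ]`. -/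
def Gam (P : Measure (Obs 𝓧)) (π₀ : 𝓧 → ℝ) (lam : ZIdx p d → ℝ)
    (φ : EuclideanSpace ℝ (Fin d)) : Matrix (ZIdx p d) (ZIdx p d) ℝ :=
  Matrix.of fun j k => ∫ o, π₀ o.x * (M.g' (M.omega lam φ o.x) * (M.q o.x)⁻¹)⁻¹ *
    (M.z φ o.x j * M.z φ o.x k) ∂P

/-- `γ* = (Γ*)⁻¹ E [π₀ {g'(ω*) q⁻¹}⁻¹ z y]`. -/
def gam (P : Measure (Obs 𝓧)) (π₀ : 𝓧 → ℝ) (lam : ZIdx p d → ℝ)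
    (φ : EuclideanSpace ℝ (Fin d)) : ZIdx p d → ℝ :=
  Matrix.mulVec (M.Gam P π₀ lam φ)⁻¹ fun k =>
    ∫ o, π₀ o.x * (M.g' (M.omega lam φ o.x) * (M.q o.x)⁻¹)⁻¹ * (M.z φ o.x k * o.y) ∂P

/-- `Σ_z = E (z zᵀ)`. -/
def Sig (P : Measure (Obs 𝓧)) (φ : EuclideanSpace ℝ (Fin d)) :
    Matrix (ZIdx p d) (ZIdx p d) ℝ :=
  Matrix.of fun j k => ∫ o, M.z φ o.x j * M.z φ o.x k ∂P

/-- `V_GEC = Var {δ ω* y + (1 - δ ω*) zᵀ γ*}`. -/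
def VGEC (P : Measure (Obs 𝓧)) (π₀ : 𝓧 → ℝ) (lam : ZIdx p d → ℝ)
    (φ : EuclideanSpace ℝ (Fin d)) : ℝ :=
  variance (fun o : Obs 𝓧 => o.δ * M.omega lam φ o.x * o.y +
    (1 - o.δ * M.omega lam φ o.x) * (M.z φ o.x ⬝ᵥ M.gam P π₀ lam φ)) P

/-! ### The regularity conditions -/

/-- Measurability of the chosen functions. -/
structure MeasurabilityCond : Prop where
  b : ∀ j, Measurable fun x => M.b x j
  q : Measurable M.q
  ps : ∀ φ, Measurable fun x => M.ps x φ

/-- The entropy: `V` is an open interval in `(0, ∞)`, and `G` is smooth enough and strictly convex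
on `V`, with `G'' > 0`. -/
structure EntropyCond : Prop where
  isOpen : IsOpen M.V
  ordConnected : M.V.OrdConnected
  pos : M.V ⊆ Set.Ioi 0
  contDiffOn : ContDiffOn ℝ 3 M.G M.V
  strictConvexOn : StrictConvexOn ℝ M.V M.G
  deriv2_pos : ∀ w ∈ M.V, 0 < M.g' w

/-- Overlap of the true propensity score, and bounded entropy weights. -/
structure OverlapCond (P : Measure (Obs 𝓧)) (π₀ : 𝓧 → ℝ) (c₀ : ℝ) : Prop where
  overlap : ∀ᵐ o ∂P, c₀ ≤ π₀ o.x ∧ π₀ o.x ≤ 1 - c₀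
  domain : ∃ K : Set ℝ, IsCompact K ∧ K ⊆ M.V ∧ ∀ᵐ o ∂P, (π₀ o.x)⁻¹ ∈ K
  weight : ∀ᵐ o ∂P, c₀ ≤ M.q o.x ∧ M.q o.x ≤ c₀⁻¹

/-- Smoothness and moments of the propensity model near the limit `φs` of the estimated parameter,
overlap at `φs`. -/
structure PropensityCond (P : Measure (Obs 𝓧)) (φs : EuclideanSpace ℝ (Fin d))
    (c₀ c ε : ℝ) : Prop where
  contDiff : ∀ x, ContDiff ℝ 2 (M.ps x)
  moment_grad :
    ∫⁻ o, ⨆ φ ∈ Metric.closedBall φs ε, ENNReal.ofReal (‖M.ps' o.x φ‖ ^ (4 + c)) ∂P < ⊤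
  moment_hess :
    ∫⁻ o, ⨆ φ ∈ Metric.closedBall φs ε, ENNReal.ofReal (M.hessFrob o.x φ ^ (2 + c)) ∂P < ⊤
  overlap : ∀ᵐ o ∂P, c₀ ≤ M.ps o.x φs ∧ M.ps o.x φs ≤ 1 - c₀

/-- `lam` is the unique population value of the multiplier, and the population value `gam` of the
regression coefficient is uniquely determined. -/
structure NuisanceCond (P : Measure (Obs 𝓧)) (π₀ : 𝓧 → ℝ) (lam : ZIdx p d → ℝ)
    (φs : EuclideanSpace ℝ (Fin d)) : Prop where
  lam_isPop : M.IsPopLambda P φs lam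
  lam_unique : ∀ lam', M.IsPopLambda P φs lam' → lam' = lam
  gam_unique : IsUnit (M.Gam P π₀ lam φs).det

/-- Moments of the basis functions, and nondegenerate calibration covariates. -/
structure CovariateCond (P : Measure (Obs 𝓧)) (φs : EuclideanSpace ℝ (Fin d)) (c : ℝ) :
    Prop where
  moment : ∀ j, ∫⁻ o, ENNReal.ofReal (|M.b o.x j| ^ (2 + c)) ∂P < ⊤
  posDef : (M.Sig P φs).PosDef

end GECSpec

/-- `Xₙ = O_p(rₙ)` for a sequence of random vectors and a positive deterministic sequence. -/
def IsBigOInProb {Ω E : Type*} [MeasurableSpace Ω] [Norm E] (μ : Measure Ω) (X : ℕ → Ω → E)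
    (r : ℕ → ℝ) : Prop :=
  ∀ η : ENNReal, 0 < η → ∃ C : ℝ, ∀ᶠ n in atTop, μ {ω | C * r n < ‖X n ω‖} ≤ η

/-- `Xₙ = o_p(rₙ)` for a sequence of random variables and a positive deterministic sequence. -/
def IsLittleOInProb {Ω : Type*} [MeasurableSpace Ω] (μ : Measure Ω) (X : ℕ → Ω → ℝ)
    (r : ℕ → ℝ) : Prop :=
  TendstoInMeasure μ (fun n ω => X n ω / r n) atTop (fun _ => 0)

/-- `π₀` is the true propensity score `P(δ = 1 ∣ X = x)`. -/
def IsPropensityScore {𝓧 : Type*} [MeasurableSpace 𝓧] (P : Measure (Obs 𝓧)) (π₀ : 𝓧 → ℝ) :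
    Prop :=
  Measurable π₀ ∧
    condExp (MeasurableSpace.comap (Obs.x (𝓧 := 𝓧)) inferInstance) P Obs.δ =ᵐ[P]
      fun o => π₀ o.x

theorem Obs.measurable_x {𝓧 : Type*} [MeasurableSpace 𝓧] : Measurable (Obs.x (𝓧 := 𝓧)) :=
  measurable_fst

/-- Missing at random: `δ` and `Y` are conditionally independent given `X`. -/
def IsMAR {𝓧 : Type*} [MeasurableSpace 𝓧] [StandardBorelSpace 𝓧] (P : Measure (Obs 𝓧))
    [IsFiniteMeasure P] : Prop :=
  CondIndepFun (MeasurableSpace.comap (Obs.x (𝓧 := 𝓧)) inferInstance)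
    Obs.measurable_x.comap_le (Obs.resp (𝓧 := 𝓧)) (Obs.y (𝓧 := 𝓧)) P

end

/-! Write `e` for the multiplier `debiasVec` that selects the debiasing covariate. Since `e·z(x,φ)
q(x) = g(1/π(x,φ))`, this multiplier produces the inverse propensity weight `1/π(x,φ)`. When the
propensity model is correct, these weights calibrate in expectation by missingness at random, so
uniqueness forces `λ* = e` and `ω* = 1/π₀`.

In the sample, convexity of `G` makes every root `λ` of the calibration equations of the form `ωᵢ =
f(λ·z(xᵢ,φ̂) qᵢ)` a solution of the minimization problem (`isGECWeights_of_dual`). At such a root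
the estimator equals the average of `δωY - γ*·(δω - 1)z`, because the second term averages to zero.
The calibration equations and this regression form are the two components of `score`, a function of
`θ = (λ, φ)`.

The expected derivative of `score` at `(e, φ₀)` carries the argument. In the first component, its
`λ`-block is `Γ*`, which is invertible. The second component vanishes in all directions, including
those of `φ` (`integral_scoreDeriv_snd`): the `φ`-derivative of the debiasing covariate is a
combination of the orthogonality covariates, so a change of `φ` moves `ω` as a change of `λ` does,
and the normal equations for `γ*` annihilate both; what remains has the factor `δ/π₀ - 1` and mean
zero. Hence estimating `φ` and `λ` has no first-order effect on the estimator.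

To turn this into an expansion, averages of `score` must be close to linear on balls of radius
`C/√N` (`tendsto_measure_not_approximatesLinearOn_average`). The score of a unit is controlled only
on a ball of radius proportional to `1/Q(x)`, but the envelope `Q` is square integrable, so `max
Q(xᵢ) = o_p(√N)` and all units are controlled at once. A quantitative inverse function argument then
gives a root with `φ = φ̂` in the ball (`exists_zero_of_isBigOInProb`), and the second component
differs there from its value at `(e, φ₀)` by `o(N^{-1/2})`. That value is the average of the
influence function `Y + (δ/π₀ - 1)(Y - z·γ*)`. The central limit theorem gives normality, and the
two summands are uncorrelated, which gives the variance formula. -/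

noncomputable section

/-! ### Maxima and averages of an i.i.d. sample -/

section IIDSample

variable {S Ω : Type*} [MeasurableSpace S] [MeasurableSpace Ω] {P : Measure S} {μ : Measure Ω}
  {O : ℕ → Ω → S}

theorem ProbabilityTheory.HasLaw.ae_comp {X : Ω → S} (h : HasLaw X P μ) {p : S → Prop}
    (hp : ∀ᵐ o ∂P, p o) : ∀ᵐ ω ∂μ, p (X ω) :=
  ae_of_ae_map h.aemeasurable (by rwa [h.map_eq])

/-- The maximum of `N` copies of a square integrable variable is `o_p(√N)`: by the union bound the
probability is at most `N P(W > √N) ≤ E[W² 1{W > √N}]`, which tends to zero by dominated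
convergence. -/
theorem tendsto_measure_exists_sqrt_lt (hlaw : ∀ i, HasLaw (O i) P μ) {W : S → ℝ}
    (hWm : Measurable W) (hW : MemLp W 2 P) :
    Tendsto (fun N : ℕ => μ {ω | ∃ i < N, √(N : ℝ) < W (O i ω)}) atTop (𝓝 0) := by
  have hfin : ∫⁻ o, ENNReal.ofReal (W o ^ 2) ∂P ≠ ⊤ :=
    hW.integrable_sq.lintegral_lt_top.ne
  have hms : ∀ N : ℕ, MeasurableSet {o | √(N : ℝ) < W o} := fun N =>
    measurableSet_lt measurable_const hWm
  have hlim : Tendsto (fun N : ℕ => ∫⁻ o, {o | √(N : ℝ) < W o}.indicator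
      (fun o => ENNReal.ofReal (W o ^ 2)) o ∂P) atTop (𝓝 (∫⁻ _, 0 ∂P)) := by
    refine tendsto_lintegral_of_dominated_convergence'
      (fun o => ENNReal.ofReal (W o ^ 2)) ?_ ?_ hfin ?_
    · intro N
      exact (((hWm.pow_const 2).ennreal_ofReal).indicator (hms N)).aemeasurable
    · intro N
      exact ae_of_all _ fun o => Set.indicator_le_self _ _ _
    · refine ae_of_all _ fun o => ?_
      refine tendsto_const_nhds.congr' ?_
      have : Tendsto (fun N : ℕ => √(N : ℝ)) atTop atTop :=
        Real.tendsto_sqrt_atTop.comp tendsto_natCast_atTop_atTop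
      filter_upwards [this.eventually_ge_atTop (W o)] with N hN
      rw [Set.indicator_of_notMem]
      simpa using hN
  rw [lintegral_zero] at hlim
  refine tendsto_of_tendsto_of_tendsto_of_le_of_le tendsto_const_nhds hlim (fun _ => zero_le) ?_
  intro N
  calc μ {ω | ∃ i < N, √(N : ℝ) < W (O i ω)}
      ≤ ∑ i ∈ Finset.range N, μ {ω | √(N : ℝ) < W (O i ω)} := by
        refine le_trans (measure_mono ?_) (measure_biUnion_finset_le _ _)
        rintro ω ⟨i, hi, h⟩
        simp only [Set.mem_iUnion]
        exact ⟨i, Finset.mem_range.2 hi, h⟩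
    _ = N * P {o | √(N : ℝ) < W o} := by
        simp [(hlaw _).measure_eq (hms N)]
    _ = ∫⁻ o, {o | √(N : ℝ) < W o}.indicator (fun _ => (N : ENNReal)) o ∂P := by
        rw [lintegral_indicator_const (hms N)]
    _ ≤ _ := by
        refine lintegral_mono fun o => Set.indicator_le_indicator' ?_
        intro h
        have h' : √(N : ℝ) < W o := h
        have : (N : ℝ) ≤ W o ^ 2 := by
          have := Real.sq_sqrt (Nat.cast_nonneg (α := ℝ) N)
          nlinarith [Real.sqrt_nonneg (N : ℝ)]
        calc (N : ENNReal) = ENNReal.ofReal N := by simp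
          _ ≤ _ := ENNReal.ofReal_le_ofReal this

/-- Markov's inequality. The summands may change with `N`, so the law of large numbers does not
apply; convergence of the means to zero is enough. -/
theorem tendsto_measure_average_ge (hlaw : ∀ i, HasLaw (O i) P μ) {m : ℕ → S → ENNReal}
    (hm : ∀ N, AEMeasurable (m N) P) (hlim : Tendsto (fun N => ∫⁻ o, m N o ∂P) atTop (𝓝 0))
    {κ : ENNReal} (hκ : κ ≠ 0) (hκ' : κ ≠ ⊤) :
    Tendsto (fun N : ℕ => μ {ω | κ ≤ (N : ENNReal)⁻¹ * ∑ i ∈ Finset.range N, m N (O i ω)})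
      atTop (𝓝 0) := by
  have h2 : Tendsto (fun N => (∫⁻ o, m N o ∂P) / κ) atTop (𝓝 0) := by
    have := ENNReal.Tendsto.div_const hlim (Or.inr hκ)
    simpa using this
  refine tendsto_of_tendsto_of_tendsto_of_le_of_le tendsto_const_nhds h2 (fun _ => zero_le) ?_
  intro N
  have hmO : ∀ i, AEMeasurable (fun ω => m N (O i ω)) μ := fun i =>
    AEMeasurable.comp_aemeasurable (by rw [(hlaw i).map_eq]; exact hm N) (hlaw i).aemeasurable
  refine (meas_ge_le_lintegral_div ?_ hκ hκ').trans ?_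
  · exact (Finset.aemeasurable_fun_sum _ fun i _ => hmO i).const_mul _
  · refine ENNReal.div_le_div_right ?_ _
    rw [lintegral_const_mul'' _ (Finset.aemeasurable_fun_sum _ fun i _ => hmO i),
      lintegral_finsetSum' _ (fun i _ => hmO i)]
    simp only [(hlaw _).lintegral_comp (hm N), Finset.sum_const, Finset.card_range, nsmul_eq_mul]
    rw [← mul_assoc]
    exact mul_le_of_le_one_left zero_le (ENNReal.inv_mul_le_one _)

variable [IsProbabilityMeasure μ]

theorem tendsto_measure_norm_average_sub_integral_gt {G : Type*} [NormedAddCommGroup G]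
    [NormedSpace ℝ G] [CompleteSpace G] [SecondCountableTopology G]
    (hlaw : ∀ i, HasLaw (O i) P μ) (hindep : iIndepFun O μ)
    {D : S → G} (hD : Integrable D P) {κ : ℝ} (hκ : 0 < κ) :
    Tendsto (fun N : ℕ => μ {ω | κ ≤ ‖(N : ℝ)⁻¹ • ∑ i ∈ Finset.range N, D (O i ω) - ∫ o, D o ∂P‖})
      atTop (𝓝 0) := by
  borelize G
  have hDm : ∀ i, AEMeasurable D (Measure.map (O i) μ) := fun i => by
    rw [(hlaw i).map_eq]; exact hD.1.aemeasurable
  have hint : ∀ i, Integrable (fun ω => D (O i ω)) μ := fun i => by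
    have : Integrable D (Measure.map (O i) μ) := by rwa [(hlaw i).map_eq]
    exact this.comp_aemeasurable (hlaw i).aemeasurable
  have hslln := strong_law_ae (μ := μ) (fun i ω => D (O i ω)) (hint 0) ?_ ?_
  · have h0 : ∫ ω, D (O 0 ω) ∂μ = ∫ o, D o ∂P := (hlaw 0).integral_comp hD.1
    rw [h0] at hslln
    have := tendstoInMeasure_of_tendsto_ae (fun n => ?_) hslln
    · rw [tendstoInMeasure_iff_norm] at this
      exact this κ hκ
    · exact (Finset.aestronglyMeasurable_fun_sum _ fun i _ => (hint i).1).const_smul (n : ℝ)⁻¹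
  · intro i j hij
    exact (hindep.indepFun hij).comp₀ (hlaw i).aemeasurable (hlaw j).aemeasurable (hDm i) (hDm j)
  · intro i
    have : IdentDistrib (O i) (O 0) μ μ :=
      ⟨(hlaw i).aemeasurable, (hlaw 0).aemeasurable, by rw [(hlaw i).map_eq, (hlaw 0).map_eq]⟩
    exact this.comp_of_aemeasurable (hDm i)

/-- Chebyshev's inequality: the sum has variance `N v`, so the constant `C` does not depend on `N`.
-/
theorem measure_sqrt_mul_abs_average_gt_le (hlaw : ∀ i, HasLaw (O i) P μ)
    (hindep : iIndepFun O μ) [IsProbabilityMeasure P] {f : S → ℝ} (hf : MemLp f 2 P)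
    (hf0 : ∫ o, f o ∂P = 0) {η : ENNReal} (hη : 0 < η) :
    ∃ C : ℝ, 0 < C ∧ ∀ N : ℕ, 0 < N →
      μ {ω | C / √(N : ℝ) ≤ |(N : ℝ)⁻¹ * ∑ i ∈ Finset.range N, f (O i ω)|} ≤ η := by
  have hfm : ∀ i, AEMeasurable f (Measure.map (O i) μ) := fun i => by
    rw [(hlaw i).map_eq]; exact hf.1.aemeasurable
  have hident : ∀ i, IdentDistrib (fun ω => f (O i ω)) f μ P := fun i => by
    have : IdentDistrib (O i) id μ P :=
      ⟨(hlaw i).aemeasurable, aemeasurable_id, by rw [(hlaw i).map_eq, Measure.map_id]⟩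
    exact this.comp_of_aemeasurable (hfm i)
  have hL2 : ∀ i, MemLp (fun ω => f (O i ω)) 2 μ := fun i => (hident i).memLp_iff.2 hf
  set v := variance f P with hv
  have hv0 : 0 ≤ v := variance_nonneg _ _
  obtain ⟨C, hC, hCη⟩ : ∃ C : ℝ, 0 < C ∧ ENNReal.ofReal (v / C ^ 2) ≤ η := by
    have : Tendsto (fun C : ℝ => ENNReal.ofReal (v / C ^ 2)) atTop (𝓝 (ENNReal.ofReal 0)) :=
      (ENNReal.continuous_ofReal.tendsto 0).comp
        (tendsto_const_nhds.div_atTop (tendsto_pow_atTop two_ne_zero))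
    rw [ENNReal.ofReal_zero] at this
    obtain ⟨C, h1, h2⟩ := ((this.eventually_lt_const hη).and (eventually_gt_atTop 0)).exists
    exact ⟨C, h2, h1.le⟩
  refine ⟨C, hC, fun N hN => ?_⟩
  have hN' : (0 : ℝ) < N := by exact_mod_cast hN
  have hs : 0 < √(N : ℝ) := Real.sqrt_pos.2 hN'
  have hsum : MemLp (fun ω => ∑ i ∈ Finset.range N, f (O i ω)) 2 μ :=
    memLp_finsetSum _ fun i _ => hL2 i
  have hmean : ∫ ω, (∑ i ∈ Finset.range N, f (O i ω)) ∂μ = 0 := by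
    rw [integral_finsetSum _ fun i _ => (hL2 i).integrable one_le_two]
    simp [(hident _).integral_eq, hf0]
  have hvar : variance (fun ω => ∑ i ∈ Finset.range N, f (O i ω)) μ = N * v := by
    have := IndepFun.variance_sum (X := fun i ω => f (O i ω)) (s := Finset.range N)
      (μ := μ) (fun i _ => hL2 i) (fun i _ j _ hij =>
        (hindep.indepFun hij).comp₀ (hlaw i).aemeasurable (hlaw j).aemeasurable (hfm i) (hfm j))
    have h2 : (∑ i ∈ Finset.range N, fun ω => f (O i ω)) =
        fun ω => ∑ i ∈ Finset.range N, f (O i ω) := by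
      ext ω; simp
    rw [h2] at this
    rw [this]
    simp [(hident _).variance_eq, hv]
  have hcheb := meas_ge_le_variance_div_sq hsum (c := C * √(N : ℝ)) (by positivity)
  rw [hmean, hvar, mul_pow, Real.sq_sqrt hN'.le] at hcheb
  refine (measure_mono ?_).trans (hcheb.trans (le_trans (le_of_eq ?_) hCη))
  · intro ω hω
    simp only [Set.mem_ofPred_eq, sub_zero] at hω ⊢
    rw [abs_mul, abs_of_pos (inv_pos.2 hN'), div_le_iff₀ hs] at hω
    calc C * √(N : ℝ) ≤ _ := mul_le_mul_of_nonneg_right hω hs.le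
      _ = (N : ℝ)⁻¹ * (√(N : ℝ) * √(N : ℝ)) * |∑ i ∈ Finset.range N, f (O i ω)| := by ring
      _ = _ := by rw [Real.mul_self_sqrt hN'.le]; field_simp
  · congr 1
    field_simp

end IIDSample

/-! ### Approximation by a linear map, tested on a dense sequence -/

section LinearApproximation

variable {E F : Type*} [NormedAddCommGroup E] [NormedSpace ℝ E] [NormedAddCommGroup F]
  [NormedSpace ℝ F]

/-- Both sides of the inequality are continuous in the pair of points, and pairs from the dense set
are dense in `s × s` because `s` is open. This lets a countable supremum, which is measurable in a
random function, control all points of a ball. -/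
theorem norm_sub_sub_le_of_dense {h : E → F} {A : E →L[ℝ] F} {s t : Set E} (hs : IsOpen s)
    (ht : Dense t) (hh : ContinuousOn h s) {κ : NNReal}
    (hκ : ∀ x ∈ s ∩ t, ∀ y ∈ s ∩ t, ‖h x - h y - A (x - y)‖ ≤ κ * ‖x - y‖) :
    ApproximatesLinearOn h A s κ := by
  intro x hx y hy
  have hmem : (x, y) ∈ closure ((s ∩ t) ×ˢ (s ∩ t)) := by
    rw [closure_prod_eq]
    exact ⟨ht.open_subset_closure_inter hs hx, ht.open_subset_closure_inter hs hy⟩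
  have hcx : ContinuousWithinAt (fun z : E × E => h z.1) ((s ∩ t) ×ˢ (s ∩ t)) (x, y) :=
    ContinuousWithinAt.comp (t := s) (hh x hx) continuous_fst.continuousWithinAt
      fun z hz => hz.1.1
  have hcy : ContinuousWithinAt (fun z : E × E => h z.2) ((s ∩ t) ×ˢ (s ∩ t)) (x, y) :=
    ContinuousWithinAt.comp (t := s) (hh y hy) continuous_snd.continuousWithinAt
      fun z hz => hz.2.1
  have hA : ContinuousWithinAt (fun z : E × E => A (z.1 - z.2)) ((s ∩ t) ×ˢ (s ∩ t)) (x, y) := by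
    fun_prop
  have hR : ContinuousWithinAt (fun z : E × E => κ * ‖z.1 - z.2‖) ((s ∩ t) ×ˢ (s ∩ t)) (x, y) := by
    fun_prop
  exact ContinuousWithinAt.closure_le (f := fun z : E × E => ‖h z.1 - h z.2 - A (z.1 - z.2)‖)
    hmem ((hcx.sub hcy).sub hA).norm hR fun z hz => hκ _ hz.1 _ hz.2

/-- The least constant with which a function approximates the linear map `A` on the points of a
dense sequence in the ball of radius `r` about `a`. -/
def linearModulus [TopologicalSpace.SeparableSpace E] (h : E → F) (A : E →L[ℝ] F) (a : E)
    (r : ℝ) : ENNReal :=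
  ⨆ (i : ℕ) (j : ℕ) (_ : TopologicalSpace.denseSeq E i ∈ Metric.ball a r ∧
      TopologicalSpace.denseSeq E j ∈ Metric.ball a r),
    ‖h (TopologicalSpace.denseSeq E i) - h (TopologicalSpace.denseSeq E j) -
      A (TopologicalSpace.denseSeq E i - TopologicalSpace.denseSeq E j)‖ₑ /
      ‖TopologicalSpace.denseSeq E i - TopologicalSpace.denseSeq E j‖ₑ

variable [TopologicalSpace.SeparableSpace E]

theorem ApproximatesLinearOn.linearModulus_le {h : E → F} {A : E →L[ℝ] F} {a : E} {r : ℝ}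
    {κ : NNReal} (hh : ApproximatesLinearOn h A (Metric.ball a r) κ) :
    linearModulus h A a r ≤ κ := by
  refine iSup_le fun i => iSup_le fun j => iSup_le fun hij => ?_
  refine ENNReal.div_le_of_le_mul ?_
  have := hh _ hij.1 _ hij.2
  rw [← ofReal_norm, ← ofReal_norm, ← ENNReal.ofReal_coe_nnreal, ← ENNReal.ofReal_mul κ.coe_nonneg]
  exact ENNReal.ofReal_le_ofReal this

theorem norm_sub_sub_le_linearModulus {h : E → F} {A : E →L[ℝ] F} {a : E} {r : ℝ}
    (hfin : linearModulus h A a r ≠ ⊤) {i j : ℕ}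
    (hi : TopologicalSpace.denseSeq E i ∈ Metric.ball a r)
    (hj : TopologicalSpace.denseSeq E j ∈ Metric.ball a r) :
    ‖h (TopologicalSpace.denseSeq E i) - h (TopologicalSpace.denseSeq E j) -
      A (TopologicalSpace.denseSeq E i - TopologicalSpace.denseSeq E j)‖ ≤
      (linearModulus h A a r).toReal *
        ‖TopologicalSpace.denseSeq E i - TopologicalSpace.denseSeq E j‖ := by
  set x := TopologicalSpace.denseSeq E i
  set y := TopologicalSpace.denseSeq E j
  have hle : ‖h x - h y - A (x - y)‖ₑ / ‖x - y‖ₑ ≤ linearModulus h A a r :=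
    le_iSup_of_le i (le_iSup_of_le j (le_iSup_of_le ⟨hi, hj⟩ le_rfl))
  by_cases hxy : x = y
  · simp [hxy]
  have h0 : ‖x - y‖ₑ ≠ 0 := by simpa [sub_eq_zero] using hxy
  rw [ENNReal.div_le_iff h0 (by simp)] at hle
  have := ENNReal.toReal_mono (ENNReal.mul_ne_top hfin (by simp)) hle
  simpa [ENNReal.toReal_mul] using this

/-- Strict differentiability says that the linear approximation holds for pairs of nearby points
with an arbitrarily small constant. -/
theorem HasStrictFDerivAt.tendsto_linearModulus {h : E → F} {A : E →L[ℝ] F} {a : E}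
    (hh : HasStrictFDerivAt h A a) {r : ℕ → ℝ} (hr : Tendsto r atTop (𝓝 0)) :
    Tendsto (fun N => linearModulus h A a (r N)) atTop (𝓝 0) := by
  rw [ENNReal.tendsto_nhds_zero]
  intro κ hκ
  obtain ⟨k, hk0, hkκ⟩ : ∃ k : NNReal, 0 < k ∧ (k : ENNReal) ≤ κ := by
    obtain ⟨k, h1, h2⟩ := ENNReal.lt_iff_exists_nnreal_btwn.1 hκ
    exact ⟨k, by exact_mod_cast h1, h2.le⟩
  obtain ⟨s, hs, happ⟩ := hh.approximates_deriv_on_nhds (Or.inr hk0)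
  obtain ⟨ρ, hρ, hball⟩ := Metric.mem_nhds_iff.1 hs
  filter_upwards [hr.eventually_lt_const hρ] with N hN
  exact ((happ.mono_set ((Metric.ball_subset_ball hN.le).trans hball)).linearModulus_le).trans hkκ

end LinearApproximation

/-! ### Averages of random functions are nearly linear at scale `N^{-1/2}` -/

section Average

variable {E F : Type*} [NormedAddCommGroup E] [NormedSpace ℝ E]
  [NormedAddCommGroup F] [NormedSpace ℝ F]
  {S Ω : Type*} [MeasurableSpace S] [MeasurableSpace Ω] {P : Measure S} {μ : Measure Ω}
  {O : ℕ → Ω → S}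

/-- Each directional derivative is an a.e. limit of difference quotients with step `1/n`; in finite
dimension the derivative is assembled from its values on a basis. -/
theorem aestronglyMeasurable_of_hasFDerivAt [FiniteDimensional ℝ E] {ψ : S → E → F} {D : S → E →L[ℝ] F} {a : E}
    (hψ : ∀ θ, StronglyMeasurable fun o => ψ o θ) (hD : ∀ᵐ o ∂P, HasFDerivAt (ψ o) (D o) a) :
    AEStronglyMeasurable D P := by
  have happ : ∀ v, AEStronglyMeasurable (fun o => D o v) P := by
    intro v
    refine aestronglyMeasurable_of_tendsto_ae atTop
      (f := fun (n : ℕ) o => (n : ℝ) • (ψ o (a + (n : ℝ)⁻¹ • v) - ψ o a)) ?_ ?_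
    · intro n
      exact (((hψ _).sub (hψ _)).const_smul (n : ℝ)).aestronglyMeasurable
    · filter_upwards [hD] with o ho
      exact ho.lim v (c := fun n : ℕ => (n : ℝ)) (by simpa using tendsto_natCast_atTop_atTop)
  let b := Module.finBasis ℝ E
  have hrep : D = fun o => ∑ i, (b.coord i).toContinuousLinearMap.smulRight (D o (b i)) := by
    ext o v
    conv_lhs => rw [← b.sum_repr v, map_sum]
    simp [map_smul]
  rw [hrep]
  refine Finset.aestronglyMeasurable_fun_sum _ fun i _ => ?_
  exact ((ContinuousLinearMap.smulRightL ℝ E F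
    (b.coord i).toContinuousLinearMap).continuous.comp_aestronglyMeasurable (happ (b i)))

theorem norm_le_of_lipschitzOnWith_ball {ψ : S → E → F} {D : S → E →L[ℝ] F} {a : E}
    (hD : ∀ᵐ o ∂P, HasStrictFDerivAt (ψ o) (D o) a) {W K : S → ℝ}
    (hLip : ∀ᵐ o ∂P, ∀ r, 0 < r → r * W o ≤ 1 →
      LipschitzOnWith (K o).toNNReal (ψ o) (Metric.ball a r)) :
    ∀ᵐ o ∂P, ‖D o‖₊ ≤ (K o).toNNReal := by
  filter_upwards [hD, hLip] with o h1 h2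
  -- This radius is admissible whatever the sign of `W o`.
  have hr : 0 < (|W o| + 1)⁻¹ := by positivity
  refine h1.hasFDerivAt.le_of_lipschitzOn (Metric.ball_mem_nhds a hr) (h2 _ hr ?_)
  rw [inv_mul_le_one₀ (by positivity)]
  linarith [le_abs_self (W o)]

theorem integrable_of_lipschitzOnWith_ball [FiniteDimensional ℝ E] {ψ : S → E → F}
    {D : S → E →L[ℝ] F} {a : E} (hψ : ∀ θ, StronglyMeasurable fun o => ψ o θ)
    (hD : ∀ᵐ o ∂P, HasStrictFDerivAt (ψ o) (D o) a) {W K : S → ℝ} (hK : Integrable K P)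
    (hLip : ∀ᵐ o ∂P, ∀ r, 0 < r → r * W o ≤ 1 →
      LipschitzOnWith (K o).toNNReal (ψ o) (Metric.ball a r)) :
    Integrable D P := by
  refine hK.norm.mono'
    (aestronglyMeasurable_of_hasFDerivAt hψ (hD.mono fun o ho => ho.hasFDerivAt)) ?_
  filter_upwards [norm_le_of_lipschitzOnWith_ball hD hLip] with o ho
  have : ‖D o‖ ≤ (K o).toNNReal := ho
  refine this.trans ?_
  rw [Real.coe_toNNReal', Real.norm_eq_abs]
  exact max_le (le_abs_self _) (abs_nonneg _)

/-- The error of the average is at most the average of the individual moduli on the shrinking ball,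
plus the deviation of the averaged derivatives from their mean. The moduli tend to zero pointwise
and are dominated by `2K`, so Markov's inequality handles the first term; the law of large numbers
handles the second. The Lipschitz bounds apply to all units at once because `max W = o_p(√N)`. -/
theorem tendsto_measure_not_approximatesLinearOn_average
    [FiniteDimensional ℝ E] [FiniteDimensional ℝ F] [IsProbabilityMeasure μ]
    (hlaw : ∀ i, HasLaw (O i) P μ) (hindep : iIndepFun O μ)
    {ψ : S → E → F} {D : S → E →L[ℝ] F} {a : E}
    (hψ : ∀ θ, StronglyMeasurable fun o => ψ o θ)
    (hD : ∀ᵐ o ∂P, HasStrictFDerivAt (ψ o) (D o) a)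
    {W : S → ℝ} (hWm : Measurable W) (hW : MemLp W 2 P)
    {K : S → ℝ} (hK : Integrable K P)
    (hLip : ∀ᵐ o ∂P, ∀ r, 0 < r → r * W o ≤ 1 →
      LipschitzOnWith (K o).toNNReal (ψ o) (Metric.ball a r))
    {C : ℝ} (hC : 0 < C) {κ : NNReal} (hκ : 0 < κ) :
    Tendsto (fun N : ℕ => μ {ω | ¬ ApproximatesLinearOn
      (fun θ => (N : ℝ)⁻¹ • ∑ i ∈ Finset.range N, ψ (O i ω) θ) (∫ o, D o ∂P)
      (Metric.ball a (C / √(N : ℝ))) κ}) atTop (𝓝 0) := by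
  have hDm : AEStronglyMeasurable D P :=
    aestronglyMeasurable_of_hasFDerivAt hψ (hD.mono fun o ho => ho.hasFDerivAt)
  have hDK := norm_le_of_lipschitzOnWith_ball hD hLip
  have hDint := integrable_of_lipschitzOnWith_ball hψ hD hK hLip
  classical
  let r : ℕ → ℝ := fun N => C / √(N : ℝ)
  have hr : Tendsto r atTop (𝓝 0) :=
    tendsto_const_nhds.div_atTop (Real.tendsto_sqrt_atTop.comp tendsto_natCast_atTop_atTop)
  -- The modulus is cut to zero where the ball of radius `r N` is too large for the Lipschitz bound;
  -- with high probability the cut affects no unit of the sample.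
  let m : ℕ → S → ENNReal := fun N o =>
    if r N * W o ≤ 1 then linearModulus (ψ o) (D o) a (r N) else 0
  have hmm : ∀ N, AEMeasurable (m N) P := by
    intro N
    have h1 : AEMeasurable (fun o => linearModulus (ψ o) (D o) a (r N)) P := by
      refine AEMeasurable.iSup fun i => AEMeasurable.iSup fun j => AEMeasurable.iSup fun _ => ?_
      refine AEMeasurable.div_const ?_ _
      refine AEStronglyMeasurable.enorm ?_
      refine ((hψ _).sub (hψ _)).aestronglyMeasurable.sub ?_
      exact (ContinuousLinearMap.apply ℝ F _).continuous.comp_aestronglyMeasurable hDm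
    have hset : MeasurableSet {o | r N * W o ≤ 1} :=
      measurableSet_le (hWm.const_mul _) measurable_const
    have : m N = {o | r N * W o ≤ 1}.indicator fun o => linearModulus (ψ o) (D o) a (r N) := by
      ext o; simp [m, Set.indicator]
    rw [this]
    exact h1.indicator hset
  have hpos : ∀ N : ℕ, 0 < N → 0 < r N := fun N hN =>
    div_pos hC (Real.sqrt_pos.2 (by exact_mod_cast hN))
  have happK : ∀ᵐ o ∂P, ∀ N, 0 < N → r N * W o ≤ 1 →
      linearModulus (ψ o) (D o) a (r N) ≤ (2 * (K o).toNNReal : NNReal) := by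
    filter_upwards [hLip, hDK] with o h1 h2 N hN hNW
    refine ApproximatesLinearOn.linearModulus_le fun x hx y hy => ?_
    have h3 := (h1 _ (hpos N hN) hNW).norm_sub_le hx hy
    have h4 : ‖D o (x - y)‖ ≤ (K o).toNNReal * ‖x - y‖ :=
      ((D o).le_opNorm _).trans (mul_le_mul_of_nonneg_right h2 (norm_nonneg _))
    push_cast
    linarith [norm_sub_le (ψ o x - ψ o y) (D o (x - y))]
  have hmlim : Tendsto (fun N => ∫⁻ o, m N o ∂P) atTop (𝓝 0) := by
    -- At `N = 0` the radius is zero and `happK` gives nothing, hence the shift.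
    rw [← tendsto_add_atTop_iff_nat 1]
    have := tendsto_lintegral_of_dominated_convergence' (μ := P) (F := fun N => m (N + 1))
      (f := fun _ => 0)
      (fun o => 2 * ENNReal.ofReal (K o)) (fun N => hmm _) ?_ ?_ ?_
    · simpa using this
    · intro N
      filter_upwards [happK] with o ho
      simp only [m]
      split_ifs with h
      · have := ho _ N.succ_pos h
        push_cast at this
        exact this
      · exact zero_le
    · rw [lintegral_const_mul' _ _ (by simp)]
      exact ENNReal.mul_ne_top (by simp) hK.lintegral_lt_top.ne
    · filter_upwards [hD] with o ho
      have h1 := (tendsto_add_atTop_iff_nat 1).2 (ho.tendsto_linearModulus hr)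
      refine tendsto_of_tendsto_of_tendsto_of_le_of_le tendsto_const_nhds h1
        (fun _ => zero_le) fun N => ?_
      simp only [m]
      split_ifs
      · exact le_rfl
      · exact zero_le
  have hκ2 : (0 : ℝ) < κ / 2 := by positivity
  have hκ2' : ((κ / 2 : NNReal) : ENNReal) ≠ 0 := by
    simpa using hκ.ne'
  have T1 := tendsto_measure_average_ge hlaw hmm hmlim hκ2' (ENNReal.coe_ne_top)
  have T2 := tendsto_measure_norm_average_sub_integral_gt hlaw hindep hDint hκ2
  have T3 := tendsto_measure_exists_sqrt_lt hlaw (hWm.const_mul C) (hW.const_mul C)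
  have hae : ∀ᵐ ω ∂μ, ∀ i, (∀ N, 0 < N → r N * W (O i ω) ≤ 1 →
      linearModulus (ψ (O i ω)) (D (O i ω)) a (r N) ≤ (2 * (K (O i ω)).toNNReal : NNReal)) ∧
      (∀ r, 0 < r → r * W (O i ω) ≤ 1 →
        LipschitzOnWith (K (O i ω)).toNNReal (ψ (O i ω)) (Metric.ball a r)) :=
    ae_all_iff.2 fun i => (hlaw i).ae_comp (happK.and hLip)
  have hsum := (T1.add T2).add T3
  rw [add_zero, add_zero] at hsum
  refine tendsto_of_tendsto_of_tendsto_of_le_of_le' tendsto_const_nhds hsum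
    (Eventually.of_forall fun _ => zero_le) ?_
  filter_upwards [eventually_gt_atTop 0] with N hN
  refine le_trans ?_ ((measure_union_le _ _).trans (add_le_add_left (measure_union_le _ _) _))
  refine measure_mono_ae ?_
  filter_upwards [hae] with ω hω hbad
  by_contra hgood
  apply hbad
  change ω ∉ (_ ∪ _ : Set Ω) at hgood
  simp only [Set.mem_union, Set.mem_ofPred_eq, not_or, not_le, not_exists, not_and, not_lt] at hgood
  obtain ⟨⟨g1, g2⟩, g3⟩ := hgood
  have hN' : (0 : ℝ) < N := by exact_mod_cast hN
  have hs : 0 < √(N : ℝ) := Real.sqrt_pos.2 hN'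
  have hrW : ∀ i < N, r N * W (O i ω) ≤ 1 := by
    intro i hi
    have : C * W (O i ω) ≤ √(N : ℝ) := g3 i hi
    simp only [r]
    rw [div_mul_eq_mul_div, div_le_one hs]
    exact this
  have hmod : ∀ i < N, m N (O i ω) = linearModulus (ψ (O i ω)) (D (O i ω)) a (r N) ∧
      linearModulus (ψ (O i ω)) (D (O i ω)) a (r N) ≠ ⊤ := fun i hi =>
    ⟨if_pos (hrW i hi), ne_top_of_le_ne_top ENNReal.coe_ne_top ((hω i).1 N hN (hrW i hi))⟩
  have hsumfin : ∀ i ∈ Finset.range N, m N (O i ω) ≠ ⊤ := fun i hi => by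
    rw [(hmod i (Finset.mem_range.1 hi)).1]; exact (hmod i (Finset.mem_range.1 hi)).2
  have g1' : (N : ℝ)⁻¹ * ∑ i ∈ Finset.range N, (m N (O i ω)).toReal ≤ κ / 2 := by
    have := ENNReal.toReal_mono ENNReal.coe_ne_top g1.le
    rw [ENNReal.toReal_mul, ENNReal.toReal_sum hsumfin] at this
    simpa using this
  refine norm_sub_sub_le_of_dense Metric.isOpen_ball (TopologicalSpace.denseRange_denseSeq E) ?_ ?_
  · refine ContinuousOn.const_smul ?_ _
    refine continuousOn_finsetSum _ fun i hi => ?_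
    exact ((hω i).2 _ (hpos N hN) (hrW i (Finset.mem_range.1 hi))).continuousOn
  · rintro x ⟨hx, i₀, rfl⟩ y ⟨hy, j₀, rfl⟩
    set x := TopologicalSpace.denseSeq E i₀
    set y := TopologicalSpace.denseSeq E j₀
    have hdecomp : (N : ℝ)⁻¹ • ∑ i ∈ Finset.range N, ψ (O i ω) x -
        (N : ℝ)⁻¹ • ∑ i ∈ Finset.range N, ψ (O i ω) y - (∫ o, D o ∂P) (x - y) =
        (N : ℝ)⁻¹ • ∑ i ∈ Finset.range N,
          (ψ (O i ω) x - ψ (O i ω) y - D (O i ω) (x - y)) +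
        ((N : ℝ)⁻¹ • ∑ i ∈ Finset.range N, D (O i ω) - ∫ o, D o ∂P) (x - y) := by
      simp only [Finset.sum_sub_distrib, smul_sub, sub_apply,
        smul_apply, sum_apply]
      abel
    rw [hdecomp]
    have e1 : ‖(N : ℝ)⁻¹ • ∑ i ∈ Finset.range N,
          (ψ (O i ω) x - ψ (O i ω) y - D (O i ω) (x - y))‖ ≤ κ / 2 * ‖x - y‖ := by
      rw [norm_smul, Real.norm_of_nonneg (inv_pos.2 hN').le]
      calc _ ≤ (N : ℝ)⁻¹ * ∑ i ∈ Finset.range N, (m N (O i ω)).toReal * ‖x - y‖ := by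
            refine mul_le_mul_of_nonneg_left ?_ (inv_pos.2 hN').le
            refine (norm_sum_le _ _).trans (Finset.sum_le_sum fun i hi => ?_)
            have := hmod i (Finset.mem_range.1 hi)
            rw [this.1]
            exact norm_sub_sub_le_linearModulus this.2 hx hy
        _ = ((N : ℝ)⁻¹ * ∑ i ∈ Finset.range N, (m N (O i ω)).toReal) * ‖x - y‖ := by
            rw [← Finset.sum_mul, mul_assoc]
        _ ≤ _ := mul_le_mul_of_nonneg_right g1' (norm_nonneg _)
    have e2 := ((N : ℝ)⁻¹ • ∑ i ∈ Finset.range N, D (O i ω) - ∫ o, D o ∂P).le_opNorm (x - y)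
    have e3 := mul_le_mul_of_nonneg_right g2.le (norm_nonneg (x - y))
    refine (norm_add_le _ _).trans ?_
    linarith

end Average

/-! ### Existence of a root near the limit, and the change of the second component -/

section ZEstimation

variable {Λ Φ : Type*} [NormedAddCommGroup Λ] [NormedSpace ℝ Λ] [FiniteDimensional ℝ Λ]
  [NormedAddCommGroup Φ] [NormedSpace ℝ Φ]

/-- With `φ` fixed, the first component is a small perturbation of the invertible map `A`, so it
covers a ball around its value at `a.1`; that value is of order `ρ`, and a ball of radius
proportional to `ρ` suffices to reach zero. The second component has no linear part, so over the
whole ball it moves by at most `κ * R`. -/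
theorem exists_zero_of_approximatesLinearOn {G : Λ × Φ → Λ × ℝ} {L : Λ × Φ →L[ℝ] Λ × ℝ}
    {A : Λ ≃L[ℝ] Λ} (hA : ∀ v, (L (v, 0)).1 = A v) (hL : ∀ v, (L v).2 = 0) {a : Λ × Φ} {ρ R : ℝ}
    (hρ : 0 < ρ)
    (hR : R = (4 * (‖(A.symm : Λ →L[ℝ] Λ)‖ + 1) * (2 + ‖L‖) + 2) * ρ) {κ : NNReal}
    (hκ : κ ≤ 1) (hκA : 2 * κ * (‖(A.symm : Λ →L[ℝ] Λ)‖ + 1) ≤ 1)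
    (hG : ApproximatesLinearOn G L (Metric.ball a R) κ) {φ : Φ} (hφ : ‖φ - a.2‖ ≤ ρ)
    (hGa : ‖(G a).1‖ ≤ ρ) :
    ∃ l, (l, φ) ∈ Metric.ball a R ∧ (G (l, φ)).1 = 0 ∧ |(G (l, φ)).2 - (G a).2| ≤ κ * R := by
  set n := ‖(A.symm : Λ →L[ℝ] Λ)‖ with hn
  have hn0 : 0 ≤ n := norm_nonneg _
  have hL0 : 0 ≤ ‖L‖ := norm_nonneg _
  have hRρ : 2 * ρ ≤ R := by
    rw [hR]; nlinarith [mul_nonneg (mul_nonneg (by linarith : (0:ℝ) ≤ 4 * (n + 1))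
      (by linarith : (0:ℝ) ≤ 2 + ‖L‖)) hρ.le]
  have hR0 : 0 < R := by linarith
  have hsub : ∀ l ∈ Metric.closedBall a.1 (R / 2), (l, φ) ∈ Metric.ball a R := by
    intro l hl
    rw [Metric.mem_closedBall] at hl
    rw [Metric.mem_ball, Prod.dist_eq]
    refine max_lt (by simp only; linarith) ?_
    rw [dist_eq_norm]; simp only; linarith
  have ha : a ∈ Metric.ball a R := Metric.mem_ball_self hR0
  -- The `+ 1` keeps the bound positive even if `Λ` is trivial.
  let rinv : (A : Λ →L[ℝ] Λ).NonlinearRightInverse :=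
    { toFun := A.symm
      nnnorm := ‖(A.symm : Λ →L[ℝ] Λ)‖₊ + 1
      bound' := fun y => by
        refine ((A.symm : Λ →L[ℝ] Λ).le_opNorm y).trans ?_
        push_cast
        exact mul_le_mul_of_nonneg_right (by simp) (norm_nonneg _)
      right_inv' := fun y => by simp }
  have happ : ApproximatesLinearOn (fun l => (G (l, φ)).1) (A : Λ →L[ℝ] Λ)
      (Metric.closedBall a.1 (R / 2)) κ := by
    intro x hx y hy
    have h := hG _ (hsub x hx) _ (hsub y hy)
    have e1 : ((x, φ) : Λ × Φ) - (y, φ) = (x - y, 0) := by simp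
    rw [e1] at h
    have e2 : ‖((x - y, 0) : Λ × Φ)‖ = ‖x - y‖ := by simp [Prod.norm_def]
    rw [e2] at h
    refine le_trans ?_ h
    have : (G (x, φ)).1 - (G (y, φ)).1 - (A : Λ →L[ℝ] Λ) (x - y) =
        (G (x, φ) - G (y, φ) - L (x - y, 0)).1 := by
      simp [hA]
    simp only [this]
    exact norm_fst_le _
  have hsurj := happ.surjOn_closedBall_of_nonlinearRightInverse rinv (b := a.1)
    (ε := R / 2) (by positivity) subset_rfl
  have hφa : (a.1, φ) ∈ Metric.ball a R := hsub _ (Metric.mem_closedBall_self (by positivity))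
  have hstart : ‖(G (a.1, φ)).1‖ ≤ (2 + ‖L‖) * ρ := by
    have h := hG _ hφa _ ha
    have e1 : ((a.1, φ) : Λ × Φ) - a = (0, φ - a.2) := by ext <;> simp
    have e2 : ‖((a.1, φ) : Λ × Φ) - a‖ ≤ ρ := by rw [e1]; simpa [Prod.norm_def] using hφ
    have h1 : ‖(G (a.1, φ) - G a - L ((a.1, φ) - a))‖ ≤ 1 * ρ :=
      h.trans (mul_le_mul hκ e2 (norm_nonneg _) zero_le_one)
    have h2 : ‖L ((a.1, φ) - a)‖ ≤ ‖L‖ * ρ :=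
      (L.le_opNorm _).trans (mul_le_mul_of_nonneg_left e2 hL0)
    have h3 : ‖(G (a.1, φ)).1 - (G a).1‖ ≤ (1 + ‖L‖) * ρ := by
      have h4 : G (a.1, φ) - G a = (G (a.1, φ) - G a - L ((a.1, φ) - a)) + L ((a.1, φ) - a) := by
        abel
      have h5 : ‖G (a.1, φ) - G a‖ ≤ (1 + ‖L‖) * ρ := by
        rw [h4]; refine (norm_add_le _ _).trans ?_; linarith
      exact (norm_fst_le (G (a.1, φ) - G a)).trans h5
    have h6 : (G (a.1, φ)).1 = ((G (a.1, φ)).1 - (G a).1) + (G a).1 := by abel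
    rw [h6]
    refine (norm_add_le _ _).trans ?_
    linarith
  -- By `hκA` the covered radius is at least `R / (4 (n + 1))`, and `R` was chosen so that this
  -- exceeds `(2 + ‖L‖) ρ`, the bound on the starting value.
  have h0 : (0 : Λ) ∈ Metric.closedBall ((fun l => (G (l, φ)).1) a.1)
      (((rinv.nnnorm : ℝ)⁻¹ - κ) * (R / 2)) := by
    rw [Metric.mem_closedBall, dist_zero_left]
    refine hstart.trans ?_
    have hnn : (rinv.nnnorm : ℝ) = n + 1 := by simp [rinv, hn]
    rw [hnn]
    have hκ' : (κ : ℝ) ≤ (n + 1)⁻¹ / 2 := by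
      rw [le_div_iff₀ two_pos, ← one_div, le_div_iff₀ (by positivity)]; linarith
    have h7 : (n + 1)⁻¹ / 2 * (R / 2) ≤ ((n + 1)⁻¹ - κ) * (R / 2) :=
      mul_le_mul_of_nonneg_right (by linarith) (by positivity)
    refine le_trans ?_ h7
    have h8 : (n + 1)⁻¹ / 2 * (R / 2) = (2 + ‖L‖) * ρ + (n + 1)⁻¹ * ρ / 2 := by
      rw [hR]; field_simp; ring
    rw [h8]
    have : 0 ≤ (n + 1)⁻¹ * ρ / 2 := by positivity
    linarith
  obtain ⟨l, hl, hl0⟩ := hsurj h0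
  refine ⟨l, hsub l hl, hl0, ?_⟩
  have h := hG _ (hsub l hl) _ ha
  have h9 : (G (l, φ)).2 - (G a).2 = (G (l, φ) - G a - L ((l, φ) - a)).2 := by simp [hL]
  rw [h9, ← Real.norm_eq_abs]
  refine (norm_snd_le _).trans (h.trans (mul_le_mul_of_nonneg_left ?_ κ.coe_nonneg))
  have := hsub l hl
  rw [Metric.mem_ball, dist_eq_norm] at this
  exact this.le

theorem exists_zero_of_isBigOInProb [FiniteDimensional ℝ Φ] {ι S Ω : Type*} [Fintype ι]
    [MeasurableSpace S]
    [MeasurableSpace Ω] {P : Measure S} [IsProbabilityMeasure P] {μ : Measure Ω}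
    [IsProbabilityMeasure μ] {O : ℕ → Ω → S} (hlaw : ∀ i, HasLaw (O i) P μ)
    (hindep : iIndepFun O μ) {ψ : S → (ι → ℝ) × Φ → (ι → ℝ) × ℝ}
    {D : S → (ι → ℝ) × Φ →L[ℝ] (ι → ℝ) × ℝ} {a : (ι → ℝ) × Φ}
    (hψ : ∀ θ, StronglyMeasurable fun o => ψ o θ)
    (hD : ∀ᵐ o ∂P, HasStrictFDerivAt (ψ o) (D o) a)
    {W : S → ℝ} (hWm : Measurable W) (hW : MemLp W 2 P)
    {K : S → ℝ} (hK : Integrable K P)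
    (hLip : ∀ᵐ o ∂P, ∀ r, 0 < r → r * W o ≤ 1 →
      LipschitzOnWith (K o).toNNReal (ψ o) (Metric.ball a r))
    (hψ2 : ∀ k, MemLp (fun o => (ψ o a).1 k) 2 P) (hψ0 : ∀ k, ∫ o, (ψ o a).1 k ∂P = 0)
    {A : (ι → ℝ) ≃L[ℝ] (ι → ℝ)} (hA : ∀ v, ((∫ o, D o ∂P) (v, 0)).1 = A v)
    (hL : ∀ v, ((∫ o, D o ∂P) v).2 = 0)
    {φhat : ℕ → Ω → Φ}
    (hφ : IsBigOInProb μ (fun N ω => φhat N ω - a.2) (fun N => (√(N : ℝ))⁻¹))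
    {η : ENNReal} (hη : 0 < η) {κ : ℝ} (hκ : 0 < κ) :
    ∃ C : ℝ, 0 < C ∧ ∀ᶠ N : ℕ in atTop, μ {ω | ¬ ((∀ i < N, C / √(N : ℝ) * W (O i ω) ≤ 1) ∧
      ∃ l, (l, φhat N ω) ∈ Metric.ball a (C / √(N : ℝ)) ∧
        ((N : ℝ)⁻¹ • ∑ i ∈ Finset.range N, ψ (O i ω) (l, φhat N ω)).1 = 0 ∧
        |((N : ℝ)⁻¹ • ∑ i ∈ Finset.range N, ψ (O i ω) (l, φhat N ω)).2 -
          ((N : ℝ)⁻¹ • ∑ i ∈ Finset.range N, ψ (O i ω) a).2| ≤ κ / √(N : ℝ))} ≤ η := by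
  classical
  -- There are `card ι + 3` exceptional events: one for each coordinate of the average at `a`, and
  -- one each for linearity, for the maximum of `W` and for `φhat`. Each receives probability `δ`.
  set δ : ENNReal := η / (4 * (Fintype.card ι + 1)) with hδ
  have hc0 : (4 * ((Fintype.card ι : ENNReal) + 1)) ≠ 0 := by simp
  have hct : (4 * ((Fintype.card ι : ENNReal) + 1)) ≠ ⊤ := by
    exact_mod_cast ENNReal.natCast_ne_top (4 * (Fintype.card ι + 1))
  have hδ0 : 0 < δ := ENNReal.div_pos hη.ne' hct
  have hδsum : Fintype.card ι * δ + (δ + (δ + δ)) ≤ η := by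
    have h : (Fintype.card ι : ENNReal) * δ + (δ + (δ + δ)) ≤ (4 * (Fintype.card ι + 1)) * δ := by
      calc _ = ((Fintype.card ι : ENNReal) + 3) * δ := by ring
        _ ≤ _ := by
          gcongr
          have : Fintype.card ι + 3 ≤ 4 * (Fintype.card ι + 1) := by omega
          exact_mod_cast this
    exact h.trans (by rw [hδ, ENNReal.mul_div_cancel hc0 hct])
  choose Ck hCk0 hCk using fun k => measure_sqrt_mul_abs_average_gt_le hlaw hindep (hψ2 k) (hψ0 k)
    (η := δ) hδ0
  obtain ⟨Cφ, hCφ⟩ := hφ δ hδ0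
  set ρ₀ : ℝ := ∑ k, Ck k + |Cφ| + 1 with hρ₀
  have hρ₀pos : 0 < ρ₀ := by
    have := Finset.sum_nonneg fun k (_ : k ∈ Finset.univ) => (hCk0 k).le
    positivity
  set L := ∫ o, D o ∂P with hLdef
  set n := ‖(A.symm : (ι → ℝ) →L[ℝ] (ι → ℝ))‖ with hn
  have hn0 : 0 ≤ n := norm_nonneg _
  have hL0 : 0 ≤ ‖L‖ := norm_nonneg _
  set C : ℝ := (4 * (n + 1) * (2 + ‖L‖) + 2) * ρ₀ with hC
  have hCpos : 0 < C := by positivity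
  -- The radius constant `C` does not involve `κ`, so the approximation constant `k` may be chosen
  -- after it, small enough that `k * C ≤ κ`.
  obtain ⟨k, hk0, hk1, hkA, hkC⟩ : ∃ k : NNReal, 0 < k ∧ k ≤ 1 ∧ 2 * k * (n + 1) ≤ 1 ∧
      k * C ≤ κ := by
    have hx : 0 < min 1 (min (2 * (n + 1))⁻¹ (κ / C)) := by positivity
    refine ⟨⟨_, hx.le⟩, hx, ?_, ?_, ?_⟩
    · exact NNReal.coe_le_coe.1 (min_le_left (1 : ℝ) _)
    · have : min 1 (min (2 * (n + 1))⁻¹ (κ / C)) ≤ (2 * (n + 1))⁻¹ :=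
        (min_le_right _ _).trans (min_le_left _ _)
      have h2 : (0 : ℝ) < 2 * (n + 1) := by positivity
      have := mul_le_mul_of_nonneg_right this h2.le
      rw [inv_mul_cancel₀ h2.ne'] at this
      change 2 * min 1 (min (2 * (n + 1))⁻¹ (κ / C)) * (n + 1) ≤ 1
      linarith
    · have : min 1 (min (2 * (n + 1))⁻¹ (κ / C)) ≤ κ / C :=
        (min_le_right _ _).trans (min_le_right _ _)
      rwa [le_div_iff₀ hCpos] at this
  have T1 := tendsto_measure_not_approximatesLinearOn_average hlaw hindep hψ hD hWm hW hK hLip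
    hCpos hk0
  have T2 := tendsto_measure_exists_sqrt_lt hlaw (hWm.const_mul C) (hW.const_mul C)
  refine ⟨C, hCpos, ?_⟩
  filter_upwards [T1.eventually_le_const hδ0, T2.eventually_le_const hδ0, hCφ,
    eventually_gt_atTop 0] with N h1 h2 h3 hN
  have hs : 0 < √(N : ℝ) := Real.sqrt_pos.2 (by exact_mod_cast hN)
  refine le_trans ?_ hδsum
  refine le_trans ?_ (add_le_add (a := μ (⋃ k ∈ Finset.univ, {ω | Ck k / √(N : ℝ) ≤
    |(N : ℝ)⁻¹ * ∑ i ∈ Finset.range N, (ψ (O i ω) a).1 k|})) ?_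
    (add_le_add h1 (add_le_add h2 h3)))
  · refine le_trans ?_ ((measure_union_le _ _).trans (add_le_add_right
      ((measure_union_le _ _).trans (add_le_add_right (measure_union_le _ _) _)) _))
    refine measure_mono fun ω hω => ?_
    by_contra hgood
    apply hω
    simp only [Set.mem_union, Set.mem_iUnion, Set.mem_ofPred_eq, not_or, not_le, not_exists,
      not_and, not_lt, not_not, Finset.mem_univ, true_imp_iff] at hgood
    obtain ⟨g1, g2, g3, g4⟩ := hgood
    refine ⟨fun i hi => ?_, ?_⟩
    · rw [div_mul_eq_mul_div, div_le_one hs]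
      exact g3 i hi
    · have hCk_le : ∀ k, Ck k ≤ ρ₀ := fun k => by
        have := Finset.single_le_sum (fun k _ => (hCk0 k).le) (Finset.mem_univ k)
        have h0 := abs_nonneg Cφ
        linarith
      have := exists_zero_of_approximatesLinearOn (G := fun θ => (N : ℝ)⁻¹ • ∑ i ∈ Finset.range N,
        ψ (O i ω) θ) hA hL (ρ := ρ₀ / √(N : ℝ)) (R := C / √(N : ℝ)) (by positivity)
        (by rw [hC]; ring) hk1 hkA g2 (φ := φhat N ω) ?_ ?_
      · obtain ⟨l, hl1, hl2, hl3⟩ := this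
        refine ⟨l, hl1, hl2, hl3.trans ?_⟩
        rw [← mul_div_assoc]
        exact div_le_div_of_nonneg_right hkC hs.le
      · refine g4.trans ?_
        rw [← div_eq_mul_inv]
        refine div_le_div_of_nonneg_right ?_ hs.le
        have := Finset.sum_nonneg fun k (_ : k ∈ Finset.univ) => (hCk0 k).le
        linarith [le_abs_self Cφ]
      · refine (pi_norm_le_iff_of_nonneg (by positivity)).2 fun k => ?_
        have e : ((N : ℝ)⁻¹ • ∑ i ∈ Finset.range N, ψ (O i ω) a).1 k =
            (N : ℝ)⁻¹ * ∑ i ∈ Finset.range N, (ψ (O i ω) a).1 k := by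
          simp [Prod.fst_sum]
        rw [e, Real.norm_eq_abs]
        exact (g1 k).le.trans (div_le_div_of_nonneg_right (hCk_le k) hs.le)
  · refine (measure_biUnion_finset_le _ _).trans ?_
    refine (Finset.sum_le_sum fun k _ => hCk k N hN).trans ?_
    simp

end ZEstimation

/-! ### Consequences of missingness at random -/

section MissingAtRandom

variable {𝓧 : Type*}

theorem Obs.δ_eq_indicator :
    Obs.δ (𝓧 := 𝓧) = {o : Obs 𝓧 | o.resp = true}.indicator (fun _ => (1 : ℝ)) := by
  ext o
  by_cases h : o.resp = true
  · rw [Set.indicator_of_mem (by exact h)]; exact if_pos h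
  · rw [Set.indicator_of_notMem (by exact h)]; exact if_neg h

theorem Obs.δ_eq_zero_or_one (o : Obs 𝓧) : o.δ = 0 ∨ o.δ = 1 := by
  unfold Obs.δ; split_ifs <;> simp

theorem Obs.abs_δ_le_one (o : Obs 𝓧) : |o.δ| ≤ 1 := by
  rcases o.δ_eq_zero_or_one with h | h <;> simp [h]

variable [MeasurableSpace 𝓧]

theorem Obs.measurable_y : Measurable (Obs.y (𝓧 := 𝓧)) := measurable_snd.fst

theorem Obs.measurable_resp : Measurable (Obs.resp (𝓧 := 𝓧)) := measurable_snd.snd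

theorem Obs.measurable_xy : Measurable fun o : Obs 𝓧 => (o.x, o.y) :=
  Obs.measurable_x.prodMk Obs.measurable_y

theorem Obs.measurableSet_resp : MeasurableSet {o : Obs 𝓧 | o.resp = true} :=
  Obs.measurable_resp (measurableSet_singleton true)

theorem Obs.measurable_δ : Measurable (Obs.δ (𝓧 := 𝓧)) := by
  rw [Obs.δ_eq_indicator]
  exact measurable_const.indicator Obs.measurableSet_resp

variable [StandardBorelSpace 𝓧] {P : Measure (Obs 𝓧)} [IsProbabilityMeasure P] {π₀ : 𝓧 → ℝ}

/-- Conditional independence gives `E[δ 1_B(Y) | X] = π₀(X) E[1_B(Y) | X] = E[π₀(X) 1_B(Y) | X]`; it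
remains to integrate over `{X ∈ A}`. -/
theorem IsMAR.setIntegral_δ (hMAR : IsMAR P) (hπ₀ : IsPropensityScore P π₀)
    (hbd : ∀ᵐ o ∂P, 0 ≤ π₀ o.x ∧ π₀ o.x ≤ 1) {A : Set 𝓧} {B : Set ℝ} (hA : MeasurableSet A)
    (hB : MeasurableSet B) :
    ∫ o in (fun o : Obs 𝓧 => (o.x, o.y)) ⁻¹' (A ×ˢ B), o.δ ∂P =
      ∫ o in (fun o : Obs 𝓧 => (o.x, o.y)) ⁻¹' (A ×ˢ B), π₀ o.x ∂P := by
  have hm : MeasurableSpace.comap (Obs.x (𝓧 := 𝓧)) inferInstance ≤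
      (inferInstance : MeasurableSpace (Obs 𝓧)) := Obs.measurable_x.comap_le
  have hBm : MeasurableSet (Obs.y (𝓧 := 𝓧) ⁻¹' B) := Obs.measurable_y hB
  have hAm : MeasurableSet[MeasurableSpace.comap (Obs.x (𝓧 := 𝓧)) inferInstance]
      (Obs.x (𝓧 := 𝓧) ⁻¹' A) := ⟨A, hA, rfl⟩
  have hpre : (fun o : Obs 𝓧 => (o.x, o.y)) ⁻¹' (A ×ˢ B) = Obs.x ⁻¹' A ∩ Obs.y ⁻¹' B := rfl
  have hci := (condIndepFun_iff_condExp_inter_preimage_eq_mul Obs.measurable_resp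
    Obs.measurable_y).1 hMAR {true} B (measurableSet_singleton _) hB
  have hδ : (Obs.resp (𝓧 := 𝓧) ⁻¹' {true}).indicator (fun _ => (1 : ℝ)) = Obs.δ := by
    rw [Obs.δ_eq_indicator]; rfl
  rw [hδ] at hci
  set g : Obs 𝓧 → ℝ := (Obs.y ⁻¹' B).indicator fun _ => (1 : ℝ) with hg
  have hgint : Integrable g P := (integrable_const (1 : ℝ)).indicator hBm
  have hπm : StronglyMeasurable[MeasurableSpace.comap (Obs.x (𝓧 := 𝓧)) inferInstance]
      (fun o : Obs 𝓧 => π₀ o.x) :=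
    (hπ₀.1.comp (comap_measurable Obs.x)).stronglyMeasurable
  have hπg : Integrable ((fun o : Obs 𝓧 => π₀ o.x) * g) P := by
    refine hgint.bdd_mul (c := 1) (hπm.mono hm).aestronglyMeasurable ?_
    filter_upwards [hbd] with o ho
    rw [Real.norm_eq_abs, abs_le]; constructor <;> linarith
  have hpull := condExp_mul_of_stronglyMeasurable_left hπm hπg hgint
  have hpair : Integrable ((Obs.resp (𝓧 := 𝓧) ⁻¹' {true} ∩ Obs.y ⁻¹' B).indicator
      fun _ => (1 : ℝ)) P :=
    (integrable_const (1 : ℝ)).indicator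
      ((Obs.measurable_resp (measurableSet_singleton true)).inter hBm)
  have e1 : ∫ o in Obs.x ⁻¹' A, (Obs.resp (𝓧 := 𝓧) ⁻¹' {true} ∩ Obs.y ⁻¹' B).indicator
      (fun _ => (1 : ℝ)) o ∂P = ∫ o in Obs.x ⁻¹' A, ((fun o : Obs 𝓧 => π₀ o.x) * g) o ∂P := by
    rw [← setIntegral_condExp hm hpair hAm, ← setIntegral_condExp hm hπg hAm]
    refine setIntegral_congr_ae (hm _ hAm) ?_
    filter_upwards [hci, hpull, hπ₀.2] with o h1 h2 h3 _
    rw [h1, h2, h3]; rfl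
  rw [hpre, ← setIntegral_indicator hBm, ← setIntegral_indicator hBm]
  calc _ = _ := ?_
    _ = _ := e1
    _ = _ := ?_
  · congr 1
    ext o
    rw [← hδ, Set.indicator_indicator, Set.inter_comm]
  · congr 1
    ext o
    by_cases h : o ∈ Obs.y (𝓧 := 𝓧) ⁻¹' B <;> simp [g, h]

/-- The measures with densities `δ` and `π₀` have the same image under `(x, y)`, since the images
agree on rectangles. Hence `h` needs no integrability: both integrals are integrals of `h` against
one measure. -/
theorem IsMAR.integral_δ_mul (hMAR : IsMAR P) (hπ₀ : IsPropensityScore P π₀)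
    (hbd : ∀ᵐ o ∂P, 0 ≤ π₀ o.x ∧ π₀ o.x ≤ 1) {h : 𝓧 × ℝ → ℝ} (hh : Measurable h) :
    ∫ o, o.δ * h (o.x, o.y) ∂P = ∫ o, π₀ o.x * h (o.x, o.y) ∂P := by
  have hδm : Measurable fun o : Obs 𝓧 => ENNReal.ofReal o.δ := Obs.measurable_δ.ennreal_ofReal
  have hπm : Measurable fun o : Obs 𝓧 => ENNReal.ofReal (π₀ o.x) :=
    (hπ₀.1.comp Obs.measurable_x).ennreal_ofReal
  have hδ0 : ∀ o : Obs 𝓧, 0 ≤ o.δ := fun o => by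
    rcases o.δ_eq_zero_or_one with h | h <;> simp [h]
  have hδint : Integrable (Obs.δ (𝓧 := 𝓧)) P :=
    (integrable_const (1 : ℝ)).mono' Obs.measurable_δ.aestronglyMeasurable
      (ae_of_all _ fun o => o.abs_δ_le_one)
  have hπint : Integrable (fun o : Obs 𝓧 => π₀ o.x) P := by
    refine (integrable_const (1 : ℝ)).mono' (hπ₀.1.comp Obs.measurable_x).aestronglyMeasurable ?_
    filter_upwards [hbd] with o ho
    rw [Real.norm_eq_abs, abs_le]; constructor <;> linarith
  have key : (P.withDensity fun o => ENNReal.ofReal o.δ).map (fun o => (o.x, o.y)) =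
      (P.withDensity fun o => ENNReal.ofReal (π₀ o.x)).map (fun o => (o.x, o.y)) := by
    have : IsFiniteMeasure (P.withDensity fun o : Obs 𝓧 => ENNReal.ofReal o.δ) :=
      isFiniteMeasure_withDensity_ofReal hδint.2
    refine Measure.ext_prod ?_
    intro A B hA hB
    have hAB : MeasurableSet ((fun o : Obs 𝓧 => (o.x, o.y)) ⁻¹' (A ×ˢ B)) :=
      Obs.measurable_xy (hA.prod hB)
    rw [Measure.map_apply Obs.measurable_xy (hA.prod hB),
      Measure.map_apply Obs.measurable_xy (hA.prod hB), withDensity_apply _ hAB,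
      withDensity_apply _ hAB,
      ← ofReal_integral_eq_lintegral_ofReal hδint.integrableOn (ae_of_all _ hδ0),
      ← ofReal_integral_eq_lintegral_ofReal hπint.integrableOn
        (ae_restrict_of_ae (hbd.mono fun o ho => ho.1)), hMAR.setIntegral_δ hπ₀ hbd hA hB]
  have h1 := congrArg (fun ν => ∫ z, h z ∂ν) key
  rw [integral_map Obs.measurable_xy.aemeasurable hh.aestronglyMeasurable,
    integral_map Obs.measurable_xy.aemeasurable hh.aestronglyMeasurable,
    integral_withDensity_eq_integral_toReal_smul hδm (by simp),
    integral_withDensity_eq_integral_toReal_smul hπm (by simp)] at h1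
  convert h1 using 1
  · refine integral_congr_ae (ae_of_all _ fun o => ?_)
    simp [ENNReal.toReal_ofReal (hδ0 o)]
  · refine integral_congr_ae ?_
    filter_upwards [hbd] with o ho
    simp [ENNReal.toReal_ofReal ho.1]

end MissingAtRandom

/-! ### The entropy, the inverse `f` of `g`, and duality -/

namespace GECSpec

variable {𝓧 : Type*} {p d : ℕ} {M : GECSpec 𝓧 p d}

theorem f_mem {t : ℝ} (ht : t ∈ M.g '' M.V) : M.f t ∈ M.V :=
  Function.invFunOn_mem ht

theorem g_f {t : ℝ} (ht : t ∈ M.g '' M.V) : M.g (M.f t) = t :=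
  Function.invFunOn_eq ht

namespace EntropyCond

theorem contDiffOn_g (hG : M.EntropyCond) : ContDiffOn ℝ 2 M.g M.V :=
  hG.contDiffOn.deriv_of_isOpen hG.isOpen (by norm_num)

theorem contDiffOn_g' (hG : M.EntropyCond) : ContDiffOn ℝ 1 M.g' M.V :=
  hG.contDiffOn_g.deriv_of_isOpen hG.isOpen (by norm_num)

theorem hasDerivAt_G (hG : M.EntropyCond) {w : ℝ} (hw : w ∈ M.V) : HasDerivAt M.G (M.g w) w :=
  ((hG.contDiffOn.contDiffAt (hG.isOpen.mem_nhds hw)).differentiableAt (by norm_num)).hasDerivAt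

theorem hasStrictDerivAt_g (hG : M.EntropyCond) {w : ℝ} (hw : w ∈ M.V) :
    HasStrictDerivAt M.g (M.g' w) w :=
  (hG.contDiffOn_g.contDiffAt (hG.isOpen.mem_nhds hw)).hasStrictDerivAt (by norm_num)

theorem strictMonoOn_g (hG : M.EntropyCond) : StrictMonoOn M.g M.V := by
  refine strictMonoOn_of_deriv_pos hG.ordConnected.convex hG.contDiffOn_g.continuousOn ?_
  intro w hw
  exact hG.deriv2_pos w (interior_subset hw)

theorem f_g (hG : M.EntropyCond) {w : ℝ} (hw : w ∈ M.V) : M.f (M.g w) = w :=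
  hG.strictMonoOn_g.injOn.leftInvOn_invFunOn hw

/-- `f` is a global inverse on `V`, and it coincides near `g(w)` with the local inverse from the
inverse function theorem, because the latter takes values in `V`, where `g` is injective. -/
theorem hasStrictDerivAt_f (hG : M.EntropyCond) {w : ℝ} (hw : w ∈ M.V) :
    HasStrictDerivAt M.f (M.g' w)⁻¹ (M.g w) := by
  have hg := hG.hasStrictDerivAt_g hw
  have hne := (hG.deriv2_pos w hw).ne'
  refine (hg.to_localInverse hne).congr_of_eventuallyEq ?_
  have hF := hg.hasStrictFDerivAt_equiv hne
  have hcont := hF.localInverse_continuousAt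
  have hV : M.V ∈ 𝓝 (HasStrictFDerivAt.localInverse M.g _ w hF (M.g w)) := by
    rw [hF.localInverse_apply_image]; exact hG.isOpen.mem_nhds hw
  filter_upwards [hF.eventually_right_inverse, hcont hV] with y h1 h2
  change HasStrictFDerivAt.localInverse M.g _ w hF y = M.f y
  conv_rhs => rw [← h1]
  exact (hG.f_g h2).symm

theorem measurable_f (hG : M.EntropyCond) : Measurable M.f := by
  classical
  have hord : (M.g '' M.V).OrdConnected :=
    (hG.ordConnected.isPreconnected.image _ hG.contDiffOn_g.continuousOn).ordConnected
  have hcont : ContinuousOn M.f (M.g '' M.V) := by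
    rintro _ ⟨w, hw, rfl⟩
    exact (hG.hasStrictDerivAt_f hw).hasDerivAt.continuousAt.continuousWithinAt
  -- Off the image of `g`, `invFunOn` takes one fixed default value, so `f` is continuous on an
  -- interval and constant elsewhere.
  have hpw : M.f = (M.g '' M.V).piecewise M.f (fun _ => Classical.choice inferInstance) := by
    ext t
    by_cases ht : t ∈ M.g '' M.V
    · rw [Set.piecewise_eq_of_mem _ _ _ ht]
    · rw [Set.piecewise_eq_of_notMem _ _ _ ht]
      exact Function.invFunOn_neg ht
  rw [hpw]
  exact hcont.measurable_piecewise continuousOn_const hord.measurableSet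

theorem image_Icc_g (hG : M.EntropyCond) {a b : ℝ} (hab : a ≤ b) (h : Set.Icc a b ⊆ M.V) :
    Set.Icc (M.g a) (M.g b) ⊆ M.g '' Set.Icc a b :=
  intermediate_value_Icc hab (hG.contDiffOn_g.continuousOn.mono h)

theorem exists_lipschitzOnWith_f (hG : M.EntropyCond) {a b : ℝ} (hab : a ≤ b)
    (h : Set.Icc a b ⊆ M.V) : ∃ K : NNReal, LipschitzOnWith K M.f (Set.Icc (M.g a) (M.g b)) := by
  obtain ⟨w₀, hw₀, hmin⟩ := isCompact_Icc.exists_isMinOn (Set.nonempty_Icc.2 hab)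
    (hG.contDiffOn_g'.continuousOn.mono h)
  have hpos := hG.deriv2_pos w₀ (h hw₀)
  refine ⟨⟨(M.g' w₀)⁻¹, (inv_pos.2 hpos).le⟩, ?_⟩
  refine Convex.lipschitzOnWith_of_nnnorm_hasDerivWithin_le (f' := fun t => (M.g' (M.f t))⁻¹)
    (convex_Icc _ _) ?_ ?_
  · intro t ht
    obtain ⟨w, hw, rfl⟩ := hG.image_Icc_g hab h ht
    rw [hG.f_g (h hw)]
    exact (hG.hasStrictDerivAt_f (h hw)).hasDerivAt.hasDerivWithinAt
  · intro t ht
    obtain ⟨w, hw, rfl⟩ := hG.image_Icc_g hab h ht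
    rw [hG.f_g (h hw)]
    have h1 : M.g' w₀ ≤ M.g' w := hmin hw
    change |(M.g' w)⁻¹| ≤ (M.g' w₀)⁻¹
    rw [abs_of_pos (inv_pos.2 (hpos.trans_le h1))]
    exact inv_anti₀ hpos h1

theorem G_ge_tangent (hG : M.EntropyCond) {w v : ℝ} (hw : w ∈ M.V) (hv : v ∈ M.V) :
    M.G w + M.g w * (v - w) ≤ M.G v := by
  rcases lt_trichotomy w v with h | h | h
  · have := hG.strictConvexOn.convexOn.le_slope_of_hasDerivAt hw hv h (hG.hasDerivAt_G hw)
    rw [slope_def_field, le_div_iff₀ (by linarith)] at this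
    linarith
  · simp [h]
  · have := hG.strictConvexOn.convexOn.slope_le_of_hasDerivAt hv hw h (hG.hasDerivAt_G hw)
    rw [slope_def_field, div_le_iff₀ (by linarith)] at this
    linarith

end EntropyCond

/-- Weak duality. The tangent line of `G` at `ωᵢ` has slope `g(ωᵢ) = l·zᵢ qᵢ`; after division by
`qᵢ` and summation, the linear term becomes `l` paired with the difference of two weighted totals of
`z`, which is zero since both weight vectors satisfy the constraints. -/
theorem isGECWeights_of_dual (hG : M.EntropyCond) {N : ℕ} {φ : EuclideanSpace ℝ (Fin d)}
    {s : Fin N → Obs 𝓧} {l : ZIdx p d → ℝ} (hps : ∀ i, (M.ps (s i).x φ)⁻¹ ∈ M.V)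
    (hq : ∀ i, 0 < M.q (s i).x)
    (hl : ∀ i, (l ⬝ᵥ M.z φ (s i).x) * M.q (s i).x ∈ M.g '' M.V)
    (hcal : ∀ k, ∑ i, (s i).δ * M.omega l φ (s i).x * M.z φ (s i).x k =
      ∑ i, M.z φ (s i).x k) :
    M.IsGECWeights φ s (fun i => M.omega l φ (s i).x) := by
  refine ⟨hps, ⟨fun i _ => f_mem (hl i), hcal⟩, ?_⟩
  intro w hw
  change M.entropy s _ ≤ M.entropy s w
  have htan : ∀ i, (s i).δ * M.G (M.omega l φ (s i).x) * (M.q (s i).x)⁻¹ +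
      (s i).δ * (w i - M.omega l φ (s i).x) * (l ⬝ᵥ M.z φ (s i).x) ≤
      (s i).δ * M.G (w i) * (M.q (s i).x)⁻¹ := by
    intro i
    by_cases hr : (s i).resp = true
    · have hδ : (s i).δ = 1 := if_pos hr
      have h1 := hG.G_ge_tangent (f_mem (hl i)) (hw.1 i hr)
      rw [g_f (hl i)] at h1
      have h2 := mul_le_mul_of_nonneg_right h1 (inv_pos.2 (hq i)).le
      have h3 := mul_inv_cancel₀ (hq i).ne'
      rw [hδ]
      unfold omega
      calc _ = (M.G (M.f (l ⬝ᵥ M.z φ (s i).x * M.q (s i).x)) +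
            l ⬝ᵥ M.z φ (s i).x * M.q (s i).x *
            (w i - M.f (l ⬝ᵥ M.z φ (s i).x * M.q (s i).x))) * (M.q (s i).x)⁻¹ := by
            field_simp [(hq i).ne']
        _ ≤ _ := by rw [one_mul]; exact h2
    · have hδ : (s i).δ = 0 := if_neg hr
      simp [hδ]
  have hzero : ∑ i, (s i).δ * (w i - M.omega l φ (s i).x) * (l ⬝ᵥ M.z φ (s i).x) = 0 := by
    have : ∀ i, (s i).δ * (w i - M.omega l φ (s i).x) * (l ⬝ᵥ M.z φ (s i).x) =
        ∑ k, l k * ((s i).δ * w i * M.z φ (s i).x k -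
          (s i).δ * M.omega l φ (s i).x * M.z φ (s i).x k) := by
      intro i
      rw [dotProduct, Finset.mul_sum]
      exact Finset.sum_congr rfl fun k _ => by ring
    simp only [this]
    rw [Finset.sum_comm]
    refine Finset.sum_eq_zero fun k _ => ?_
    rw [← Finset.mul_sum, Finset.sum_sub_distrib, hw.2 k, hcal k, sub_self, mul_zero]
  have hs := Finset.sum_le_sum fun i (_ : i ∈ Finset.univ) => htan i
  rw [Finset.sum_add_distrib, hzero, add_zero] at hs
  exact hs

end GECSpec

/-! ### Measurable envelopes for suprema over a ball -/

section Envelope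

variable {𝓧 E F : Type*} [MeasurableSpace 𝓧] [NormedAddCommGroup E] [NormedSpace ℝ E]
  [NormedAddCommGroup F] [NormedSpace ℝ F]

theorem measurable_fderiv_apply_of_differentiableAt [MeasurableSpace F] [BorelSpace F]
    [SecondCountableTopology F] {h : 𝓧 → E → F} (hm : ∀ θ, Measurable fun x => h x θ) {a : E}
    (hd : ∀ x, DifferentiableAt ℝ (h x) a) (v : E) :
    Measurable fun x => fderiv ℝ (h x) a v := by
  refine measurable_of_tendsto_metrizable
    (f := fun (n : ℕ) x => (n : ℝ) • (h x (a + (n : ℝ)⁻¹ • v) - h x a)) ?_ ?_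
  · intro n
    exact ((hm _).sub (hm _)).const_smul (n : ℝ)
  · rw [tendsto_pi_nhds]
    intro x
    exact (hd x).hasFDerivAt.lim v (c := fun n : ℕ => (n : ℝ))
      (by simpa using tendsto_natCast_atTop_atTop)

-- The supremum in the moment condition need not be measurable, so it is replaced by the supremum
-- over a dense sequence in the open ball. Continuity in the parameter extends the bound to the
-- whole open ball, and the root of order `s` turns it into an `L^s` envelope.
omit [NormedSpace ℝ E] in
theorem exists_measurable_envelope [TopologicalSpace.SeparableSpace E] {S : Type*}
    [MeasurableSpace S] {P : Measure S} {X : S → 𝓧} (hX : Measurable X) {h : 𝓧 → E → ℝ}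
    (h0 : ∀ x θ, 0 ≤ h x θ) (hc : ∀ x, Continuous (h x)) (hm : ∀ θ, Measurable fun x => h x θ)
    {a : E} {ε s : ℝ} (hs : 0 < s)
    (hfin : ∫⁻ o, ⨆ θ ∈ Metric.closedBall a ε, ENNReal.ofReal (h (X o) θ ^ s) ∂P < ⊤) :
    ∃ B : 𝓧 → ℝ, Measurable B ∧ (∀ x, 0 ≤ B x) ∧
      MemLp (fun o => B (X o)) (ENNReal.ofReal s) P ∧
      ∀ᵐ o ∂P, ∀ θ ∈ Metric.ball a ε, h (X o) θ ≤ B (X o) := by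
  let T := TopologicalSpace.denseSeq E
  let e : 𝓧 → ENNReal := fun x =>
    ⨆ (i : ℕ) (_ : T i ∈ Metric.ball a ε), ENNReal.ofReal (h x (T i) ^ s)
  have hem : Measurable e := Measurable.iSup fun i => Measurable.iSup fun _ =>
    ((hm _).pow_const s).ennreal_ofReal
  have hefin : ∫⁻ o, e (X o) ∂P < ⊤ := by
    refine lt_of_le_of_lt (lintegral_mono fun o => ?_) hfin
    refine iSup_le fun i => iSup_le fun hi => ?_
    exact le_iSup₂_of_le (T i) (Metric.ball_subset_closedBall hi) le_rfl
  have hlt : ∀ᵐ o ∂P, e (X o) < ⊤ := ae_lt_top (hem.comp hX) hefin.ne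
  refine ⟨fun x => (e x).toReal ^ s⁻¹, hem.ennreal_toReal.pow_const _,
    fun x => Real.rpow_nonneg ENNReal.toReal_nonneg _, ⟨?_, ?_⟩, ?_⟩
  · exact ((hem.comp hX).ennreal_toReal.pow_const _).aestronglyMeasurable
  · rw [eLpNorm_lt_top_iff_lintegral_rpow_enorm_lt_top (by simpa using hs) ENNReal.ofReal_ne_top,
      ENNReal.toReal_ofReal hs.le]
    refine lt_of_le_of_lt (le_of_eq (lintegral_congr_ae ?_)) hefin
    filter_upwards [hlt] with o ho
    rw [Real.enorm_eq_ofReal (Real.rpow_nonneg ENNReal.toReal_nonneg _),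
      ENNReal.ofReal_rpow_of_nonneg (Real.rpow_nonneg ENNReal.toReal_nonneg _) hs.le,
      ← Real.rpow_mul ENNReal.toReal_nonneg, inv_mul_cancel₀ hs.ne', Real.rpow_one,
      ENNReal.ofReal_toReal ho.ne]
  · filter_upwards [hlt] with o ho θ hθ
    have hclosed : IsClosed {θ | ENNReal.ofReal (h (X o) θ ^ s) ≤ e (X o)} :=
      isClosed_le (ENNReal.continuous_ofReal.comp
        ((hc (X o)).rpow_const fun _ => Or.inr hs.le)) continuous_const
    have hmem : θ ∈ {θ | ENNReal.ofReal (h (X o) θ ^ s) ≤ e (X o)} := by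
      refine closure_minimal ?_ hclosed
        ((TopologicalSpace.denseRange_denseSeq E).open_subset_closure_inter Metric.isOpen_ball hθ)
      rintro _ ⟨hi, i, rfl⟩
      exact le_iSup₂_of_le (f := fun i (_ : T i ∈ Metric.ball a ε) =>
        ENNReal.ofReal (h (X o) (T i) ^ s)) i hi le_rfl
    have h1 : h (X o) θ ^ s ≤ (e (X o)).toReal := by
      have := (ENNReal.ofReal_le_iff_le_toReal ho.ne).1 hmem
      exact this
    calc h (X o) θ = (h (X o) θ ^ s) ^ s⁻¹ := by
          rw [← Real.rpow_mul (h0 _ _), mul_inv_cancel₀ hs.ne', Real.rpow_one]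
      _ ≤ _ := Real.rpow_le_rpow (Real.rpow_nonneg (h0 _ _) _) h1 (inv_pos.2 hs).le

end Envelope

/-- The operator norm is at most the Frobenius norm, by the Cauchy-Schwarz inequality. -/
theorem ContinuousLinearMap.norm_apply_le_sqrt_sum {d : ℕ} {F : Type*} [NormedAddCommGroup F]
    [NormedSpace ℝ F] (A : EuclideanSpace ℝ (Fin d) →L[ℝ] F) :
    ‖A‖ ≤ √(∑ j : Fin d, ‖A (EuclideanSpace.single j 1)‖ ^ 2) := by
  refine A.opNorm_le_bound (Real.sqrt_nonneg _) fun v => ?_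
  have hv : v = ∑ j, v j • EuclideanSpace.single j (1 : ℝ) := by
    ext i
    simp [Pi.single_apply]
  calc ‖A v‖ = ‖∑ j, v j • A (EuclideanSpace.single j 1)‖ := by
        conv_lhs => rw [hv]
        simp
    _ ≤ ∑ j, ‖A (EuclideanSpace.single j 1)‖ * ‖v j‖ := by
        refine (norm_sum_le _ _).trans (le_of_eq (Finset.sum_congr rfl fun j _ => ?_))
        rw [norm_smul, mul_comm]
    _ ≤ √(∑ j, ‖A (EuclideanSpace.single j 1)‖ ^ 2) * √(∑ j, ‖v j‖ ^ 2) :=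
        Real.sum_mul_le_sqrt_mul_sqrt _ _ _
    _ = _ := by rw [EuclideanSpace.norm_eq]

/-! ### Derivatives of the propensity model and measurability of the covariates -/

namespace GECSpec

section Propensity

variable {𝓧 : Type*} {p d : ℕ} {M : GECSpec 𝓧 p d}

theorem fderiv_ps_apply {x : 𝓧} (hps : ContDiff ℝ 2 (M.ps x)) (φ v : EuclideanSpace ℝ (Fin d)) :
    fderiv ℝ (M.ps x) φ v = ∑ j, M.ps' x φ j * v j := by
  have h := ((hps.differentiable (by norm_num)) φ).hasGradientAt.hasFDerivAt
  rw [h.fderiv, InnerProductSpace.toDual_apply_apply, PiLp.inner_apply]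
  refine Finset.sum_congr rfl fun j _ => ?_
  simp [ps', mul_comm]

theorem ps'_apply {x : 𝓧} (hps : ContDiff ℝ 2 (M.ps x)) (φ : EuclideanSpace ℝ (Fin d))
    (j : Fin d) : M.ps' x φ j = fderiv ℝ (M.ps x) φ (EuclideanSpace.single j 1) := by
  rw [fderiv_ps_apply hps]
  simp

theorem contDiff_ps' {x : 𝓧} (hps : ContDiff ℝ 2 (M.ps x)) : ContDiff ℝ 1 (M.ps' x) := by
  have h1 : ContDiff ℝ 1 (fderiv ℝ (M.ps x)) := hps.fderiv_right (by norm_num)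
  exact (InnerProductSpace.toDual ℝ
    (EuclideanSpace ℝ (Fin d))).symm.contDiff.comp h1

theorem continuous_hessFrob {x : 𝓧} (hps : ContDiff ℝ 2 (M.ps x)) :
    Continuous (M.hessFrob x) := by
  have h := (contDiff_ps' hps).continuous_fderiv (by norm_num)
  unfold hessFrob
  fun_prop

theorem norm_fderiv_ps'_le (x : 𝓧) (φ : EuclideanSpace ℝ (Fin d)) :
    ‖fderiv ℝ (M.ps' x) φ‖ ≤ M.hessFrob x φ :=
  ContinuousLinearMap.norm_apply_le_sqrt_sum _

theorem norm_fderiv_ps {x : 𝓧} (φ : EuclideanSpace ℝ (Fin d)) :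
    ‖fderiv ℝ (M.ps x) φ‖ = ‖M.ps' x φ‖ := by
  simp [ps', gradient]

variable [MeasurableSpace 𝓧]

theorem measurable_ps' (hmeas : M.MeasurabilityCond) (hps : ∀ x, ContDiff ℝ 2 (M.ps x))
    (φ : EuclideanSpace ℝ (Fin d)) : Measurable fun x => M.ps' x φ := by
  have h : ∀ j, Measurable fun x => M.ps' x φ j := by
    intro j
    simp only [ps'_apply (hps _)]
    exact measurable_fderiv_apply_of_differentiableAt hmeas.ps
      (fun x => (hps x).differentiable (by norm_num) φ) _
  have : (fun x => M.ps' x φ) = fun x => WithLp.toLp 2 fun j => M.ps' x φ j := by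
    ext x j; rfl
  rw [this]
  exact (PiLp.continuous_toLp 2 _).measurable.comp (measurable_pi_lambda _ h)

theorem measurable_fderiv_ps' (hmeas : M.MeasurabilityCond) (hps : ∀ x, ContDiff ℝ 2 (M.ps x))
    (φ v : EuclideanSpace ℝ (Fin d)) : Measurable fun x => fderiv ℝ (M.ps' x) φ v :=
  measurable_fderiv_apply_of_differentiableAt (measurable_ps' hmeas hps)
    (fun x => (contDiff_ps' (hps x)).differentiable (by norm_num) φ) _

theorem measurable_hessFrob (hmeas : M.MeasurabilityCond) (hps : ∀ x, ContDiff ℝ 2 (M.ps x))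
    (φ : EuclideanSpace ℝ (Fin d)) : Measurable fun x => M.hessFrob x φ := by
  unfold hessFrob
  have := measurable_fderiv_ps' hmeas hps φ
  fun_prop

theorem measurable_z (hmeas : M.MeasurabilityCond) (hps : ∀ x, ContDiff ℝ 2 (M.ps x))
    (φ : EuclideanSpace ℝ (Fin d)) (k : ZIdx p d) : Measurable fun x => M.z φ x k := by
  have hg : Measurable M.g := measurable_deriv _
  have hg' : Measurable M.g' := measurable_deriv _
  have h1 := hmeas.ps φ
  have h2 := hmeas.q
  have h3 := measurable_ps' hmeas hps φ
  rcases k with j | j | j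
  · exact hmeas.b j
  · simp only [z, Sum.elim_inr, Sum.elim_inl]
    fun_prop
  · simp only [z, Sum.elim_inr]
    fun_prop

end Propensity

end GECSpec

/-! ### Calculus of bounded Lipschitz functions -/

/-- `F` is bounded by `B` and Lipschitz with constant `L` on `s`. -/
structure BddLipschitzOn {E : Type*} [PseudoMetricSpace E] (F : E → ℝ) (s : Set E) (B L : ℝ) :
    Prop where
  abs_le : ∀ x ∈ s, |F x| ≤ B
  abs_sub_le : ∀ x ∈ s, ∀ y ∈ s, |F x - F y| ≤ L * dist x y

namespace BddLipschitzOn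

variable {E : Type*} [PseudoMetricSpace E] {F G : E → ℝ} {s : Set E} {B L B' L' : ℝ}

theorem const {v : ℝ} (hv : |v| ≤ B) : BddLipschitzOn (fun _ : E => v) s B 0 :=
  ⟨fun _ _ => hv, fun _ _ _ _ => by simp⟩

theorem mono (h : BddLipschitzOn F s B L) (hB : B ≤ B') (hL : L ≤ L') :
    BddLipschitzOn F s B' L' :=
  ⟨fun x hx => (h.abs_le x hx).trans hB, fun x hx y hy =>
    (h.abs_sub_le x hx y hy).trans (mul_le_mul_of_nonneg_right hL dist_nonneg)⟩

theorem add (hF : BddLipschitzOn F s B L) (hG : BddLipschitzOn G s B' L') :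
    BddLipschitzOn (fun x => F x + G x) s (B + B') (L + L') := by
  refine ⟨fun x hx => (abs_add_le _ _).trans (add_le_add (hF.abs_le x hx) (hG.abs_le x hx)),
    fun x hx y hy => ?_⟩
  have e : F x + G x - (F y + G y) = (F x - F y) + (G x - G y) := by ring
  rw [e, add_mul]
  exact (abs_add_le _ _).trans (add_le_add (hF.abs_sub_le x hx y hy) (hG.abs_sub_le x hx y hy))

theorem mul (hF : BddLipschitzOn F s B L) (hG : BddLipschitzOn G s B' L') :
    BddLipschitzOn (fun x => F x * G x) s (B * B') (B * L' + B' * L) := by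
  refine ⟨fun x hx => ?_, fun x hx y hy => ?_⟩
  · rw [abs_mul]
    exact mul_le_mul (hF.abs_le x hx) (hG.abs_le x hx) (abs_nonneg _)
      ((abs_nonneg _).trans (hF.abs_le x hx))
  · have e : F x * G x - F y * G y = F x * (G x - G y) + G y * (F x - F y) := by ring
    rw [e]
    refine (abs_add_le _ _).trans ?_
    rw [abs_mul, abs_mul, add_mul, mul_assoc, mul_assoc]
    exact add_le_add
      (mul_le_mul (hF.abs_le x hx) (hG.abs_sub_le x hx y hy) (abs_nonneg _)
        ((abs_nonneg _).trans (hF.abs_le x hx)))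
      (mul_le_mul (hG.abs_le y hy) (hF.abs_sub_le x hx y hy) (abs_nonneg _)
        ((abs_nonneg _).trans (hG.abs_le y hy)))

theorem sum {ι : Type*} (t : Finset ι) {F : ι → E → ℝ} {B L : ι → ℝ}
    (h : ∀ i ∈ t, BddLipschitzOn (F i) s (B i) (L i)) :
    BddLipschitzOn (fun x => ∑ i ∈ t, F i x) s (∑ i ∈ t, B i) (∑ i ∈ t, L i) := by
  refine ⟨fun x hx => (Finset.abs_sum_le_sum_abs _ _).trans
    (Finset.sum_le_sum fun i hi => (h i hi).abs_le x hx), fun x hx y hy => ?_⟩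
  rw [← Finset.sum_sub_distrib, Finset.sum_mul]
  exact (Finset.abs_sum_le_sum_abs _ _).trans
    (Finset.sum_le_sum fun i hi => (h i hi).abs_sub_le x hx y hy)

theorem comp {A : ℝ → ℝ} {T : Set ℝ} (hA : BddLipschitzOn A T B L) (hL : 0 ≤ L)
    (hT : ∀ x ∈ s, F x ∈ T) (hF : ∀ x ∈ s, ∀ y ∈ s, |F x - F y| ≤ L' * dist x y) :
    BddLipschitzOn (fun x => A (F x)) s B (L * L') := by
  refine ⟨fun x hx => hA.abs_le _ (hT x hx), fun x hx y hy => ?_⟩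
  refine (hA.abs_sub_le _ (hT x hx) _ (hT y hy)).trans ?_
  rw [mul_assoc, Real.dist_eq]
  exact mul_le_mul_of_nonneg_left (hF x hx y hy) hL

theorem comp_snd {E' : Type*} [PseudoMetricSpace E'] {a : E' × E} {r : ℝ}
    (hF : BddLipschitzOn F (Metric.ball a.2 r) B L) (hL : 0 ≤ L) :
    BddLipschitzOn (fun θ : E' × E => F θ.2) (Metric.ball a r) B L := by
  have hmem : ∀ θ ∈ Metric.ball a r, θ.2 ∈ Metric.ball a.2 r := fun θ hθ => by
    rw [Metric.mem_ball, Prod.dist_eq] at hθ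
    exact (le_max_right _ _).trans_lt hθ
  refine ⟨fun x hx => hF.abs_le _ (hmem x hx), fun x hx y hy => ?_⟩
  exact (hF.abs_sub_le _ (hmem x hx) _ (hmem y hy)).trans
    (mul_le_mul_of_nonneg_left (le_max_right _ _) hL)

theorem lipschitzOnWith (hF : BddLipschitzOn F s B L) : LipschitzOnWith L.toNNReal F s :=
  LipschitzOnWith.of_dist_le_mul fun x hx y hy => by
    rw [Real.dist_eq]
    exact (hF.abs_sub_le x hx y hy).trans
      (mul_le_mul_of_nonneg_right (Real.le_coe_toNNReal L) dist_nonneg)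

theorem of_contDiffOn_Icc {A : ℝ → ℝ} {α β : ℝ} (hA : ContDiffOn ℝ 1 A (Set.Icc α β)) :
    ∃ K, 0 ≤ K ∧ BddLipschitzOn A (Set.Icc α β) K K := by
  obtain ⟨K₁, h₁⟩ := isCompact_Icc.exists_bound_of_continuousOn hA.continuousOn
  obtain ⟨K₂, h₂⟩ := hA.exists_lipschitzOnWith one_ne_zero (convex_Icc _ _) isCompact_Icc
  refine ⟨max |K₁| K₂, (abs_nonneg _).trans (le_max_left _ _), fun x hx => ?_,
    fun x hx y hy => ?_⟩
  · exact (h₁ x hx).trans ((le_abs_self _).trans (le_max_left _ _))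
  · have := h₂.dist_le_mul x hx y hy
    rw [Real.dist_eq] at this
    exact this.trans (mul_le_mul_of_nonneg_right (le_max_right _ _) dist_nonneg)

end BddLipschitzOn

/-! ### Deterministic control of covariates and weights near the limit -/

namespace GECSpec

/-- The multiplier that selects the debiasing covariate. -/
def debiasVec (p d : ℕ) : ZIdx p d → ℝ := Pi.single (Sum.inr (Sum.inr ())) 1

variable {𝓧 : Type*} {p d : ℕ} {M : GECSpec 𝓧 p d}

theorem debiasVec_dotProduct_mul {x : 𝓧} (hq : M.q x ≠ 0) (φ : EuclideanSpace ℝ (Fin d)) :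
    (debiasVec p d ⬝ᵥ M.z φ x) * M.q x = M.g (M.ps x φ)⁻¹ := by
  simp [debiasVec, z, hq]

/-- The coefficient of the gradient of the propensity model in the calibration covariates, as a
function of the propensity. -/
def gradCoef (M : GECSpec 𝓧 p d) (t : ℝ) : ℝ := -(M.g' t⁻¹) * (t ^ 2)⁻¹

theorem contDiffAt_gradCoef (hG : M.EntropyCond) {t : ℝ} (ht : t⁻¹ ∈ M.V) :
    ContDiffAt ℝ 1 M.gradCoef t := by
  have ht0 : t ≠ 0 := (inv_pos.1 (hG.pos ht)).ne'
  have h1 : ContDiffAt ℝ 1 M.g' t⁻¹ := hG.contDiffOn_g'.contDiffAt (hG.isOpen.mem_nhds ht)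
  have h2 : ContDiffAt ℝ 1 (fun t : ℝ => t⁻¹) t := contDiffAt_inv ℝ ht0
  exact (ContDiffAt.comp t h1 h2).neg.mul
    ((contDiffAt_id.pow 2).inv (pow_ne_zero 2 ht0))

theorem contDiffAt_g_inv (hG : M.EntropyCond) {t : ℝ} (ht : t⁻¹ ∈ M.V) :
    ContDiffAt ℝ 1 (fun t => M.g t⁻¹) t := by
  have ht0 : t ≠ 0 := (inv_pos.1 (hG.pos ht)).ne'
  have h1 : ContDiffAt ℝ 1 M.g t⁻¹ :=
    (hG.contDiffOn_g.contDiffAt (hG.isOpen.mem_nhds ht)).of_le (by norm_num)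
  exact ContDiffAt.comp t h1 (contDiffAt_inv ℝ ht0)

/-- The functions of the model are controlled at `x`, near the parameter `φ₀`, by the envelope
value `Q`. -/
structure EnvelopeAt (M : GECSpec 𝓧 p d) (φ₀ : EuclideanSpace ℝ (Fin d)) (c₀ a b ε Q : ℝ) (x : 𝓧) :
    Prop where
  one_le : 1 ≤ Q
  contDiff_ps : ContDiff ℝ 2 (M.ps x)
  ps_mem : (M.ps x φ₀)⁻¹ ∈ Set.Icc a b
  q_ge : c₀ ≤ M.q x
  b_le : ∀ j, |M.b x j| ≤ Q
  ps'_le : ∀ φ ∈ Metric.ball φ₀ ε, ‖M.ps' x φ‖ ^ 2 ≤ Q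
  hess_le : ∀ φ ∈ Metric.ball φ₀ ε, M.hessFrob x φ ≤ Q
  q_le : M.q x ≤ c₀⁻¹

/-- Near the point `(λ, φ₀)` the weights are defined, and with the calibration covariates they are
bounded and Lipschitz. -/
structure LocalControl (M : GECSpec 𝓧 p d) (φ₀ : EuclideanSpace ℝ (Fin d)) (C Q r : ℝ) (x : 𝓧) :
    Prop where
  ps_mem : ∀ θ ∈ Metric.ball (debiasVec p d, φ₀) r, (M.ps x θ.2)⁻¹ ∈ M.V
  dual_mem : ∀ θ ∈ Metric.ball (debiasVec p d, φ₀) r,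
    (θ.1 ⬝ᵥ M.z θ.2 x) * M.q x ∈ M.g '' M.V
  z : ∀ k, BddLipschitzOn (fun θ => M.z θ.2 x k) (Metric.ball (debiasVec p d, φ₀) r) (C * Q) (C * Q)
  omega : BddLipschitzOn (fun θ => M.omega θ.1 θ.2 x) (Metric.ball (debiasVec p d, φ₀) r)
    C (C * Q)

/-- The gradient of the propensity is bounded by `√Q` and its Hessian by `Q`. Differentiating the
covariates produces at most products of two gradients, or one Hessian, with coefficients bounded on
the compact range of the propensity; so all constants are linear in `Q`. -/
theorem exists_bddLipschitzOn_z (hG : M.EntropyCond) {c₀ a' b' : ℝ} (hc₀ : 0 < c₀) (hb' : 0 < b')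
    (hV : Set.Icc a' b' ⊆ M.V) :
    ∃ C : ℝ, 0 < C ∧ ∀ (φ₀ : EuclideanSpace ℝ (Fin d)) (a b ε Q : ℝ) (x : 𝓧),
      M.EnvelopeAt φ₀ c₀ a b ε Q x → ∀ r ≤ ε,
        (∀ φ ∈ Metric.ball φ₀ r, M.ps x φ ∈ Set.Icc b'⁻¹ a'⁻¹) →
        ∀ k, BddLipschitzOn (fun φ => M.z φ x k) (Metric.ball φ₀ r) (C * Q) (C * Q) := by
  have hinv : ∀ t ∈ Set.Icc b'⁻¹ a'⁻¹, t⁻¹ ∈ M.V := fun t ht => hV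
    ⟨by have := inv_anti₀ ((inv_pos.2 hb').trans_le ht.1) ht.2; rwa [inv_inv] at this,
     by have := inv_anti₀ (inv_pos.2 hb') ht.1; rwa [inv_inv] at this⟩
  obtain ⟨K₁, hK₁0, hK₁⟩ := BddLipschitzOn.of_contDiffOn_Icc (A := M.gradCoef) (α := b'⁻¹)
    (β := a'⁻¹) fun t ht => (contDiffAt_gradCoef hG (hinv t ht)).contDiffWithinAt
  obtain ⟨K₀, hK₀0, hK₀⟩ := BddLipschitzOn.of_contDiffOn_Icc (A := fun t => M.g t⁻¹) (α := b'⁻¹)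
    (β := a'⁻¹) fun t ht => (contDiffAt_g_inv hG (hinv t ht)).contDiffWithinAt
  have hc₀' : 0 < c₀⁻¹ := inv_pos.2 hc₀
  refine ⟨1 + 2 * K₁ * c₀⁻¹ + K₀ * c₀⁻¹, by positivity, ?_⟩
  intro φ₀ a b ε Q x hx r hr hmem
  have hQ0 : 0 ≤ Q := zero_le_one.trans hx.one_le
  have hsQ : √Q * √Q = Q := Real.mul_self_sqrt hQ0
  have hsQ' : √Q ≤ Q := by
    rw [Real.sqrt_le_left hQ0]; nlinarith [hx.one_le]
  have hbd : ∀ φ ∈ Metric.ball φ₀ r, ‖M.ps' x φ‖ ≤ √Q := fun φ hφ =>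
    Real.le_sqrt_of_sq_le (hx.ps'_le φ (Metric.ball_subset_ball hr hφ))
  have hpsL : ∀ φ ∈ Metric.ball φ₀ r, ∀ φ' ∈ Metric.ball φ₀ r,
      |M.ps x φ - M.ps x φ'| ≤ √Q * dist φ φ' := by
    intro φ hφ φ' hφ'
    rw [dist_eq_norm, ← Real.norm_eq_abs]
    refine (convex_ball φ₀ r).norm_image_sub_le_of_norm_fderiv_le (𝕜 := ℝ)
      (fun ψ _ => hx.contDiff_ps.differentiable (by norm_num) ψ) (fun ψ hψ => ?_) hφ' hφ
    rw [norm_fderiv_ps]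
    exact hbd ψ hψ
  have hqpos : 0 < M.q x := hc₀.trans_le hx.q_ge
  have hqi : |(M.q x)⁻¹| ≤ c₀⁻¹ := by
    rw [abs_of_pos (inv_pos.2 hqpos)]; exact inv_anti₀ hc₀ hx.q_ge
  have hq : BddLipschitzOn (fun _ : EuclideanSpace ℝ (Fin d) => (M.q x)⁻¹) (Metric.ball φ₀ r)
    c₀⁻¹ 0 := .const hqi
  have hps' : ∀ j, BddLipschitzOn (fun φ => M.ps' x φ j) (Metric.ball φ₀ r) (√Q) Q := by
    intro j
    refine ⟨fun φ hφ => ?_, fun φ hφ φ' hφ' => ?_⟩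
    · exact (PiLp.norm_apply_le (M.ps' x φ) j).trans (hbd φ hφ)
    · have h1 : ‖M.ps' x φ - M.ps' x φ'‖ ≤ Q * ‖φ - φ'‖ := by
        refine (convex_ball φ₀ r).norm_image_sub_le_of_norm_fderiv_le (𝕜 := ℝ)
          (fun ψ _ => (contDiff_ps' hx.contDiff_ps).differentiable (by norm_num) ψ)
          (fun ψ hψ => ?_) hφ' hφ
        exact (norm_fderiv_ps'_le x ψ).trans (hx.hess_le ψ (Metric.ball_subset_ball hr hψ))
      rw [dist_eq_norm]
      exact (PiLp.norm_apply_le (M.ps' x φ - M.ps' x φ') j).trans h1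
  have hKc₁ : 0 ≤ K₁ * c₀⁻¹ := by positivity
  have hKc₀ : 0 ≤ K₀ * c₀⁻¹ := by positivity
  rintro (j | j | j)
  · refine (BddLipschitzOn.const (hx.b_le j)).mono ?_ (by positivity)
    nlinarith [mul_nonneg hKc₁ hQ0, mul_nonneg hKc₀ hQ0]
  · have h := ((hK₁.comp hK₁0 hmem hpsL).mul hq).mul (hps' j)
    refine h.mono ?_ ?_
    · nlinarith [mul_nonneg hKc₁ hQ0, mul_nonneg hKc₀ hQ0, mul_le_mul_of_nonneg_left hsQ' hKc₁]
    · have : K₁ * c₀⁻¹ * Q + √Q * (K₁ * 0 + c₀⁻¹ * (K₁ * √Q)) = 2 * K₁ * c₀⁻¹ * Q := by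
        calc _ = K₁ * c₀⁻¹ * Q + K₁ * c₀⁻¹ * (√Q * √Q) := by ring
          _ = _ := by rw [hsQ]; ring
      rw [this]
      nlinarith [mul_nonneg hKc₀ hQ0]
  · have h := (hK₀.comp hK₀0 hmem hpsL).mul hq
    refine h.mono ?_ ?_
    · nlinarith [mul_nonneg hKc₁ hQ0, mul_nonneg hKc₀ hQ0,
        mul_le_mul_of_nonneg_left hx.one_le hKc₀]
    · nlinarith [mul_nonneg hKc₁ hQ0, mul_nonneg hKc₀ hQ0,
        mul_le_mul_of_nonneg_left hsQ' hKc₀]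

/-- On a ball of radius at most `1/(C Q)` the propensity moves by at most `r Q` and the argument of
`f` by at most a multiple of `r Q`. Both therefore stay in fixed compact intervals slightly larger
than their ranges at the centre, where `f` is bounded and Lipschitz. -/
theorem exists_localControl (hG : M.EntropyCond) {c₀ a b a' b' ε : ℝ} (hc₀ : 0 < c₀) (hε : 0 < ε)
    (ha' : 0 < a') (ha : a' < a) (hab : a ≤ b) (hb : b < b') (hV : Set.Icc a' b' ⊆ M.V) :
    ∃ C : ℝ, 0 < C ∧ ∀ (φ₀ : EuclideanSpace ℝ (Fin d)) (Q : ℝ) (x : 𝓧),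
      M.EnvelopeAt φ₀ c₀ a b ε Q x → ∀ r, 0 < r → r * (C * Q) ≤ 1 →
        M.LocalControl φ₀ C Q r x := by
  have ha0 : 0 < a := ha'.trans ha
  have hb0 : 0 < b := ha0.trans_le hab
  have hb'0 : 0 < b' := hb0.trans hb
  have hab' : a' ≤ b' := (ha.trans_le (hab.trans hb.le)).le
  have hmemV : ∀ w, a ≤ w → w ≤ b → w ∈ M.V := fun w h1 h2 =>
    hV ⟨ha.le.trans h1, h2.trans hb.le⟩
  obtain ⟨C₁, hC₁, hz⟩ := exists_bddLipschitzOn_z (M := M) hG hc₀ hb'0 hV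
  obtain ⟨Kf, hKf⟩ := hG.exists_lipschitzOnWith_f hab' hV
  set η₁ := min (b⁻¹ - b'⁻¹) (a'⁻¹ - a⁻¹) with hη₁
  have hη₁pos : 0 < η₁ := lt_min (sub_pos.2 (inv_strictAnti₀ hb0 hb))
    (sub_pos.2 (inv_strictAnti₀ ha' ha))
  set η₂ := min (M.g a - M.g a') (M.g b' - M.g b) with hη₂
  have hη₂pos : 0 < η₂ := lt_min
    (sub_pos.2 (hG.strictMonoOn_g (hV ⟨le_rfl, hab'⟩) (hmemV a le_rfl hab) ha))
    (sub_pos.2 (hG.strictMonoOn_g (hmemV b hab le_rfl) (hV ⟨hab', le_rfl⟩) hb))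
  set n : ℝ := ((Fintype.card (ZIdx p d) : ℕ) : ℝ) with hn
  have hn0 : 0 ≤ n := Nat.cast_nonneg _
  have hc₀' : 0 < c₀⁻¹ := inv_pos.2 hc₀
  -- A product `θ.1 k * z k`, with `|θ.1 k| ≤ 2`, has Lipschitz constant `2 C₁ Q + C₁ Q`; there are
  -- `n` of them, and `q ≤ c₀⁻¹`.
  set C₃ : ℝ := n * (3 * C₁) * c₀⁻¹ with hC₃
  have hC₃0 : 0 ≤ C₃ := by positivity
  have hKf0 : (0 : ℝ) ≤ Kf := Kf.coe_nonneg
  -- Each summand secures one estimate, in this order: `r ≤ 1`, `r ≤ ε`, the range of the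
  -- propensity, the constants of `z`, the range of the argument of `f`, the Lipschitz constant of
  -- the weight, the bound of the weight.
  set C : ℝ := 1 + ε⁻¹ + η₁⁻¹ + C₁ + C₃ * η₂⁻¹ + Kf * C₃ + b' with hC
  have t1 : 0 < ε⁻¹ := inv_pos.2 hε
  have t2 : 0 < η₁⁻¹ := inv_pos.2 hη₁pos
  have t3 : 0 ≤ C₃ * η₂⁻¹ := by positivity
  have t4 : 0 ≤ Kf * C₃ := by positivity
  refine ⟨C, by positivity, ?_⟩
  intro φ₀ Q x hx r hr hrC
  have hQ1 := hx.one_le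
  have hQ0 : 0 ≤ Q := zero_le_one.trans hQ1
  have hle : ∀ t, 0 ≤ t → t ≤ C → r * Q * t ≤ 1 := by
    intro t _ htC
    refine le_trans ?_ hrC
    nlinarith [mul_nonneg hr.le hQ0]
  have hle' : ∀ t, 0 ≤ t → t ≤ C → r * t ≤ 1 := by
    intro t ht htC
    refine le_trans ?_ (hle t ht htC)
    nlinarith [mul_nonneg hr.le ht]
  have hr1 : r ≤ 1 := by simpa using hle' 1 zero_le_one (by linarith)
  have hrε : r ≤ ε := by
    have := hle' ε⁻¹ t1.le (by linarith)
    rwa [← div_eq_mul_inv, div_le_one hε] at this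
  have hrη₁ : r * Q ≤ η₁ := by
    have := hle η₁⁻¹ t2.le (by linarith)
    rwa [← div_eq_mul_inv, div_le_one hη₁pos] at this
  have hrη₂ : r * Q * C₃ ≤ η₂ := by
    have := hle (C₃ * η₂⁻¹) t3 (by linarith)
    rwa [← mul_assoc, ← div_eq_mul_inv, div_le_one hη₂pos] at this
  have hqpos : 0 < M.q x := hc₀.trans_le hx.q_ge
  have hps0pos : 0 < M.ps x φ₀ := inv_pos.1 (ha0.trans_le hx.ps_mem.1)
  have hps : ∀ φ ∈ Metric.ball φ₀ r, M.ps x φ ∈ Set.Icc b'⁻¹ a'⁻¹ := by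
    intro φ hφ
    have hd : |M.ps x φ - M.ps x φ₀| ≤ η₁ := by
      refine le_trans ?_ hrη₁
      rw [← Real.norm_eq_abs]
      have := (convex_ball φ₀ r).norm_image_sub_le_of_norm_fderiv_le (𝕜 := ℝ) (C := Q)
        (fun ψ _ => hx.contDiff_ps.differentiable (by norm_num) ψ) (fun ψ hψ => ?_)
        (Metric.mem_ball_self hr) hφ
      · refine this.trans ?_
        rw [mul_comm]
        rw [Metric.mem_ball, dist_eq_norm] at hφ
        exact mul_le_mul_of_nonneg_right hφ.le hQ0
      · rw [norm_fderiv_ps]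
        have := hx.ps'_le ψ (Metric.ball_subset_ball hrε hψ)
        nlinarith [norm_nonneg (M.ps' x ψ)]
    have h1 : b⁻¹ ≤ M.ps x φ₀ := by
      have := inv_anti₀ (ha0.trans_le hx.ps_mem.1) hx.ps_mem.2; rwa [inv_inv] at this
    have h2 : M.ps x φ₀ ≤ a⁻¹ := by
      have := inv_anti₀ ha0 hx.ps_mem.1; rwa [inv_inv] at this
    have h3 := abs_le.1 hd
    have h4 : η₁ ≤ b⁻¹ - b'⁻¹ := min_le_left _ _
    have h5 : η₁ ≤ a'⁻¹ - a⁻¹ := min_le_right _ _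
    constructor <;> linarith [h3.1, h3.2]
  have hps_inv : ∀ φ ∈ Metric.ball φ₀ r, (M.ps x φ)⁻¹ ∈ Set.Icc a' b' := by
    intro φ hφ
    have h := hps φ hφ
    have hb'i : 0 < b'⁻¹ := inv_pos.2 hb'0
    constructor
    · have := inv_anti₀ (hb'i.trans_le h.1) h.2; rwa [inv_inv] at this
    · have := inv_anti₀ hb'i h.1; rwa [inv_inv] at this
  set U := Metric.ball (debiasVec p d, φ₀) r with hU
  have hU1 : ∀ θ ∈ U, dist θ.1 (debiasVec p d) < r := fun θ hθ => by
    rw [hU, Metric.mem_ball, Prod.dist_eq] at hθ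
    exact (le_max_left _ _).trans_lt hθ
  have hU2 : ∀ θ ∈ U, θ.2 ∈ Metric.ball φ₀ r := fun θ hθ => by
    rw [hU, Metric.mem_ball, Prod.dist_eq] at hθ
    exact (le_max_right _ _).trans_lt hθ
  have hθ₀ : (debiasVec p d, φ₀) ∈ U := Metric.mem_ball_self hr
  have hzU : ∀ k, BddLipschitzOn (fun θ : (ZIdx p d → ℝ) × EuclideanSpace ℝ (Fin d) =>
      M.z θ.2 x k) U (C₁ * Q) (C₁ * Q) := fun k =>
    BddLipschitzOn.comp_snd (a := (debiasVec p d, φ₀)) (hz φ₀ a b ε Q x hx r hrε hps k)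
      (by positivity)
  have hcoord : ∀ k, BddLipschitzOn (fun θ : (ZIdx p d → ℝ) × EuclideanSpace ℝ (Fin d) =>
      θ.1 k) U 2 1 := by
    intro k
    refine ⟨fun θ hθ => ?_, fun θ _ θ' _ => ?_⟩
    · have h1 : |θ.1 k - debiasVec p d k| ≤ r := by
        rw [← Real.dist_eq]
        exact (dist_le_pi_dist _ _ k).trans (hU1 θ hθ).le
      have h2 : |debiasVec p d k| ≤ 1 := by
        unfold debiasVec
        rw [Pi.single_apply]
        split_ifs <;> simp
      have h3 := abs_sub_abs_le_abs_sub (θ.1 k) (debiasVec p d k)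
      linarith
    · rw [one_mul, ← Real.dist_eq]
      exact (dist_le_pi_dist _ _ k).trans (le_max_left _ _)
  have ht : BddLipschitzOn (fun θ : (ZIdx p d → ℝ) × EuclideanSpace ℝ (Fin d) =>
      (θ.1 ⬝ᵥ M.z θ.2 x) * M.q x) U (n * (2 * (C₁ * Q)) * c₀⁻¹) (C₃ * Q) := by
    have hq : BddLipschitzOn (fun _ : (ZIdx p d → ℝ) × EuclideanSpace ℝ (Fin d) => M.q x) U
        c₀⁻¹ 0 := .const (by rw [abs_of_pos hqpos]; exact hx.q_le)
    have h := (BddLipschitzOn.sum Finset.univ fun k _ => (hcoord k).mul (hzU k)).mul hq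
    refine h.mono (le_of_eq ?_) (le_of_eq ?_)
    · simp only [Finset.sum_const, Finset.card_univ, nsmul_eq_mul]
      rw [hn]
    · simp only [Finset.sum_const, Finset.card_univ, nsmul_eq_mul]
      rw [hC₃, hn]; ring
  have htmem : ∀ θ ∈ U, (θ.1 ⬝ᵥ M.z θ.2 x) * M.q x ∈ Set.Icc (M.g a') (M.g b') := by
    intro θ hθ
    have h1 := ht.abs_sub_le θ hθ _ hθ₀
    rw [debiasVec_dotProduct_mul hqpos.ne'] at h1
    have h2 : C₃ * Q * dist θ (debiasVec p d, φ₀) ≤ η₂ := by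
      refine le_trans ?_ hrη₂
      have := mul_le_mul_of_nonneg_left (Metric.mem_ball.1 hθ).le (mul_nonneg hC₃0 hQ0)
      linarith
    have h3 := abs_le.1 (h1.trans h2)
    have h4 : η₂ ≤ M.g a - M.g a' := min_le_left _ _
    have h5 : η₂ ≤ M.g b' - M.g b := min_le_right _ _
    have hm := hmemV _ hx.ps_mem.1 hx.ps_mem.2
    have h6 := hG.strictMonoOn_g.monotoneOn (hmemV a le_rfl hab) hm hx.ps_mem.1
    have h7 := hG.strictMonoOn_g.monotoneOn hm (hmemV b hab le_rfl) hx.ps_mem.2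
    constructor <;> linarith [h3.1, h3.2]
  have hfB : BddLipschitzOn M.f (Set.Icc (M.g a') (M.g b')) b' Kf := by
    refine ⟨fun t ht => ?_, fun t ht s hs => ?_⟩
    · obtain ⟨w, hw, rfl⟩ := hG.image_Icc_g hab' hV ht
      rw [hG.f_g (hV hw), abs_of_pos (ha'.trans_le hw.1)]
      exact hw.2
    · rw [← Real.dist_eq]; exact hKf.dist_le_mul t ht s hs
  refine ⟨fun θ hθ => hV (hps_inv _ (hU2 θ hθ)), fun θ hθ => ?_, fun k => ?_, ?_⟩
  · obtain ⟨w, hw, hwt⟩ := hG.image_Icc_g hab' hV (htmem θ hθ)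
    exact ⟨w, hV hw, hwt⟩
  · exact (hzU k).mono (mul_le_mul_of_nonneg_right (by linarith) hQ0)
      (mul_le_mul_of_nonneg_right (by linarith) hQ0)
  · refine (hfB.comp hKf0 htmem ht.abs_sub_le).mono (by linarith) ?_
    rw [← mul_assoc]
    exact mul_le_mul_of_nonneg_right (by linarith) hQ0

end GECSpec

/-! ### The score and its derivative -/

namespace GECSpec

variable {𝓧 : Type*} {p d : ℕ} {M : GECSpec 𝓧 p d}

theorem omega_debiasVec (hG : M.EntropyCond) {φ : EuclideanSpace ℝ (Fin d)} {x : 𝓧}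
    (hps : (M.ps x φ)⁻¹ ∈ M.V) (hq : M.q x ≠ 0) :
    M.omega (debiasVec p d) φ x = (M.ps x φ)⁻¹ := by
  unfold omega
  rw [debiasVec_dotProduct_mul hq, hG.f_g hps]

/-- The contribution of a unit to the calibration equations, and to the regression form of the
estimator with coefficient `γ`. -/
def score (M : GECSpec 𝓧 p d) (γ : ZIdx p d → ℝ) (o : Obs 𝓧)
    (θ : (ZIdx p d → ℝ) × EuclideanSpace ℝ (Fin d)) : (ZIdx p d → ℝ) × ℝ :=
  (fun k => (o.δ * M.omega θ.1 θ.2 o.x - 1) * M.z θ.2 o.x k,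
    o.δ * M.omega θ.1 θ.2 o.x * o.y -
      ∑ k, γ k * ((o.δ * M.omega θ.1 θ.2 o.x - 1) * M.z θ.2 o.x k))

theorem measurable_omega [MeasurableSpace 𝓧] (hmeas : M.MeasurabilityCond) (hG : M.EntropyCond)
    (hps : ∀ x, ContDiff ℝ 2 (M.ps x)) (l : ZIdx p d → ℝ) (φ : EuclideanSpace ℝ (Fin d)) :
    Measurable fun x => M.omega l φ x := by
  have hz := measurable_z hmeas hps φ
  have hf := hG.measurable_f
  have hq := hmeas.q
  unfold omega dotProduct
  fun_prop

theorem measurable_score [MeasurableSpace 𝓧] (hmeas : M.MeasurabilityCond) (hG : M.EntropyCond)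
    (hps : ∀ x, ContDiff ℝ 2 (M.ps x)) (γ : ZIdx p d → ℝ)
    (θ : (ZIdx p d → ℝ) × EuclideanSpace ℝ (Fin d)) : Measurable fun o => M.score γ o θ := by
  have hz : ∀ k, Measurable fun o : Obs 𝓧 => M.z θ.2 o.x k := fun k =>
    (measurable_z hmeas hps θ.2 k).comp Obs.measurable_x
  have hω : Measurable fun o : Obs 𝓧 => M.omega θ.1 θ.2 o.x :=
    (measurable_omega hmeas hG hps θ.1 θ.2).comp Obs.measurable_x
  have hδ := Obs.measurable_δ (𝓧 := 𝓧)
  have hy := Obs.measurable_y (𝓧 := 𝓧)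
  unfold score
  fun_prop

/-- The weight is bounded by `C` uniformly in `Q`, and only Lipschitz with constant `C Q`, so the
constant is quadratic in `Q` and linear in `Q |y|`. It is integrable as soon as `Q` and `y` are
square integrable. -/
theorem LocalControl.lipschitzOnWith_score {φ₀ : EuclideanSpace ℝ (Fin d)} {C Q r : ℝ}
    {o : Obs 𝓧} (h : M.LocalControl φ₀ C Q r o.x) (hC : 0 < C) (hQ : 1 ≤ Q) (γ : ZIdx p d → ℝ) :
    LipschitzOnWith
      ((1 + ∑ k, |γ k|) * ((2 * C ^ 2 + C) * Q ^ 2) + C * (Q * |o.y|)).toNNReal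
      (M.score γ o) (Metric.ball (debiasVec p d, φ₀) r) := by
  have hQ0 : 0 ≤ Q := zero_le_one.trans hQ
  set U := Metric.ball (debiasVec p d, φ₀) r
  set K := (2 * C ^ 2 + C) * Q ^ 2 with hK
  have hK0 : 0 ≤ K := by positivity
  have hδ : BddLipschitzOn (fun _ : (ZIdx p d → ℝ) × EuclideanSpace ℝ (Fin d) => o.δ) U 1 0 :=
    .const o.abs_δ_le_one
  have hm1 : BddLipschitzOn (fun _ : (ZIdx p d → ℝ) × EuclideanSpace ℝ (Fin d) => (-1 : ℝ)) U 1 0 :=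
    .const (by simp)
  have hs : ∀ k, BddLipschitzOn (fun θ => (o.δ * M.omega θ.1 θ.2 o.x - 1) * M.z θ.2 o.x k) U
      ((1 * C + 1) * (C * Q)) K := fun k => by
    have := ((hδ.mul h.omega).add hm1).mul (h.z k)
    refine this.mono le_rfl ?_
    have h1 : C * Q ≤ C * Q ^ 2 :=
      mul_le_mul_of_nonneg_left (by nlinarith) hC.le
    have h2 := mul_le_mul_of_nonneg_left h1 hC.le
    rw [hK]
    linarith
  have hy : BddLipschitzOn (fun _ : (ZIdx p d → ℝ) × EuclideanSpace ℝ (Fin d) => o.y) U |o.y| 0 :=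
    .const le_rfl
  have h2 := ((hδ.mul h.omega).mul hy).add ((BddLipschitzOn.sum Finset.univ fun k _ =>
      (BddLipschitzOn.const (v := γ k) le_rfl).mul (hs k)).mul hm1)
  have hL : 0 ≤ (1 + ∑ k, |γ k|) * K + C * (Q * |o.y|) := by positivity
  have hγ : 0 ≤ ∑ k, |γ k| := Finset.sum_nonneg fun k _ => abs_nonneg _
  have hCQ : 0 ≤ C * (Q * |o.y|) := by positivity
  refine LipschitzOnWith.of_dist_le_mul fun θ hθ θ' hθ' => ?_
  rw [Real.coe_toNNReal _ hL, Prod.dist_eq]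
  refine max_le ((dist_pi_le_iff (by positivity)).2 fun k => ?_) ?_
  · rw [Real.dist_eq]
    refine ((hs k).abs_sub_le θ hθ θ' hθ').trans (mul_le_mul_of_nonneg_right ?_ dist_nonneg)
    linarith [mul_nonneg hγ hK0]
  · have h3 := h2.abs_sub_le θ hθ θ' hθ'
    have e : ∀ θ : (ZIdx p d → ℝ) × EuclideanSpace ℝ (Fin d), (M.score γ o θ).2 =
        o.δ * M.omega θ.1 θ.2 o.x * o.y +
        (∑ k, γ k * ((o.δ * M.omega θ.1 θ.2 o.x - 1) * M.z θ.2 o.x k)) * -1 := fun θ => by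
      simp only [score]; ring
    rw [Real.dist_eq, e, e]
    refine h3.trans (mul_le_mul_of_nonneg_right ?_ dist_nonneg)
    simp only [mul_zero, add_zero, zero_add, one_mul, ← Finset.sum_mul]
    linarith

/-- The derivative in `φ` of the calibration covariates. -/
def zDeriv (M : GECSpec 𝓧 p d) (φ : EuclideanSpace ℝ (Fin d)) (x : 𝓧) :
    ZIdx p d → EuclideanSpace ℝ (Fin d) →L[ℝ] ℝ :=
  Sum.elim (fun _ => 0) (Sum.elim
    (fun j => (M.q x)⁻¹ • (M.gradCoef (M.ps x φ) • (EuclideanSpace.proj j ∘L fderiv ℝ (M.ps' x) φ) +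
      M.ps' x φ j • (deriv M.gradCoef (M.ps x φ) • fderiv ℝ (M.ps x) φ)))
    (fun _ => (M.q x)⁻¹ • (M.gradCoef (M.ps x φ) • fderiv ℝ (M.ps x) φ)))

theorem hasStrictFDerivAt_z (hG : M.EntropyCond) {φ : EuclideanSpace ℝ (Fin d)} {x : 𝓧}
    (hps : ContDiff ℝ 2 (M.ps x)) (hV : (M.ps x φ)⁻¹ ∈ M.V) (k : ZIdx p d) :
    HasStrictFDerivAt (fun φ => M.z φ x k) (M.zDeriv φ x k) φ := by
  have h1 : HasStrictFDerivAt (M.ps x) (fderiv ℝ (M.ps x) φ) φ :=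
    hps.contDiffAt.hasStrictFDerivAt (by norm_num)
  have h2 : HasStrictFDerivAt (M.ps' x) (fderiv ℝ (M.ps' x) φ) φ :=
    (contDiff_ps' hps).contDiffAt.hasStrictFDerivAt (by norm_num)
  rcases k with j | j | j
  · exact hasStrictFDerivAt_const _ _
  · have h3 := ((contDiffAt_gradCoef hG hV).hasStrictDerivAt (by norm_num)).comp_hasStrictFDerivAt
      φ h1
    have h4 : HasStrictFDerivAt (fun φ => M.ps' x φ j)
        (EuclideanSpace.proj j ∘L fderiv ℝ (M.ps' x) φ) φ :=
      (EuclideanSpace.proj (𝕜 := ℝ) j).hasStrictFDerivAt.comp φ h2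
    refine ((h3.mul h4).const_mul (M.q x)⁻¹).congr_of_eventuallyEq (Eventually.of_forall fun ψ => ?_)
    simp only [z, gradCoef, Sum.elim_inr, Sum.elim_inl, Function.comp_apply, Pi.mul_apply]
    ring
  · have hne : M.ps x φ ≠ 0 := (inv_pos.1 (hG.pos hV)).ne'
    have h3 : HasStrictDerivAt (fun t => M.g t⁻¹) (M.gradCoef (M.ps x φ)) (M.ps x φ) := by
      have := HasStrictDerivAt.comp (M.ps x φ) (hG.hasStrictDerivAt_g hV) (hasStrictDerivAt_inv hne)
      convert! this using 1
      simp [gradCoef]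
    have h4 := h3.comp_hasStrictFDerivAt φ h1
    refine (h4.const_mul (M.q x)⁻¹).congr_of_eventuallyEq (Eventually.of_forall fun ψ => ?_)
    simp only [z, Sum.elim_inr, Function.comp_apply]
    ring

/-- The embedding of the propensity parameters as multipliers of the orthogonal calibration
covariates. -/
def gradVec (p : ℕ) {d : ℕ} (v : EuclideanSpace ℝ (Fin d)) : ZIdx p d → ℝ :=
  Sum.elim 0 (Sum.elim (fun j => v j) 0)

/-- The reason for the orthogonality covariates: by the chain rule, the `φ`-gradient of `g(1/π) q⁻¹`
is `-g'(1/π) π⁻² q⁻¹ π'`, which is the middle block of `z`. -/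
theorem zDeriv_debias_apply {φ : EuclideanSpace ℝ (Fin d)} {x : 𝓧}
    (hps : ContDiff ℝ 2 (M.ps x)) (v : EuclideanSpace ℝ (Fin d)) :
    M.zDeriv φ x (Sum.inr (Sum.inr ())) v = M.z φ x ⬝ᵥ gradVec p v := by
  simp only [zDeriv, Sum.elim_inr, smul_apply, fderiv_ps_apply hps, dotProduct,
    Fintype.sum_sum_type, gradVec, z, Sum.elim_inl, Pi.zero_apply, mul_zero, Finset.sum_const_zero,
    add_zero, zero_add, smul_eq_mul, Finset.mul_sum, gradCoef]
  exact Finset.sum_congr rfl fun j _ => by ring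

/-- The derivative of the weight `ω(λ, φ)` at a point `(λ, φ)` where it equals `1 / π(x, φ)`. -/
def omegaDeriv (M : GECSpec 𝓧 p d) (φ : EuclideanSpace ℝ (Fin d)) (x : 𝓧) :
    (ZIdx p d → ℝ) × EuclideanSpace ℝ (Fin d) →L[ℝ] ℝ :=
  (M.g' (M.ps x φ)⁻¹)⁻¹ • M.q x • ∑ k, (debiasVec p d k •
    (M.zDeriv φ x k ∘L ContinuousLinearMap.snd ℝ _ _) +
    M.z φ x k • (ContinuousLinearMap.proj k ∘L ContinuousLinearMap.fst ℝ _ _))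

/-- Moving `φ` by `v.2` has the same first-order effect on the weight as moving `λ` by `gradVec p
v.2`, so the derivative in every direction is a weighted linear combination of the covariates. -/
theorem omegaDeriv_apply {φ : EuclideanSpace ℝ (Fin d)} {x : 𝓧} (hps : ContDiff ℝ 2 (M.ps x))
    (v : (ZIdx p d → ℝ) × EuclideanSpace ℝ (Fin d)) :
    M.omegaDeriv φ x v = (M.g' (M.ps x φ)⁻¹ * (M.q x)⁻¹)⁻¹ *
      (M.z φ x ⬝ᵥ (v.1 + gradVec p v.2)) := by
  have h1 : ∑ k, debiasVec p d k * M.zDeriv φ x k v.2 = M.z φ x ⬝ᵥ gradVec p v.2 := by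
    rw [← zDeriv_debias_apply hps]
    simp [debiasVec, Pi.single_apply]
  simp only [omegaDeriv, smul_apply, sum_apply,
    add_apply, ContinuousLinearMap.comp_apply, ContinuousLinearMap.coe_snd',
    ContinuousLinearMap.coe_fst', ContinuousLinearMap.proj_apply, smul_eq_mul,
    Finset.sum_add_distrib, h1, dotProduct_add]
  simp only [dotProduct, mul_inv, inv_inv]
  ring

theorem hasStrictFDerivAt_omega (hG : M.EntropyCond) {φ : EuclideanSpace ℝ (Fin d)} {x : 𝓧}
    (hps : ContDiff ℝ 2 (M.ps x)) (hV : (M.ps x φ)⁻¹ ∈ M.V) (hq : M.q x ≠ 0) :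
    HasStrictFDerivAt (fun θ : (ZIdx p d → ℝ) × EuclideanSpace ℝ (Fin d) => M.omega θ.1 θ.2 x)
      (M.omegaDeriv φ x) (debiasVec p d, φ) := by
  set a : (ZIdx p d → ℝ) × EuclideanSpace ℝ (Fin d) := (debiasVec p d, φ)
  have h1 : ∀ k, HasStrictFDerivAt
      (fun θ : (ZIdx p d → ℝ) × EuclideanSpace ℝ (Fin d) => M.z θ.2 x k)
      (M.zDeriv φ x k ∘L ContinuousLinearMap.snd ℝ _ _) a := fun k =>
    (show HasStrictFDerivAt (fun φ => M.z φ x k) (M.zDeriv φ x k) a.2 from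
      hasStrictFDerivAt_z hG hps hV k).comp a hasStrictFDerivAt_snd
  have h2 : ∀ k, HasStrictFDerivAt
      (fun θ : (ZIdx p d → ℝ) × EuclideanSpace ℝ (Fin d) => θ.1 k)
      (ContinuousLinearMap.proj (R := ℝ) (φ := fun _ : ZIdx p d => ℝ) k ∘L
        ContinuousLinearMap.fst ℝ _ _) a := fun k =>
    (ContinuousLinearMap.proj (R := ℝ) (φ := fun _ : ZIdx p d => ℝ) k ∘L
        ContinuousLinearMap.fst ℝ _ (EuclideanSpace ℝ (Fin d))).hasStrictFDerivAt
  have h3 := (HasStrictFDerivAt.fun_sum (u := Finset.univ) fun k _ => (h2 k).mul (h1 k)).mul_const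
    (M.q x)
  have hf : HasStrictDerivAt M.f (M.g' (M.ps x φ)⁻¹)⁻¹
      ((∑ k, a.1 k * M.z a.2 x k) * M.q x) := by
    have e : (∑ k, a.1 k * M.z a.2 x k) * M.q x = M.g (M.ps x φ)⁻¹ :=
      debiasVec_dotProduct_mul hq φ
    rw [e]
    exact hG.hasStrictDerivAt_f hV
  exact hf.comp_hasStrictFDerivAt a h3

/-- The derivative of `score` at `(λ, φ)` with weight `1 / π(x, φ)`. -/
def scoreDeriv (M : GECSpec 𝓧 p d) (γ : ZIdx p d → ℝ) (φ : EuclideanSpace ℝ (Fin d)) (o : Obs 𝓧) :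
    (ZIdx p d → ℝ) × EuclideanSpace ℝ (Fin d) →L[ℝ] (ZIdx p d → ℝ) × ℝ :=
  let s : ZIdx p d → (ZIdx p d → ℝ) × EuclideanSpace ℝ (Fin d) →L[ℝ] ℝ := fun k =>
    (o.δ * (M.ps o.x φ)⁻¹ - 1) • (M.zDeriv φ o.x k ∘L ContinuousLinearMap.snd ℝ _ _) +
      M.z φ o.x k • (o.δ • M.omegaDeriv φ o.x)
  (ContinuousLinearMap.pi s).prod (o.y • (o.δ • M.omegaDeriv φ o.x) - ∑ k, γ k • s k)

theorem hasStrictFDerivAt_score (hG : M.EntropyCond) (γ : ZIdx p d → ℝ)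
    {φ : EuclideanSpace ℝ (Fin d)} {o : Obs 𝓧} (hps : ContDiff ℝ 2 (M.ps o.x))
    (hV : (M.ps o.x φ)⁻¹ ∈ M.V) (hq : M.q o.x ≠ 0) :
    HasStrictFDerivAt (M.score γ o) (M.scoreDeriv γ φ o) (debiasVec p d, φ) := by
  set a : (ZIdx p d → ℝ) × EuclideanSpace ℝ (Fin d) := (debiasVec p d, φ) with ha
  have h1 : ∀ k, HasStrictFDerivAt
      (fun θ : (ZIdx p d → ℝ) × EuclideanSpace ℝ (Fin d) => M.z θ.2 o.x k)
      (M.zDeriv φ o.x k ∘L ContinuousLinearMap.snd ℝ _ _) a := fun k =>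
    (show HasStrictFDerivAt (fun φ => M.z φ o.x k) (M.zDeriv φ o.x k) a.2 from
      hasStrictFDerivAt_z hG hps hV k).comp a hasStrictFDerivAt_snd
  have hω := (hasStrictFDerivAt_omega hG hps hV hq).const_mul o.δ
  have hs : ∀ k, HasStrictFDerivAt
      (fun θ : (ZIdx p d → ℝ) × EuclideanSpace ℝ (Fin d) =>
        (o.δ * M.omega θ.1 θ.2 o.x - 1) * M.z θ.2 o.x k)
      ((o.δ * (M.ps o.x φ)⁻¹ - 1) • (M.zDeriv φ o.x k ∘L ContinuousLinearMap.snd ℝ _ _) +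
        M.z φ o.x k • (o.δ • M.omegaDeriv φ o.x)) a := fun k => by
    have := (hω.sub_const 1).mul (h1 k)
    rw [omega_debiasVec hG hV hq] at this
    exact this
  exact (hasStrictFDerivAt_pi.2 hs).prodMk ((hω.mul_const o.y).sub
    (HasStrictFDerivAt.fun_sum (u := Finset.univ) fun k _ => (hs k).const_mul (γ k)))

end GECSpec

/-! ### Moments and unbiasedness under a correct model -/

namespace GECSpec

variable {𝓧 : Type*} {p d : ℕ} [MeasurableSpace 𝓧]

/-- A correctly specified model with an envelope `Q` that controls the weights and the calibration
covariates near `φ₀`. -/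
structure RegularModel (M : GECSpec 𝓧 p d) (P : Measure (Obs 𝓧)) (π₀ : 𝓧 → ℝ)
    (φ₀ : EuclideanSpace ℝ (Fin d)) (c₀ C : ℝ) (Q : 𝓧 → ℝ) : Prop where
  entropy : M.EntropyCond
  meas : M.MeasurabilityCond
  contDiff : ∀ x, ContDiff ℝ 2 (M.ps x)
  memLp_y : MemLp Obs.y 2 P
  measurable_π₀ : Measurable π₀
  integral_δ_mul : ∀ h : 𝓧 × ℝ → ℝ, Measurable h →
    ∫ o, o.δ * h (o.x, o.y) ∂P = ∫ o, π₀ o.x * h (o.x, o.y) ∂P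
  c₀_pos : 0 < c₀
  C_pos : 0 < C
  measurable_Q : Measurable Q
  memLp_Q : MemLp (fun o => Q o.x) 2 P
  ae_one_le_Q : ∀ᵐ o ∂P, 1 ≤ Q o.x
  ae_π₀_eq : ∀ᵐ o ∂P, π₀ o.x = M.ps o.x φ₀
  ae_overlap : ∀ᵐ o ∂P, c₀ ≤ M.ps o.x φ₀ ∧ M.ps o.x φ₀ ≤ 1
  ae_q_pos : ∀ᵐ o ∂P, 0 < M.q o.x
  ae_mem : ∀ᵐ o ∂P, (M.ps o.x φ₀)⁻¹ ∈ M.V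
  ae_local : ∀ᵐ o ∂P, ∀ r, 0 < r → r * (C * Q o.x) ≤ 1 → M.LocalControl φ₀ C (Q o.x) r o.x

/-- The weight `{g'(1/π) q⁻¹}⁻¹` of the regression that defines `γ*`. -/
def regWeight (M : GECSpec 𝓧 p d) (φ : EuclideanSpace ℝ (Fin d)) (x : 𝓧) : ℝ :=
  (M.g' (M.ps x φ)⁻¹ * (M.q x)⁻¹)⁻¹

namespace RegularModel

variable {M : GECSpec 𝓧 p d} {P : Measure (Obs 𝓧)} {π₀ : 𝓧 → ℝ}
  {φ₀ : EuclideanSpace ℝ (Fin d)} {c₀ C : ℝ} {Q : 𝓧 → ℝ}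

theorem ae_exists_localControl (H : M.RegularModel P π₀ φ₀ c₀ C Q) :
    ∀ᵐ o ∂P, ∃ r, 0 < r ∧ M.LocalControl φ₀ C (Q o.x) r o.x := by
  filter_upwards [H.ae_local, H.ae_one_le_Q] with o h1 h2
  have h3 : 0 < C * Q o.x := mul_pos H.C_pos (zero_lt_one.trans_le h2)
  exact ⟨(C * Q o.x)⁻¹, inv_pos.2 h3, h1 _ (inv_pos.2 h3) (inv_mul_cancel₀ h3.ne').le⟩

theorem measurable_z (H : M.RegularModel P π₀ φ₀ c₀ C Q) (k : ZIdx p d) :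
    Measurable fun x => M.z φ₀ x k :=
  GECSpec.measurable_z H.meas H.contDiff φ₀ k

theorem measurable_regWeight (H : M.RegularModel P π₀ φ₀ c₀ C Q) :
    Measurable fun x => M.regWeight φ₀ x := by
  have hg' : Measurable M.g' := measurable_deriv _
  have h1 := H.meas.ps φ₀
  have h2 := H.meas.q
  unfold regWeight
  fun_prop

theorem ae_abs_z_le (H : M.RegularModel P π₀ φ₀ c₀ C Q) (k : ZIdx p d) :
    ∀ᵐ o ∂P, |M.z φ₀ o.x k| ≤ C * Q o.x := by
  filter_upwards [H.ae_exists_localControl] with o ⟨r, hr, h⟩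
  exact (h.z k).abs_le _ (Metric.mem_ball_self hr)

/-- `regWeight * z k` is the derivative of the weight in the `k`-th direction of `λ`, hence bounded
by the local Lipschitz constant of the weight. -/
theorem ae_abs_regWeight_mul_z_le (H : M.RegularModel P π₀ φ₀ c₀ C Q) (k : ZIdx p d) :
    ∀ᵐ o ∂P, |M.regWeight φ₀ o.x * M.z φ₀ o.x k| ≤ C * Q o.x := by
  filter_upwards [H.ae_exists_localControl, H.ae_mem, H.ae_q_pos, H.ae_one_le_Q] with
    o ⟨r, hr, h⟩ hV hq hQ
  have hCQ : 0 ≤ C * Q o.x := mul_nonneg H.C_pos.le (zero_le_one.trans hQ)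
  have hD := (hasStrictFDerivAt_omega H.entropy (H.contDiff o.x) hV hq.ne').hasFDerivAt
  have hle := hD.le_of_lipschitzOn (Metric.ball_mem_nhds _ hr) h.omega.lipschitzOnWith
  rw [Real.coe_toNNReal _ hCQ] at hle
  have h1 := (M.omegaDeriv φ₀ o.x).le_of_opNorm_le hle (Pi.single k 1, 0)
  rw [omegaDeriv_apply (H.contDiff o.x)] at h1
  have h2 : gradVec p (0 : EuclideanSpace ℝ (Fin d)) = 0 := by
    ext (j | j | j) <;> simp [gradVec]
  simpa [h2, Prod.norm_def, regWeight, Pi.norm_single] using h1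

theorem ae_abs_zDeriv_le (H : M.RegularModel P π₀ φ₀ c₀ C Q) (k : ZIdx p d)
    (v : EuclideanSpace ℝ (Fin d)) :
    ∀ᵐ o ∂P, |M.zDeriv φ₀ o.x k v| ≤ C * Q o.x * ‖v‖ := by
  filter_upwards [H.ae_exists_localControl, H.ae_mem, H.ae_one_le_Q] with
    o ⟨r, hr, h⟩ hV hQ
  have hCQ : 0 ≤ C * Q o.x := mul_nonneg H.C_pos.le (zero_le_one.trans hQ)
  have hD : HasFDerivAt (fun θ : (ZIdx p d → ℝ) × EuclideanSpace ℝ (Fin d) => M.z θ.2 o.x k)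
      (M.zDeriv φ₀ o.x k ∘L ContinuousLinearMap.snd ℝ _ _) (debiasVec p d, φ₀) :=
    HasFDerivAt.comp (g := fun φ => M.z φ o.x k) _
      (hasStrictFDerivAt_z H.entropy (H.contDiff o.x) hV k).hasFDerivAt hasFDerivAt_snd
  have hle := hD.le_of_lipschitzOn (Metric.ball_mem_nhds _ hr) (h.z k).lipschitzOnWith
  rw [Real.coe_toNNReal _ hCQ] at hle
  simpa [Prod.norm_def] using ContinuousLinearMap.le_of_opNorm_le _ hle (0, v)

theorem memLp_of_ae_abs_le (H : M.RegularModel P π₀ φ₀ c₀ C Q) {h : 𝓧 → ℝ} (hm : Measurable h)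
    {K : ℝ} (hle : ∀ᵐ o ∂P, |h o.x| ≤ K * Q o.x) : MemLp (fun o => h o.x) 2 P :=
  (H.memLp_Q.const_mul K).mono' (hm.comp Obs.measurable_x).aestronglyMeasurable hle

theorem memLp_z (H : M.RegularModel P π₀ φ₀ c₀ C Q) (k : ZIdx p d) :
    MemLp (fun o : Obs 𝓧 => M.z φ₀ o.x k) 2 P :=
  H.memLp_of_ae_abs_le (H.measurable_z k) (H.ae_abs_z_le k)

theorem memLp_regWeight_mul_z (H : M.RegularModel P π₀ φ₀ c₀ C Q) (k : ZIdx p d) :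
    MemLp (fun o : Obs 𝓧 => M.regWeight φ₀ o.x * M.z φ₀ o.x k) 2 P :=
  H.memLp_of_ae_abs_le (h := fun x => M.regWeight φ₀ x * M.z φ₀ x k)
    (H.measurable_regWeight.mul (H.measurable_z k)) (H.ae_abs_regWeight_mul_z_le k)

theorem measurable_zDeriv_apply (H : M.RegularModel P π₀ φ₀ c₀ C Q) (k : ZIdx p d)
    (v : EuclideanSpace ℝ (Fin d)) : Measurable fun x => M.zDeriv φ₀ x k v := by
  have h1 := H.meas.ps φ₀
  have h2 := H.meas.q
  have h3 := measurable_ps' H.meas H.contDiff φ₀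
  have h4 := measurable_fderiv_ps' H.meas H.contDiff φ₀ v
  have h5 : Measurable fun x => fderiv ℝ (M.ps x) φ₀ v :=
    measurable_fderiv_apply_of_differentiableAt H.meas.ps
      (fun x => (H.contDiff x).differentiable (by norm_num) φ₀) v
  have hg' : Measurable M.g' := measurable_deriv _
  have h6 : Measurable M.gradCoef := by unfold gradCoef; fun_prop
  have h7 : Measurable (deriv M.gradCoef) := measurable_deriv _
  rcases k with j | j | j
  · exact measurable_const
  · have : (fun x => M.zDeriv φ₀ x (Sum.inr (Sum.inl j)) v) = fun x =>
        (M.q x)⁻¹ * (M.gradCoef (M.ps x φ₀) * fderiv ℝ (M.ps' x) φ₀ v j +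
          M.ps' x φ₀ j * (deriv M.gradCoef (M.ps x φ₀) * fderiv ℝ (M.ps x) φ₀ v)) := rfl
    rw [this]
    fun_prop
  · have : (fun x => M.zDeriv φ₀ x (Sum.inr (Sum.inr j)) v) = fun x =>
        (M.q x)⁻¹ * (M.gradCoef (M.ps x φ₀) * fderiv ℝ (M.ps x) φ₀ v) := rfl
    rw [this]
    fun_prop

theorem memLp_zDeriv_apply (H : M.RegularModel P π₀ φ₀ c₀ C Q) (k : ZIdx p d)
    (v : EuclideanSpace ℝ (Fin d)) : MemLp (fun o : Obs 𝓧 => M.zDeriv φ₀ o.x k v) 2 P := by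
  refine H.memLp_of_ae_abs_le (h := fun x => M.zDeriv φ₀ x k v) (H.measurable_zDeriv_apply k v)
    (K := C * ‖v‖) ?_
  filter_upwards [H.ae_abs_zDeriv_le k v] with o ho
  linarith

theorem measurable_δ_div (H : M.RegularModel P π₀ φ₀ c₀ C Q) :
    Measurable fun o : Obs 𝓧 => o.δ * (M.ps o.x φ₀)⁻¹ :=
  Obs.measurable_δ.mul ((H.meas.ps φ₀).comp Obs.measurable_x).inv

theorem ae_abs_δ_div_le (H : M.RegularModel P π₀ φ₀ c₀ C Q) :
    ∀ᵐ o ∂P, |o.δ * (M.ps o.x φ₀)⁻¹| ≤ c₀⁻¹ := by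
  filter_upwards [H.ae_overlap] with o ho
  rw [abs_mul, abs_of_pos (inv_pos.2 (H.c₀_pos.trans_le ho.1))]
  calc _ ≤ 1 * (M.ps o.x φ₀)⁻¹ := mul_le_mul_of_nonneg_right o.abs_δ_le_one
        (inv_pos.2 (H.c₀_pos.trans_le ho.1)).le
    _ ≤ _ := by rw [one_mul]; exact inv_anti₀ H.c₀_pos ho.1

theorem memLp_δ_div_sub_one_mul (H : M.RegularModel P π₀ φ₀ c₀ C Q) {f : Obs 𝓧 → ℝ} {s : ENNReal}
    (hf : MemLp f s P) : MemLp (fun o => (o.δ * (M.ps o.x φ₀)⁻¹ - 1) * f o) s P := by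
  refine MemLp.of_le_mul (c := c₀⁻¹ + 1) hf
    ((H.measurable_δ_div.sub_const 1).aestronglyMeasurable.mul hf.1) ?_
  filter_upwards [H.ae_abs_δ_div_le] with o ho
  rw [norm_mul]
  refine mul_le_mul_of_nonneg_right ?_ (norm_nonneg _)
  rw [Real.norm_eq_abs]
  have := abs_sub (o.δ * (M.ps o.x φ₀)⁻¹) 1
  rw [abs_one] at this
  linarith

/-- Missingness at random replaces `δ` by `π₀`, which cancels `1/π` because the model is correct. -/
theorem integral_δ_div_sub_one_mul (H : M.RegularModel P π₀ φ₀ c₀ C Q) {h : 𝓧 × ℝ → ℝ}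
    (hm : Measurable h) (hint : Integrable (fun o : Obs 𝓧 => h (o.x, o.y)) P) :
    ∫ o, (o.δ * (M.ps o.x φ₀)⁻¹ - 1) * h (o.x, o.y) ∂P = 0 := by
  have h1 := H.integral_δ_mul (fun z => (M.ps z.1 φ₀)⁻¹ * h z)
    (((H.meas.ps φ₀).comp measurable_fst).inv.mul hm)
  have h2 : ∫ o, π₀ o.x * ((M.ps o.x φ₀)⁻¹ * h (o.x, o.y)) ∂P = ∫ o, h (o.x, o.y) ∂P := by
    refine integral_congr_ae ?_
    filter_upwards [H.ae_π₀_eq, H.ae_overlap] with o h3 h4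
    rw [h3, mul_inv_cancel_left₀ (H.c₀_pos.trans_le h4.1).ne']
  have h3 : Integrable (fun o : Obs 𝓧 => o.δ * (M.ps o.x φ₀)⁻¹ * h (o.x, o.y)) P := by
    have := (memLp_one_iff_integrable.1
      (H.memLp_δ_div_sub_one_mul (memLp_one_iff_integrable.2 hint))).add hint
    refine this.congr (ae_of_all _ fun o => ?_)
    simp only [Pi.add_apply]; ring
  have h4 : (fun o : Obs 𝓧 => (o.δ * (M.ps o.x φ₀)⁻¹ - 1) * h (o.x, o.y)) =
      fun o => o.δ * (M.ps o.x φ₀)⁻¹ * h (o.x, o.y) - h (o.x, o.y) := by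
    ext o; ring
  rw [h4, integral_sub h3 hint, sub_eq_zero, ← h2, ← h1]
  exact integral_congr_ae (ae_of_all _ fun o => mul_assoc _ _ _)

theorem ae_omega_debiasVec (H : M.RegularModel P π₀ φ₀ c₀ C Q) :
    ∀ᵐ o ∂P, M.omega (debiasVec p d) φ₀ o.x = (M.ps o.x φ₀)⁻¹ := by
  filter_upwards [H.ae_mem, H.ae_q_pos] with o h1 h2
  exact omega_debiasVec H.entropy h1 h2.ne'

theorem integrable_z [IsFiniteMeasure P] (H : M.RegularModel P π₀ φ₀ c₀ C Q) (k : ZIdx p d) :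
    Integrable (fun o : Obs 𝓧 => M.z φ₀ o.x k) P :=
  (H.memLp_z k).integrable one_le_two

/-- The weights of this multiplier are `1/π`, and inverse propensity weighting is unbiased for `E
z`. -/
theorem isPopLambda_debiasVec [IsFiniteMeasure P]
    (H : M.RegularModel P π₀ φ₀ c₀ C Q) :
    M.IsPopLambda P φ₀ (debiasVec p d) := by
  have hae : ∀ k, (fun o : Obs 𝓧 => o.δ * M.omega (debiasVec p d) φ₀ o.x * M.z φ₀ o.x k) =ᵐ[P]
      fun o => (o.δ * (M.ps o.x φ₀)⁻¹ - 1) * M.z φ₀ o.x k + M.z φ₀ o.x k := fun k => by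
    filter_upwards [H.ae_omega_debiasVec] with o ho
    rw [ho]; ring
  have hint : ∀ k, Integrable (fun o => (o.δ * (M.ps o.x φ₀)⁻¹ - 1) * M.z φ₀ o.x k) P := fun k =>
    (H.memLp_δ_div_sub_one_mul (H.memLp_z k)).integrable one_le_two
  refine ⟨?_, H.integrable_z, fun k => ?_, fun k => ?_⟩
  · filter_upwards [H.ae_mem, H.ae_q_pos] with o h1 h2
    rw [debiasVec_dotProduct_mul h2.ne']
    exact ⟨_, h1, rfl⟩
  · exact ((hint k).add (H.integrable_z k)).congr (hae k).symm
  · rw [integral_congr_ae (hae k), integral_add (hint k) (H.integrable_z k),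
      H.integral_δ_div_sub_one_mul (h := fun z => M.z φ₀ z.1 k)
        ((H.measurable_z k).comp measurable_fst) (H.integrable_z k), zero_add]

theorem Gam_apply (H : M.RegularModel P π₀ φ₀ c₀ C Q) (j k : ZIdx p d) :
    M.Gam P π₀ (debiasVec p d) φ₀ j k =
      ∫ o, π₀ o.x * (M.regWeight φ₀ o.x * M.z φ₀ o.x j * M.z φ₀ o.x k) ∂P := by
  refine integral_congr_ae ?_
  filter_upwards [H.ae_omega_debiasVec] with o ho
  simp only [ho, regWeight]; ring

theorem integrable_π₀_mul (H : M.RegularModel P π₀ φ₀ c₀ C Q) {f : Obs 𝓧 → ℝ}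
    (hf : Integrable f P) : Integrable (fun o => π₀ o.x * f o) P := by
  refine hf.bdd_mul (c := 1) (H.measurable_π₀.comp Obs.measurable_x).aestronglyMeasurable ?_
  filter_upwards [H.ae_π₀_eq, H.ae_overlap] with o h1 h2
  rw [h1, Real.norm_eq_abs, abs_of_pos (H.c₀_pos.trans_le h2.1)]
  exact h2.2

theorem integrable_regWeight_mul_z_mul_z (H : M.RegularModel P π₀ φ₀ c₀ C Q) (j k : ZIdx p d) :
    Integrable (fun o : Obs 𝓧 => M.regWeight φ₀ o.x * M.z φ₀ o.x j * M.z φ₀ o.x k) P :=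
  (H.memLp_regWeight_mul_z j).integrable_mul (H.memLp_z k)

theorem integrable_regWeight_mul_z_mul_y (H : M.RegularModel P π₀ φ₀ c₀ C Q) (j : ZIdx p d) :
    Integrable (fun o : Obs 𝓧 => M.regWeight φ₀ o.x * M.z φ₀ o.x j * o.y) P :=
  (H.memLp_regWeight_mul_z j).integrable_mul H.memLp_y

/-- These are the normal equations `Γ* γ* = E[π₀ w z Y]` of the regression defining `γ*`, with `w`
the regression weight. -/
theorem integral_regWeight_mul_z_mul_residual (H : M.RegularModel P π₀ φ₀ c₀ C Q)
    (hdet : IsUnit (M.Gam P π₀ (debiasVec p d) φ₀).det) (j : ZIdx p d) :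
    ∫ o, π₀ o.x * (M.regWeight φ₀ o.x * M.z φ₀ o.x j *
      (o.y - M.z φ₀ o.x ⬝ᵥ M.gam P π₀ (debiasVec p d) φ₀)) ∂P = 0 := by
  set γ := M.gam P π₀ (debiasVec p d) φ₀ with hγ
  have h1 : (M.Gam P π₀ (debiasVec p d) φ₀).mulVec γ j =
      ∫ o, π₀ o.x * (M.regWeight φ₀ o.x * M.z φ₀ o.x j * o.y) ∂P := by
    rw [hγ, gam, Matrix.mulVec_mulVec, Matrix.mul_nonsing_inv _ hdet, Matrix.one_mulVec]
    refine integral_congr_ae ?_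
    filter_upwards [H.ae_omega_debiasVec] with o ho
    simp only [ho, regWeight]; ring
  have h2 : (M.Gam P π₀ (debiasVec p d) φ₀).mulVec γ j =
      ∫ o, ∑ k, π₀ o.x * (M.regWeight φ₀ o.x * M.z φ₀ o.x j * M.z φ₀ o.x k) * γ k ∂P := by
    rw [integral_finsetSum _ fun k _ =>
      (H.integrable_π₀_mul (H.integrable_regWeight_mul_z_mul_z j k)).mul_const (γ k)]
    simp only [Matrix.mulVec, dotProduct, H.Gam_apply, integral_mul_const]
  have h3 : ∀ o : Obs 𝓧, π₀ o.x * (M.regWeight φ₀ o.x * M.z φ₀ o.x j * (o.y - M.z φ₀ o.x ⬝ᵥ γ)) =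
      π₀ o.x * (M.regWeight φ₀ o.x * M.z φ₀ o.x j * o.y) -
      ∑ k, π₀ o.x * (M.regWeight φ₀ o.x * M.z φ₀ o.x j * M.z φ₀ o.x k) * γ k := by
    intro o
    rw [mul_sub, mul_sub, dotProduct, Finset.mul_sum, Finset.mul_sum]
    congr 1
    exact Finset.sum_congr rfl fun k _ => by ring
  simp only [h3]
  rw [integral_sub (H.integrable_π₀_mul (H.integrable_regWeight_mul_z_mul_y j))
    (integrable_finsetSum _ fun k _ =>
      (H.integrable_π₀_mul (H.integrable_regWeight_mul_z_mul_z j k)).mul_const (γ k)),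
    ← h1, ← h2, sub_self]

end RegularModel

end GECSpec

/-! ### The expected derivative of the score and the asymptotic expansion -/

namespace GECSpec.RegularModel

variable {𝓧 : Type*} {p d : ℕ} [MeasurableSpace 𝓧] {M : GECSpec 𝓧 p d} {P : Measure (Obs 𝓧)}
  {π₀ : 𝓧 → ℝ} {φ₀ : EuclideanSpace ℝ (Fin d)} {c₀ C : ℝ} {Q : 𝓧 → ℝ}

theorem stronglyMeasurable_score (H : M.RegularModel P π₀ φ₀ c₀ C Q) (γ : ZIdx p d → ℝ)
    (θ : (ZIdx p d → ℝ) × EuclideanSpace ℝ (Fin d)) :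
    StronglyMeasurable fun o => M.score γ o θ :=
  (measurable_score H.meas H.entropy H.contDiff γ θ).stronglyMeasurable

theorem ae_hasStrictFDerivAt_score (H : M.RegularModel P π₀ φ₀ c₀ C Q) (γ : ZIdx p d → ℝ) :
    ∀ᵐ o ∂P, HasStrictFDerivAt (M.score γ o) (M.scoreDeriv γ φ₀ o) (debiasVec p d, φ₀) := by
  filter_upwards [H.ae_mem, H.ae_q_pos] with o h1 h2
  exact hasStrictFDerivAt_score H.entropy γ (H.contDiff o.x) h1 h2.ne'

theorem ae_lipschitzOnWith_score (H : M.RegularModel P π₀ φ₀ c₀ C Q) (γ : ZIdx p d → ℝ) :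
    ∀ᵐ o ∂P, ∀ r, 0 < r → r * (C * Q o.x) ≤ 1 → LipschitzOnWith
      ((1 + ∑ k, |γ k|) * ((2 * C ^ 2 + C) * Q o.x ^ 2) + C * (Q o.x * |o.y|)).toNNReal
      (M.score γ o) (Metric.ball (debiasVec p d, φ₀) r) := by
  filter_upwards [H.ae_local, H.ae_one_le_Q] with o h1 h2 r hr hrQ
  exact (h1 r hr hrQ).lipschitzOnWith_score H.C_pos h2 γ

theorem integrable_envelope (H : M.RegularModel P π₀ φ₀ c₀ C Q) (γ : ZIdx p d → ℝ) :
    Integrable (fun o => (1 + ∑ k, |γ k|) * ((2 * C ^ 2 + C) * Q o.x ^ 2) +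
      C * (Q o.x * |o.y|)) P :=
  ((H.memLp_Q.integrable_sq.const_mul _).const_mul _).add
    ((H.memLp_Q.integrable_mul H.memLp_y.abs).const_mul C)

theorem integrable_scoreDeriv (H : M.RegularModel P π₀ φ₀ c₀ C Q) (γ : ZIdx p d → ℝ) :
    Integrable (M.scoreDeriv γ φ₀) P :=
  integrable_of_lipschitzOnWith_ball (H.stronglyMeasurable_score γ)
    (H.ae_hasStrictFDerivAt_score γ) (H.integrable_envelope γ) (H.ae_lipschitzOnWith_score γ)

/-- With `φ` fixed only the weight varies, with derivative `regWeight * (z·v)`; missingness at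
random turns `δ` into `π₀`. -/
theorem integral_scoreDeriv_fst (H : M.RegularModel P π₀ φ₀ c₀ C Q) (γ v : ZIdx p d → ℝ) :
    ((∫ o, M.scoreDeriv γ φ₀ o ∂P) (v, 0)).1 =
      (M.Gam P π₀ (debiasVec p d) φ₀).mulVec v := by
  ext k
  have h1 : ((∫ o, M.scoreDeriv γ φ₀ o ∂P) (v, 0)).1 k =
      ∫ o, (M.scoreDeriv γ φ₀ o (v, 0)).1 k ∂P := by
    rw [ContinuousLinearMap.integral_apply (H.integrable_scoreDeriv γ)]
    exact ((ContinuousLinearMap.proj (R := ℝ) (φ := fun _ : ZIdx p d => ℝ) k ∘L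
      ContinuousLinearMap.fst ℝ (ZIdx p d → ℝ) ℝ).integral_comp_comm
      ((H.integrable_scoreDeriv γ).apply_continuousLinearMap (v, 0))).symm
  have h2 : gradVec p (0 : EuclideanSpace ℝ (Fin d)) = 0 := by
    ext (j | j | j) <;> simp [gradVec]
  have h3 : ∀ o : Obs 𝓧, (M.scoreDeriv γ φ₀ o (v, 0)).1 k =
      o.δ * ∑ j, M.regWeight φ₀ o.x * M.z φ₀ o.x k * M.z φ₀ o.x j * v j := by
    intro o
    simp only [scoreDeriv, ContinuousLinearMap.prod_apply, ContinuousLinearMap.pi_apply,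
      add_apply, smul_apply, ContinuousLinearMap.comp_apply, ContinuousLinearMap.coe_snd',
      map_zero, omegaDeriv_apply (H.contDiff o.x), h2, add_zero, smul_eq_mul]
    have e : ∑ j, M.regWeight φ₀ o.x * M.z φ₀ o.x k * M.z φ₀ o.x j * v j =
        M.regWeight φ₀ o.x * M.z φ₀ o.x k * (M.z φ₀ o.x ⬝ᵥ v) := by
      rw [dotProduct, Finset.mul_sum]
      exact Finset.sum_congr rfl fun j _ => by ring
    rw [e, regWeight]
    ring
  rw [h1]
  simp only [h3]
  have hm := H.measurable_z
  have hw := H.measurable_regWeight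
  rw [H.integral_δ_mul (fun z => ∑ j, M.regWeight φ₀ z.1 * M.z φ₀ z.1 k * M.z φ₀ z.1 j * v j)
    (by fun_prop)]
  simp only [Finset.mul_sum]
  rw [integral_finsetSum _ fun j _ => H.integrable_π₀_mul
    ((H.integrable_regWeight_mul_z_mul_z k j).mul_const (v j))]
  rw [Matrix.mulVec, dotProduct]
  refine Finset.sum_congr rfl fun j _ => ?_
  rw [H.Gam_apply, ← integral_mul_const]
  exact integral_congr_ae (ae_of_all _ fun o => by ring)

/-- Along `v` the derivative is `δ w (z·u)(Y - z·γ)` with `u = v.1 + gradVec p v.2` and `w` the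
regression weight, minus `(δ/π - 1)` times a function of `x`. The first part has mean zero by the
normal equations, the second by unbiasedness of inverse propensity weighting. -/
theorem integral_scoreDeriv_snd (H : M.RegularModel P π₀ φ₀ c₀ C Q) [IsFiniteMeasure P]
    (hdet : IsUnit (M.Gam P π₀ (debiasVec p d) φ₀).det)
    (v : (ZIdx p d → ℝ) × EuclideanSpace ℝ (Fin d)) :
    ((∫ o, M.scoreDeriv (M.gam P π₀ (debiasVec p d) φ₀) φ₀ o ∂P) v).2 = 0 := by
  set γ := M.gam P π₀ (debiasVec p d) φ₀ with hγ
  have h1 : ((∫ o, M.scoreDeriv γ φ₀ o ∂P) v).2 = ∫ o, (M.scoreDeriv γ φ₀ o v).2 ∂P := by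
    rw [ContinuousLinearMap.integral_apply (H.integrable_scoreDeriv γ)]
    exact ((ContinuousLinearMap.snd ℝ (ZIdx p d → ℝ) ℝ).integral_comp_comm
      ((H.integrable_scoreDeriv γ).apply_continuousLinearMap v)).symm
  set w : ZIdx p d → ℝ := v.1 + gradVec p v.2 with hw
  have h2 : ∀ o : Obs 𝓧, (M.scoreDeriv γ φ₀ o v).2 =
      o.δ * (∑ j, w j * (M.regWeight φ₀ o.x * M.z φ₀ o.x j * (o.y - M.z φ₀ o.x ⬝ᵥ γ))) -
      (o.δ * (M.ps o.x φ₀)⁻¹ - 1) * ∑ k, γ k * M.zDeriv φ₀ o.x k v.2 := by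
    intro o
    simp only [scoreDeriv, ContinuousLinearMap.prod_apply, sub_apply, sum_apply, add_apply,
      smul_apply, ContinuousLinearMap.comp_apply, ContinuousLinearMap.coe_snd',
      omegaDeriv_apply (H.contDiff o.x), smul_eq_mul, ← hw]
    have e1 : ∑ j, w j * (M.regWeight φ₀ o.x * M.z φ₀ o.x j * (o.y - M.z φ₀ o.x ⬝ᵥ γ)) =
        M.regWeight φ₀ o.x * (M.z φ₀ o.x ⬝ᵥ w) * (o.y - M.z φ₀ o.x ⬝ᵥ γ) := by
      simp only [dotProduct, Finset.mul_sum, Finset.sum_mul]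
      exact Finset.sum_congr rfl fun j _ => by ring
    have e2 : ∑ k, γ k * ((o.δ * (M.ps o.x φ₀)⁻¹ - 1) * M.zDeriv φ₀ o.x k v.2 +
        M.z φ₀ o.x k * (o.δ * ((M.g' (M.ps o.x φ₀)⁻¹ * (M.q o.x)⁻¹)⁻¹ * (M.z φ₀ o.x ⬝ᵥ w)))) =
        (o.δ * (M.ps o.x φ₀)⁻¹ - 1) * ∑ k, γ k * M.zDeriv φ₀ o.x k v.2 +
        (M.z φ₀ o.x ⬝ᵥ γ) * (o.δ * ((M.g' (M.ps o.x φ₀)⁻¹ * (M.q o.x)⁻¹)⁻¹ *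
          (M.z φ₀ o.x ⬝ᵥ w))) := by
      rw [Finset.mul_sum, show M.z φ₀ o.x ⬝ᵥ γ = ∑ k, M.z φ₀ o.x k * γ k from rfl, Finset.sum_mul, ← Finset.sum_add_distrib]
      exact Finset.sum_congr rfl fun j _ => by ring
    rw [e1, e2, regWeight]
    ring
  have hz := H.measurable_z
  have hr := H.measurable_regWeight
  have hzd := fun k => H.measurable_zDeriv_apply k v.2
  have hps := H.meas.ps φ₀
  have hres : MemLp (fun o : Obs 𝓧 => o.y - M.z φ₀ o.x ⬝ᵥ γ) 2 P := by
    refine H.memLp_y.sub ?_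
    exact memLp_finsetSum _ fun k _ => (H.memLp_z k).mul_const (γ k)
  have hI : ∀ j, Integrable (fun o : Obs 𝓧 => M.regWeight φ₀ o.x * M.z φ₀ o.x j *
      (o.y - M.z φ₀ o.x ⬝ᵥ γ)) P := fun j =>
    (H.memLp_regWeight_mul_z j).integrable_mul hres
  have hJ : Integrable (fun o : Obs 𝓧 => ∑ k, γ k * M.zDeriv φ₀ o.x k v.2) P :=
    integrable_finsetSum _ fun k _ =>
      ((H.memLp_zDeriv_apply k v.2).integrable one_le_two).const_mul (γ k)
  have hsum : Integrable (fun o : Obs 𝓧 => ∑ j, w j * (M.regWeight φ₀ o.x * M.z φ₀ o.x j *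
      (o.y - M.z φ₀ o.x ⬝ᵥ γ))) P :=
    integrable_finsetSum _ fun j _ => (hI j).const_mul (w j)
  rw [h1]
  simp only [h2]
  rw [integral_sub]
  · rw [H.integral_δ_div_sub_one_mul (h := fun z => ∑ k, γ k * M.zDeriv φ₀ z.1 k v.2)
      (by fun_prop) hJ, sub_zero]
    have hdot : Measurable fun x => M.z φ₀ x ⬝ᵥ γ := by unfold dotProduct; fun_prop
    rw [H.integral_δ_mul (fun z => ∑ j, w j * (M.regWeight φ₀ z.1 * M.z φ₀ z.1 j *
      (z.2 - M.z φ₀ z.1 ⬝ᵥ γ))) (by fun_prop)]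
    have e : ∀ o : Obs 𝓧, π₀ o.x * ∑ j, w j * (M.regWeight φ₀ o.x * M.z φ₀ o.x j *
        (o.y - M.z φ₀ o.x ⬝ᵥ γ)) = ∑ j, w j * (π₀ o.x * (M.regWeight φ₀ o.x * M.z φ₀ o.x j *
        (o.y - M.z φ₀ o.x ⬝ᵥ γ))) := fun o => by
      rw [Finset.mul_sum]
      exact Finset.sum_congr rfl fun j _ => by ring
    simp only [e]
    rw [integral_finsetSum _ fun j _ => (H.integrable_π₀_mul (hI j)).const_mul (w j)]
    refine Finset.sum_eq_zero fun j _ => ?_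
    rw [integral_const_mul, H.integral_regWeight_mul_z_mul_residual hdet j, mul_zero]
  · refine hsum.bdd_mul (c := 1) Obs.measurable_δ.aestronglyMeasurable
      (ae_of_all _ fun o => o.abs_δ_le_one)
  · exact memLp_one_iff_integrable.1 (H.memLp_δ_div_sub_one_mul (memLp_one_iff_integrable.2 hJ))

theorem ae_score_debiasVec (H : M.RegularModel P π₀ φ₀ c₀ C Q) (γ : ZIdx p d → ℝ) :
    ∀ᵐ o ∂P, M.score γ o (debiasVec p d, φ₀) =
      (fun k => (o.δ * (π₀ o.x)⁻¹ - 1) * M.z φ₀ o.x k,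
        o.δ * (π₀ o.x)⁻¹ * o.y + (1 - o.δ * (π₀ o.x)⁻¹) * (M.z φ₀ o.x ⬝ᵥ γ)) := by
  filter_upwards [H.ae_omega_debiasVec, H.ae_π₀_eq] with o h1 h2
  simp only [score, h1, h2]
  congr 1
  have : ∑ k, γ k * ((o.δ * (M.ps o.x φ₀)⁻¹ - 1) * M.z φ₀ o.x k) =
      (o.δ * (M.ps o.x φ₀)⁻¹ - 1) * (M.z φ₀ o.x ⬝ᵥ γ) := by
    rw [dotProduct, Finset.mul_sum]
    exact Finset.sum_congr rfl fun j _ => by ring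
  rw [this]
  ring

section Expansion

variable [IsProbabilityMeasure P] {Ω : Type*} [MeasurableSpace Ω] {μ : Measure Ω}
  [IsProbabilityMeasure μ] {O : ℕ → Ω → Obs 𝓧}

/-- At a root of the calibration equations the second component of the averaged score is the
estimator, and at `(debiasVec, φ₀)` it is the claimed expansion; these differ by `o_p(N^{-1/2})`. -/
theorem isLittleOInProb_sub (H : M.RegularModel P π₀ φ₀ c₀ C Q)
    (hdet : IsUnit (M.Gam P π₀ (debiasVec p d) φ₀).det)
    (hlaw : ∀ i, HasLaw (O i) P μ) (hindep : iIndepFun O μ)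
    {φhat : ℕ → Ω → EuclideanSpace ℝ (Fin d)}
    (hφ : IsBigOInProb μ (fun N ω => φhat N ω - φ₀) (fun N => (√(N : ℝ))⁻¹))
    {θhat : ℕ → Ω → ℝ}
    (hθ : ∀ N, ∀ᵐ ω ∂μ, ∀ w : Fin N → ℝ,
      M.IsGECWeights (φhat N ω) (fun i : Fin N => O i ω) w →
        θhat N ω = (N : ℝ)⁻¹ * ∑ i : Fin N, (O i ω).δ * w i * (O i ω).y) :
    IsLittleOInProb μ
      (fun N ω => θhat N ω -
        ((N : ℝ)⁻¹ * ∑ i : Fin N, (O i ω).δ * (π₀ (O i ω).x)⁻¹ * (O i ω).y +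
         (N : ℝ)⁻¹ * ∑ i : Fin N, (1 - (O i ω).δ * (π₀ (O i ω).x)⁻¹) *
            (M.z φ₀ (O i ω).x ⬝ᵥ M.gam P π₀ (debiasVec p d) φ₀)))
      (fun N => (√(N : ℝ))⁻¹) := by
  set γ := M.gam P π₀ (debiasVec p d) φ₀ with hγ
  let Γ := M.Gam P π₀ (debiasVec p d) φ₀
  let A : (ZIdx p d → ℝ) ≃L[ℝ] (ZIdx p d → ℝ) :=
    (Matrix.toLin'OfInv (Matrix.nonsing_inv_mul Γ hdet)
      (Matrix.mul_nonsing_inv Γ hdet)).toContinuousLinearEquiv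
  have hA : ∀ v, ((∫ o, M.scoreDeriv γ φ₀ o ∂P) (v, 0)).1 = A v := fun v =>
    (H.integral_scoreDeriv_fst γ v).trans (Matrix.toLin'_apply Γ v).symm
  have hbase := H.ae_score_debiasVec γ
  have hs1 : ∀ k, (fun o => (M.score γ o (debiasVec p d, φ₀)).1 k) =ᵐ[P]
      fun o => (o.δ * (M.ps o.x φ₀)⁻¹ - 1) * M.z φ₀ o.x k := fun k => by
    filter_upwards [hbase, H.ae_π₀_eq] with o h1 h2
    rw [h1, h2]
  unfold IsLittleOInProb
  rw [tendstoInMeasure_iff_norm]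
  intro ε hε
  rw [ENNReal.tendsto_nhds_zero]
  intro η hη
  -- The choice `ε / 2` makes the good event incompatible with a scaled error of at least `ε`.
  obtain ⟨K, hK, hev⟩ := exists_zero_of_isBigOInProb hlaw hindep
    (H.stronglyMeasurable_score γ) (H.ae_hasStrictFDerivAt_score γ)
    (W := fun o => C * Q o.x) ((H.measurable_Q.comp Obs.measurable_x).const_mul C)
    (H.memLp_Q.const_mul C) (H.integrable_envelope γ) (H.ae_lipschitzOnWith_score γ)
    (fun k => (memLp_congr_ae (hs1 k)).2 (H.memLp_δ_div_sub_one_mul (H.memLp_z k)))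
    (fun k => by
      rw [integral_congr_ae (hs1 k)]
      exact H.integral_δ_div_sub_one_mul (h := fun z => M.z φ₀ z.1 k)
        ((H.measurable_z k).comp measurable_fst) (H.integrable_z k))
    hA (H.integral_scoreDeriv_snd hdet) hφ hη (κ := ε / 2) (half_pos hε)
  filter_upwards [hev, eventually_gt_atTop 0] with N hN hN0
  refine le_trans (measure_mono_ae ?_) hN
  have hae : ∀ᵐ ω ∂μ, ∀ i, _ := ae_all_iff.2 fun i =>
    (hlaw i).ae_comp (hbase.and (H.ae_local.and H.ae_q_pos))
  filter_upwards [hae, hθ N] with ω hω hθω hbad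
  change ¬ _
  rintro ⟨hW, l, hl, hroot, hclose⟩
  have hNpos : (0 : ℝ) < N := by exact_mod_cast hN0
  have hs : 0 < √(N : ℝ) := Real.sqrt_pos.2 hNpos
  have hctrl : ∀ i < N, M.LocalControl φ₀ C (Q (O i ω).x) (K / √(N : ℝ)) (O i ω).x :=
    fun i hi => (hω i).2.1 _ (div_pos hK hs) (hW i hi)
  have hcal : ∀ k, ∑ i ∈ Finset.range N, ((O i ω).δ * M.omega l (φhat N ω) (O i ω).x - 1) *
      M.z (φhat N ω) (O i ω).x k = 0 := by
    intro k
    have := congrFun hroot k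
    simpa [Prod.fst_sum, score, hNpos.ne', hN0.ne'] using this
  -- The root gives one solution of the calibration problem. The hypothesis on `θhat` covers every
  -- solution, so uniqueness of the minimizer plays no role.
  have hgec := isGECWeights_of_dual (M := M) H.entropy (φ := φhat N ω)
    (s := fun i : Fin N => O i ω) (l := l)
    (fun i => (hctrl i i.2).ps_mem _ hl) (fun i => (hω i).2.2)
    (fun i => (hctrl i i.2).dual_mem _ hl) (fun k => by
      have := hcal k
      rw [Finset.sum_range] at this
      rw [← sub_eq_zero, ← Finset.sum_sub_distrib, ← this]
      exact Finset.sum_congr rfl fun i _ => by ring)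
  have hθeq := hθω _ hgec
  -- At the root the terms with coefficient `γ` sum to zero.
  have e1 : ((N : ℝ)⁻¹ • ∑ i ∈ Finset.range N, M.score γ (O i ω) (l, φhat N ω)).2 = θhat N ω := by
    rw [hθeq, Prod.smul_snd, Prod.snd_sum, smul_eq_mul]
    simp only [score, Finset.sum_sub_distrib]
    rw [Finset.sum_comm]
    simp only [← Finset.mul_sum, hcal, mul_zero, Finset.sum_const_zero, sub_zero]
    rw [Finset.sum_range]
  have e2 : ((N : ℝ)⁻¹ • ∑ i ∈ Finset.range N, M.score γ (O i ω) (debiasVec p d, φ₀)).2 =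
      (N : ℝ)⁻¹ * ∑ i : Fin N, (O i ω).δ * (π₀ (O i ω).x)⁻¹ * (O i ω).y +
         (N : ℝ)⁻¹ * ∑ i : Fin N, (1 - (O i ω).δ * (π₀ (O i ω).x)⁻¹) *
            (M.z φ₀ (O i ω).x ⬝ᵥ γ) := by
    rw [Prod.smul_snd, Prod.snd_sum, smul_eq_mul, ← mul_add, ← Finset.sum_add_distrib,
      Finset.sum_range]
    congr 1
    exact Finset.sum_congr rfl fun i _ => by rw [(hω i).1]
  rw [e1, e2] at hclose
  have hbad' : ε ≤ ‖(θhat N ω - _) / (√(N : ℝ))⁻¹ - 0‖ := hbad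
  rw [sub_zero, div_inv_eq_mul, norm_mul, Real.norm_eq_abs, Real.norm_of_nonneg hs.le] at hbad'
  rw [le_div_iff₀ hs] at hclose
  linarith

end Expansion

end GECSpec.RegularModel

/-! ### Mean and variance of the influence function -/

namespace GECSpec

variable {𝓧 : Type*} {p d : ℕ} [MeasurableSpace 𝓧] {M : GECSpec 𝓧 p d} {P : Measure (Obs 𝓧)}
  {π₀ : 𝓧 → ℝ} {φ₀ : EuclideanSpace ℝ (Fin d)}

namespace RegularModel

variable {c₀ C : ℝ} {Q : 𝓧 → ℝ}

theorem memLp_residual (H : M.RegularModel P π₀ φ₀ c₀ C Q) (γ : ZIdx p d → ℝ) :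
    MemLp (fun o : Obs 𝓧 => o.y - M.z φ₀ o.x ⬝ᵥ γ) 2 P :=
  H.memLp_y.sub (memLp_finsetSum _ fun k _ => (H.memLp_z k).mul_const (γ k))

theorem measurable_residual (H : M.RegularModel P π₀ φ₀ c₀ C Q) (γ : ZIdx p d → ℝ) :
    Measurable fun z : 𝓧 × ℝ => z.2 - M.z φ₀ z.1 ⬝ᵥ γ := by
  have hz := H.measurable_z
  unfold dotProduct
  fun_prop

theorem ae_abs_inv_le (H : M.RegularModel P π₀ φ₀ c₀ C Q) :
    ∀ᵐ o ∂P, |(M.ps o.x φ₀)⁻¹| ≤ c₀⁻¹ := by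
  filter_upwards [H.ae_overlap] with o ho
  rw [abs_of_pos (inv_pos.2 (H.c₀_pos.trans_le ho.1))]
  exact inv_anti₀ H.c₀_pos ho.1

theorem integrable_inv_sub_mul_sq (H : M.RegularModel P π₀ φ₀ c₀ C Q) (γ : ZIdx p d → ℝ)
    (t : ℝ) : Integrable (fun o : Obs 𝓧 => ((M.ps o.x φ₀)⁻¹ - t) *
      (o.y - M.z φ₀ o.x ⬝ᵥ γ) ^ 2) P := by
  refine (H.memLp_residual γ).integrable_sq.bdd_mul (c := c₀⁻¹ + |t|)
    (((H.meas.ps φ₀).comp Obs.measurable_x).inv.sub_const t).aestronglyMeasurable ?_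
  filter_upwards [H.ae_abs_inv_le] with o ho
  exact (abs_sub _ _).trans (by linarith)

/-- The influence function of the estimator is `Y` plus a weighted residual. -/
theorem ae_influence_eq (H : M.RegularModel P π₀ φ₀ c₀ C Q) (γ : ZIdx p d → ℝ) :
    (fun o : Obs 𝓧 => o.δ * (π₀ o.x)⁻¹ * o.y +
      (1 - o.δ * (π₀ o.x)⁻¹) * (M.z φ₀ o.x ⬝ᵥ γ)) =ᵐ[P]
      Obs.y + fun o => (o.δ * (M.ps o.x φ₀)⁻¹ - 1) * (o.y - M.z φ₀ o.x ⬝ᵥ γ) := by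
  filter_upwards [H.ae_π₀_eq] with o ho
  simp only [Pi.add_apply, ho]
  ring

theorem integral_δ_div_sub_one_mul_residual [IsProbabilityMeasure P]
    (H : M.RegularModel P π₀ φ₀ c₀ C Q) (γ : ZIdx p d → ℝ) :
    ∫ o, (o.δ * (M.ps o.x φ₀)⁻¹ - 1) * (o.y - M.z φ₀ o.x ⬝ᵥ γ) ∂P = 0 :=
  H.integral_δ_div_sub_one_mul (H.measurable_residual γ)
    ((H.memLp_residual γ).integrable one_le_two)

theorem integral_influence [IsProbabilityMeasure P]
    (H : M.RegularModel P π₀ φ₀ c₀ C Q) (γ : ZIdx p d → ℝ) :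
    ∫ o : Obs 𝓧, (o.δ * (π₀ o.x)⁻¹ * o.y +
      (1 - o.δ * (π₀ o.x)⁻¹) * (M.z φ₀ o.x ⬝ᵥ γ)) ∂P = ∫ o, o.y ∂P := by
  rw [integral_congr_ae (H.ae_influence_eq γ)]
  simp only [Pi.add_apply]
  rw [integral_add (H.memLp_y.integrable one_le_two)
    ((H.memLp_δ_div_sub_one_mul (H.memLp_residual γ)).integrable one_le_two),
    H.integral_δ_div_sub_one_mul_residual γ, add_zero]

theorem memLp_influence (H : M.RegularModel P π₀ φ₀ c₀ C Q) (γ : ZIdx p d → ℝ) :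
    MemLp (fun o : Obs 𝓧 => o.δ * (π₀ o.x)⁻¹ * o.y +
      (1 - o.δ * (π₀ o.x)⁻¹) * (M.z φ₀ o.x ⬝ᵥ γ)) 2 P :=
  (memLp_congr_ae (H.ae_influence_eq γ)).2
    (H.memLp_y.add (H.memLp_δ_div_sub_one_mul (H.memLp_residual γ)))

/-- The influence function is `Y + (δ/π - 1) R` with `R` the regression residual. The second summand
has mean zero even after multiplication by `Y`, so it is uncorrelated with `Y`. -/
theorem variance_influence [IsProbabilityMeasure P]
    (H : M.RegularModel P π₀ φ₀ c₀ C Q) (γ : ZIdx p d → ℝ) :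
    variance (fun o : Obs 𝓧 => o.δ * (π₀ o.x)⁻¹ * o.y +
      (1 - o.δ * (π₀ o.x)⁻¹) * (M.z φ₀ o.x ⬝ᵥ γ)) P =
      variance (Obs.y (𝓧 := 𝓧)) P +
        ∫ o, ((M.ps o.x φ₀)⁻¹ - 1) * (o.y - M.z φ₀ o.x ⬝ᵥ γ) ^ 2 ∂P := by
  have hR := H.memLp_residual γ
  have he := H.memLp_δ_div_sub_one_mul hR
  have hRm := H.measurable_residual γ
  have he0 := H.integral_δ_div_sub_one_mul_residual γ
  have hcov : covariance (Obs.y (𝓧 := 𝓧))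
      (fun o => (o.δ * (M.ps o.x φ₀)⁻¹ - 1) * (o.y - M.z φ₀ o.x ⬝ᵥ γ)) P = 0 := by
    rw [covariance_eq_sub H.memLp_y he, he0, mul_zero, sub_zero]
    rw [← H.integral_δ_div_sub_one_mul (h := fun z => z.2 * (z.2 - M.z φ₀ z.1 ⬝ᵥ γ))
      (measurable_snd.mul hRm) (H.memLp_y.integrable_mul hR)]
    refine integral_congr_ae (ae_of_all _ fun o => ?_)
    simp only [Pi.mul_apply]
    ring
  rw [variance_congr (H.ae_influence_eq γ), variance_add H.memLp_y he, hcov, mul_zero, add_zero,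
    variance_eq_sub he, he0]
  congr 1
  have hint2 : Integrable (fun o : Obs 𝓧 => ((M.ps o.x φ₀)⁻¹ - 2) *
      (o.y - M.z φ₀ o.x ⬝ᵥ γ) ^ 2) P := H.integrable_inv_sub_mul_sq γ 2
  have h0 := H.integral_δ_div_sub_one_mul
    (h := fun z => ((M.ps z.1 φ₀)⁻¹ - 2) * (z.2 - M.z φ₀ z.1 ⬝ᵥ γ) ^ 2)
    ((((H.meas.ps φ₀).comp measurable_fst).inv.sub_const 2).mul (hRm.pow_const 2)) hint2
  -- As `δ² = δ`, the square of `δ/π - 1` equals `(δ/π - 1)(1/π - 2) + (1/π - 1)`, whose first term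
  -- integrates to zero against functions of `(x, y)`.
  have hsplit : ∀ o : Obs 𝓧, (((fun o : Obs 𝓧 => (o.δ * (M.ps o.x φ₀)⁻¹ - 1) *
      (o.y - M.z φ₀ o.x ⬝ᵥ γ)) ^ 2) o) =
      (o.δ * (M.ps o.x φ₀)⁻¹ - 1) * (((M.ps o.x φ₀)⁻¹ - 2) * (o.y - M.z φ₀ o.x ⬝ᵥ γ) ^ 2) +
      ((M.ps o.x φ₀)⁻¹ - 1) * (o.y - M.z φ₀ o.x ⬝ᵥ γ) ^ 2 := by
    intro o
    simp only [Pi.pow_apply]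
    rcases o.δ_eq_zero_or_one with h | h <;> rw [h] <;> ring
  simp only [hsplit]
  rw [integral_add (memLp_one_iff_integrable.1
    (H.memLp_δ_div_sub_one_mul (memLp_one_iff_integrable.2 hint2)))
    (H.integrable_inv_sub_mul_sq γ 1), h0]
  ring

theorem VGEC_eq_variance_influence (H : M.RegularModel P π₀ φ₀ c₀ C Q) :
    M.VGEC P π₀ (debiasVec p d) φ₀ = variance (fun o : Obs 𝓧 => o.δ * (π₀ o.x)⁻¹ * o.y +
      (1 - o.δ * (π₀ o.x)⁻¹) * (M.z φ₀ o.x ⬝ᵥ M.gam P π₀ (debiasVec p d) φ₀)) P := by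
  refine variance_congr ?_
  filter_upwards [H.ae_omega_debiasVec, H.ae_π₀_eq] with o h1 h2
  rw [h1, h2]

end RegularModel

/-! ### Verification of the regular model from the stated conditions -/

/-- The compact range lies between its extreme points; since `V` is open and an interval, both ends
can be moved outwards within `V`. The gap leaves room for the propensity to vary with the parameter.
-/
theorem OverlapCond.exists_Icc_subset {c₀ : ℝ} [IsProbabilityMeasure P] (hG : M.EntropyCond)
    (h : M.OverlapCond P π₀ c₀) :
    ∃ a' a b b' : ℝ, 0 < a' ∧ a' < a ∧ a ≤ b ∧ b < b' ∧ Set.Icc a' b' ⊆ M.V ∧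
      ∀ᵐ o ∂P, (π₀ o.x)⁻¹ ∈ Set.Icc a b := by
  obtain ⟨K, hK, hKV, hae⟩ := h.domain
  obtain ⟨o, ho⟩ := hae.exists
  have hne : K.Nonempty := ⟨_, ho⟩
  obtain ⟨a, ha, hmin⟩ := hK.exists_isLeast hne
  obtain ⟨b, hb, hmax⟩ := hK.exists_isGreatest hne
  obtain ⟨e₁, he₁, h₁⟩ := Metric.isOpen_iff.1 hG.isOpen a (hKV ha)
  obtain ⟨e₂, he₂, h₂⟩ := Metric.isOpen_iff.1 hG.isOpen b (hKV hb)
  have ha' : a - e₁ / 2 ∈ M.V := h₁ (by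
    rw [Metric.mem_ball, Real.dist_eq, sub_sub_cancel_left, abs_neg, abs_of_pos (half_pos he₁)]
    exact half_lt_self he₁)
  have hb' : b + e₂ / 2 ∈ M.V := h₂ (by
    rw [Metric.mem_ball, Real.dist_eq, add_sub_cancel_left, abs_of_pos (half_pos he₂)]
    exact half_lt_self he₂)
  refine ⟨a - e₁ / 2, a, b, b + e₂ / 2, hG.pos ha', by linarith, hmin hb, by linarith,
    hG.ordConnected.out ha' hb', ?_⟩
  filter_upwards [hae] with o ho
  exact ⟨hmin ho, hmax ho⟩

theorem exists_envelopeAt [IsProbabilityMeasure P] {c₀ c ε a b : ℝ} (hc : 0 < c)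
    (hmeas : M.MeasurabilityCond) (hoverlap : M.OverlapCond P π₀ c₀)
    (hps : M.PropensityCond P φ₀ c₀ c ε) (hcov : M.CovariateCond P φ₀ c)
    (hRP : ∀ᵐ o ∂P, π₀ o.x = M.ps o.x φ₀) (hab : ∀ᵐ o ∂P, (π₀ o.x)⁻¹ ∈ Set.Icc a b) :
    ∃ Q : 𝓧 → ℝ, Measurable Q ∧ MemLp (fun o => Q o.x) 2 P ∧
      ∀ᵐ o ∂P, M.EnvelopeAt φ₀ c₀ a b ε (Q o.x) o.x := by
  obtain ⟨B₁, hB₁m, hB₁0, hB₁L, hB₁⟩ := exists_measurable_envelope (P := P) Obs.measurable_x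
    (h := fun x φ => ‖M.ps' x φ‖) (fun _ _ => norm_nonneg _)
    (fun x => (contDiff_ps' (hps.contDiff x)).continuous.norm)
    (fun φ => (measurable_ps' hmeas hps.contDiff φ).norm) (by linarith) hps.moment_grad
  obtain ⟨B₂, hB₂m, hB₂0, hB₂L, hB₂⟩ := exists_measurable_envelope (P := P) Obs.measurable_x
    (h := M.hessFrob) (fun _ _ => Real.sqrt_nonneg _)
    (fun x => continuous_hessFrob (hps.contDiff x))
    (fun φ => measurable_hessFrob hmeas hps.contDiff φ) (by linarith) hps.moment_hess
  have h24 : (2 : ENNReal) ≤ ENNReal.ofReal (2 + c) := by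
    calc (2 : ENNReal) = ENNReal.ofReal 2 := by simp
      _ ≤ _ := ENNReal.ofReal_le_ofReal (by linarith)
  have h44 : (4 : ENNReal) ≤ ENNReal.ofReal (4 + c) := by
    calc (4 : ENNReal) = ENNReal.ofReal 4 := by simp
      _ ≤ _ := ENNReal.ofReal_le_ofReal (by linarith)
  have hB₂L2 : MemLp (fun o : Obs 𝓧 => B₂ o.x) 2 P := hB₂L.mono_exponent h24
  have hB₁L4 : MemLp (fun o : Obs 𝓧 => B₁ o.x) 4 P := hB₁L.mono_exponent h44
  have hB₁L2 : MemLp (fun o : Obs 𝓧 => B₁ o.x ^ 2) 2 P := by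
    have hm : Measurable fun o : Obs 𝓧 => B₁ o.x ^ 2 := (hB₁m.comp Obs.measurable_x).pow_const 2
    rw [memLp_two_iff_integrable_sq hm.aestronglyMeasurable]
    have := hB₁L4.integrable_norm_pow (p := 4) (by norm_num)
    refine this.congr (ae_of_all _ fun o => ?_)
    simp only [Real.norm_of_nonneg (hB₁0 _)]
    ring
  have hbL : ∀ j, MemLp (fun o : Obs 𝓧 => |M.b o.x j|) 2 P := by
    intro j
    have hbm : Measurable fun o : Obs 𝓧 => M.b o.x j := (hmeas.b j).comp Obs.measurable_x
    have : MemLp (fun o : Obs 𝓧 => M.b o.x j) (ENNReal.ofReal (2 + c)) P := by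
      refine ⟨hbm.aestronglyMeasurable, ?_⟩
      have h2c : 0 < 2 + c := by linarith
      rw [eLpNorm_lt_top_iff_lintegral_rpow_enorm_lt_top (by simpa using h2c)
        ENNReal.ofReal_ne_top, ENNReal.toReal_ofReal h2c.le]
      refine lt_of_le_of_lt (le_of_eq (lintegral_congr fun o => ?_)) (hcov.moment j)
      rw [Real.enorm_eq_ofReal_abs, ENNReal.ofReal_rpow_of_nonneg (abs_nonneg _) h2c.le]
    exact (this.mono_exponent h24).abs
  -- The gradient envelope enters squared, which is where its moment of order `4 + c` is needed for
  -- a square integrable `Q`; the other two envelopes enter linearly and need only order `2 + c`.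
  refine ⟨fun x => 1 + ∑ j, |M.b x j| + B₁ x ^ 2 + B₂ x, ?_, ?_, ?_⟩
  · have hb : Measurable fun x => ∑ j, |M.b x j| :=
      Finset.measurable_fun_sum _ fun j _ => measurable_norm.comp (hmeas.b j)
    exact ((hb.const_add 1).add (hB₁m.pow_const 2)).add hB₂m
  · have h0 : MemLp (fun _ : Obs 𝓧 => (1 : ℝ)) 2 P := memLp_const 1
    have h1 : MemLp (fun o : Obs 𝓧 => ∑ j, |M.b o.x j|) 2 P :=
      memLp_finsetSum _ fun j _ => hbL j
    exact ((h0.add h1).add hB₁L2).add hB₂L2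
  · filter_upwards [hB₁, hB₂, hoverlap.weight, hRP, hab] with o h1 h2 h3 h4 h5
    have hs : 0 ≤ ∑ j, |M.b o.x j| := Finset.sum_nonneg fun j _ => abs_nonneg _
    have hb2 := hB₂0 o.x
    have hb1 := sq_nonneg (B₁ o.x)
    refine ⟨by linarith, hps.contDiff o.x, h4 ▸ h5, h3.1, fun j => ?_, fun φ hφ => ?_,
      fun φ hφ => ?_, h3.2⟩
    · have := Finset.single_le_sum (f := fun j => |M.b o.x j|) (fun j _ => abs_nonneg _)
        (Finset.mem_univ j)
      linarith
    · have := pow_le_pow_left₀ (norm_nonneg _) (h1 φ hφ) 2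
      linarith
    · have := h2 φ hφ
      linarith

theorem exists_regularModel [StandardBorelSpace 𝓧] [IsProbabilityMeasure P]
    (hY : MemLp Obs.y 2 P) (hMAR : IsMAR P) (hπ₀ : IsPropensityScore P π₀)
    {c₀ c ε : ℝ} (hc₀ : 0 < c₀) (hc : 0 < c) (hε : 0 < ε)
    (hmeas : M.MeasurabilityCond) (hG : M.EntropyCond) (hoverlap : M.OverlapCond P π₀ c₀)
    (hps : M.PropensityCond P φ₀ c₀ c ε) (hcov : M.CovariateCond P φ₀ c)
    (hRP : ∀ᵐ o ∂P, π₀ o.x = M.ps o.x φ₀) :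
    ∃ (C : ℝ) (Q : 𝓧 → ℝ), M.RegularModel P π₀ φ₀ c₀ C Q := by
  obtain ⟨a', a, b, b', ha', haa', hab, hbb', hV, hmem⟩ := hoverlap.exists_Icc_subset hG
  obtain ⟨Q, hQm, hQL, hQ⟩ := exists_envelopeAt hc hmeas hoverlap hps hcov hRP hmem
  obtain ⟨C, hC, hloc⟩ := exists_localControl hG hc₀ hε ha' haa' hab hbb' hV
  refine ⟨C, Q, hG, hmeas, hps.contDiff, hY, hπ₀.1,
    fun h hh => hMAR.integral_δ_mul hπ₀ ?_ hh, hc₀, hC, hQm, hQL, ?_, hRP, ?_, ?_, ?_, ?_⟩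
  · filter_upwards [hoverlap.overlap] with o ho
    exact ⟨hc₀.le.trans ho.1, by linarith [ho.2]⟩
  · filter_upwards [hQ] with o ho using ho.one_le
  · filter_upwards [hps.overlap] with o ho
    exact ⟨ho.1, by linarith [ho.2]⟩
  · filter_upwards [hQ] with o ho using hc₀.trans_le ho.q_ge
  · filter_upwards [hQ] with o ho
    exact hV ⟨haa'.le.trans ho.ps_mem.1, ho.ps_mem.2.trans hbb'.le⟩
  · filter_upwards [hQ] with o ho using hloc φ₀ (Q o.x) o.x ho

end GECSpec

/-! ### Central limit theorem and conclusion -/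

theorem tendstoInDistribution_sqrt_mul_average_sub {S Ω : Type*} [MeasurableSpace S]
    [MeasurableSpace Ω] {P : Measure S} {μ : Measure Ω} [IsProbabilityMeasure μ]
    {O : ℕ → Ω → S} (hlaw : ∀ i, HasLaw (O i) P μ)
    (hindep : iIndepFun O μ) {T : S → ℝ} (hT : MemLp T 2 P) :
    TendstoInDistribution
      (fun (N : ℕ) ω => √(N : ℝ) * ((N : ℝ)⁻¹ * ∑ i ∈ Finset.range N, T (O i ω) - ∫ o, T o ∂P))
      atTop (id : ℝ → ℝ) (fun _ => μ) (gaussianReal 0 (variance T P).toNNReal) := by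
  have hTm : ∀ i, AEMeasurable T (Measure.map (O i) μ) := fun i => by
    rw [(hlaw i).map_eq]; exact hT.1.aemeasurable
  have hident : ∀ i, IdentDistrib (fun ω => T (O i ω)) T μ P := fun i => by
    have : IdentDistrib (O i) id μ P :=
      ⟨(hlaw i).aemeasurable, aemeasurable_id, by rw [(hlaw i).map_eq, Measure.map_id]⟩
    exact this.comp_of_aemeasurable (hTm i)
  have h := tendstoInDistribution_inv_sqrt_mul_sum_sub (P := μ)
    (X := fun i ω => T (O i ω)) (Y := (id : ℝ → ℝ))
    (P' := gaussianReal 0 (variance T P).toNNReal)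
    (by rw [(hident 0).variance_eq]; exact HasLaw.id)
    ((hident 0).memLp_iff.2 hT)
    (hindep.comp₀ (fun _ => T) (fun i => (hlaw i).aemeasurable) hTm)
    (fun i => (hident i).trans (hident 0).symm)
  rw [(hident 0).integral_eq] at h
  convert h using 3 with N ω
  -- At `N = 0` both normalizations give zero.
  rcases Nat.eq_zero_or_pos N with h0 | h0
  · simp [h0]
  · have hN : (0 : ℝ) < N := by exact_mod_cast h0
    have hs : 0 < √(N : ℝ) := Real.sqrt_pos.2 hN
    have hss : √(N : ℝ) * √(N : ℝ) = N := Real.mul_self_sqrt hN.le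
    field_simp
    rw [Real.sq_sqrt hN.le]

end

theorem corollary2
    {𝓧 : Type*} [MeasurableSpace 𝓧] [StandardBorelSpace 𝓧] {p d : ℕ}
    (M : GECSpec 𝓧 p d)
    -- the population: the law `P` of `(X, Y, δ)`, missing at random, with propensity score `π₀`
    (P : Measure (Obs 𝓧)) [IsProbabilityMeasure P] (hY : MemLp Obs.y 2 P)
    (hMAR : IsMAR P) (π₀ : 𝓧 → ℝ) (hπ₀ : IsPropensityScore P π₀)
    -- an i.i.d. sample
    {Ω : Type*} [MeasurableSpace Ω] (μ : Measure Ω) [IsProbabilityMeasure μ]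
    (O : ℕ → Ω → Obs 𝓧) (hlaw : ∀ i, HasLaw (O i) P μ) (hindep : iIndepFun O μ)
    -- regularity conditions, with the parameter limit `φ₀` and the multiplier limit `lam`
    (c₀ c ε : ℝ) (hc₀ : c₀ ∈ Set.Ioo (0 : ℝ) (1 / 2)) (hc : 0 < c) (hε : 0 < ε)
    (φ₀ : EuclideanSpace ℝ (Fin d)) (lam : ZIdx p d → ℝ)
    (hmeas : M.MeasurabilityCond)
    (hG : M.EntropyCond)
    (hoverlap : M.OverlapCond P π₀ c₀)
    (hps : M.PropensityCond P φ₀ c₀ c ε)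
    (hnuis : M.NuisanceCond P π₀ lam φ₀)
    (hcov : M.CovariateCond P φ₀ c)
    -- the estimated parameter is root-`N` consistent
    (φhat : ℕ → Ω → EuclideanSpace ℝ (Fin d)) (hφmeas : ∀ N, AEMeasurable (φhat N) μ)
    (hφ : IsBigOInProb μ (fun N ω => φhat N ω - φ₀) (fun N => (√(N : ℝ))⁻¹))
    -- the propensity model is correct
    (hRP : ∀ᵐ o ∂P, π₀ o.x = M.ps o.x φ₀)
    -- the estimator, arbitrary where the calibration problem has no solution
    (θhat : ℕ → Ω → ℝ) (hθmeas : ∀ N, AEMeasurable (θhat N) μ)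
    (hθ : ∀ N, ∀ᵐ ω ∂μ, ∀ w : Fin N → ℝ,
      M.IsGECWeights (φhat N ω) (fun i : Fin N => O i ω) w →
        θhat N ω = (N : ℝ)⁻¹ * ∑ i : Fin N, (O i ω).δ * w i * (O i ω).y) :
    -- the asymptotic expansion
    IsLittleOInProb μ
      (fun N ω => θhat N ω -
        ((N : ℝ)⁻¹ * ∑ i : Fin N, (O i ω).δ * (π₀ (O i ω).x)⁻¹ * (O i ω).y +
         (N : ℝ)⁻¹ * ∑ i : Fin N, (1 - (O i ω).δ * (π₀ (O i ω).x)⁻¹) *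
            (M.z φ₀ (O i ω).x ⬝ᵥ M.gam P π₀ lam φ₀)))
      (fun N => (√(N : ℝ))⁻¹) ∧
    -- `V_GEC` is the asymptotic variance of the estimator
    TendstoInDistribution (fun (N : ℕ) ω => √(N : ℝ) * (θhat N ω - ∫ o, o.y ∂P)) atTop
      (id : ℝ → ℝ) (fun _ => μ) (gaussianReal 0 (M.VGEC P π₀ lam φ₀).toNNReal) ∧
    -- the formula for `V_GEC`
    Integrable (fun o : Obs 𝓧 => ((π₀ o.x)⁻¹ - 1) *
      (o.y - M.z φ₀ o.x ⬝ᵥ M.gam P π₀ lam φ₀) ^ 2) P ∧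
    M.VGEC P π₀ lam φ₀ = variance (Obs.y (𝓧 := 𝓧)) P +
      ∫ o, ((π₀ o.x)⁻¹ - 1) * (o.y - M.z φ₀ o.x ⬝ᵥ M.gam P π₀ lam φ₀) ^ 2 ∂P := by
  obtain ⟨C, Q, H⟩ := GECSpec.exists_regularModel hY hMAR hπ₀ hc₀.1 hc hε hmeas hG hoverlap hps
    hcov hRP
  -- Uniqueness of the multiplier identifies the abstract `lam` with the explicit solution, so that
  -- `ω*` becomes `1/π₀`.
  obtain rfl : lam = GECSpec.debiasVec p d :=
    (hnuis.lam_unique _ H.isPopLambda_debiasVec).symm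
  have hexp := H.isLittleOInProb_sub hnuis.gam_unique hlaw hindep hφ hθ
  refine ⟨hexp, ?_, ?_, ?_⟩
  · have hclt := tendstoInDistribution_sqrt_mul_average_sub hlaw hindep
      (H.memLp_influence (M.gam P π₀ (GECSpec.debiasVec p d) φ₀))
    rw [H.integral_influence, ← H.VGEC_eq_variance_influence] at hclt
    -- Slutsky's theorem: after multiplication by `√N` the remainder of the expansion tends to zero
    -- in probability.
    refine tendstoInDistribution_of_tendstoInMeasure_sub _ _ hclt ?_
      fun N => ((hθmeas N).sub_const _).const_mul _
    refine hexp.congr_left fun N => ae_of_all _ fun ω => ?_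
    simp only [Pi.sub_apply, Finset.sum_range, Finset.sum_add_distrib, div_inv_eq_mul]
    ring
  · refine (H.integrable_inv_sub_mul_sq
      (M.gam P π₀ (GECSpec.debiasVec p d) φ₀) 1).congr ?_
    filter_upwards [hRP] with o ho
    rw [ho]
  · rw [H.VGEC_eq_variance_influence, H.variance_influence]
    congr 1
    refine integral_congr_ae ?_
    filter_upwards [hRP] with o ho
    rw [ho]
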